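/- All graphs are finite, simple and undirected, with $n\ge 1$ vertices and $m$ edges. For vertices $a,b$ of $G$ let $d(a,b)$ be the length of a shortest $a$-$b$ path ($\infty$ if $a$ and $b$ lie in different connected components). For vertices $a,b,c,d$ let $D_1=d(a,b)+d(c,d)$, $D_2=d(a,c)+d(b,d)$, $D_3=d(a,d)+d(b,c)$, and let $\delta(a,b,c,d)=|D_i-D_j|$, where $\{i,j,k\}=\{1,2,3\}$ and $D_k\le\min\{D_i,D_j\}$ (with $|\infty-\infty|=0$). The hyperbolicity of $G$ is $\delta(G)=\max_{a,b,c,d}\delta(a,b,c,d)$, and $G$ is $\delta$-hyperbolic if $\delta(G)\le\delta$; equivalently, $d(a,b)+d(c,d)\le\max\{d(a,c)+d(b,d),\,d(a,d)+d(b,c)\}+\delta$ for all vertices $a,b,c,d$. The problem Hyperbolicity asks, given a graph $G$ (by adjacency lists) and a positive integer $\delta$, whether $G$ is $\delta$-hyperbolic. A maximal path of $G$ is a path $P$ (with distinct vertices) such that (1) $P$ has at least two vertices; (2) all inner vertices of $P$ have degree two in $G$; (3) either both endpoints of $P$ have degree at least three in $G$, or one endpoint has degree at least three and the other has degree two; and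 (4) no longer path satisfying (1)-(3) contains $P$ as a subpath. The minimum maximal paths cover number of $G$ is the smallest number of maximal paths that together contain all vertices of $G$; it is undefined if the maximal paths of $G$ do not cover all vertices. Theorem. Hyperbolicity can be solved in $O(k^4(n+m))$ time, where $k$ is the minimum maximal paths cover number of $G$. Precisely, there are a constant $C$ and a single program for a word RAM (unit-cost addition, truncated subtraction, multiplication, integer division, comparison and indirect memory access; words of $O(\log(n+m+\delta))$ bits) that decides Hyperbolicity on every input $(G,\delta)$ and that takes at most $C\,k^4(n+m)$ steps whenever $G$ has a minimum maximal paths cover number $k$. -/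

import Mathlib

namespace HypRAM

/-! ### Hyperbolicity of graphs -/

section Hyperbolicity

variable {V : Type*}

/-- `|x - y|` for extended natural numbers; truncated subtraction makes `|∞ - ∞| = 0`. -/
noncomputable def absDiff (x y : ℕ∞) : ℕ∞ := max (x - y) (y - x)

/-- The value `δ(a,b,c,d)`: with the distance sums `D₁ = d(a,b) + d(c,d)`,
`D₂ = d(a,c) + d(b,d)` and `D₃ = d(a,d) + d(b,c)`, it is `|Dᵢ - Dⱼ|`, where
`{i,j,k} = {1,2,3}` and `Dₖ ≤ min (Dᵢ, Dⱼ)`. Vertices in different connected components are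
at distance `∞`. -/
noncomputable def quadDelta (G : SimpleGraph V) (a b c d : V) : ℕ∞ :=
  let D₁ := G.edist a b + G.edist c d
  let D₂ := G.edist a c + G.edist b d
  let D₃ := G.edist a d + G.edist b c
  if D₁ ≤ min D₂ D₃ then absDiff D₂ D₃
  else if D₂ ≤ min D₁ D₃ then absDiff D₁ D₃
  else absDiff D₁ D₂

/-- The hyperbolicity `δ(G)`, the maximum of `δ(a,b,c,d)` over all quadruples of vertices. -/
noncomputable def hyperbolicity (G : SimpleGraph V) : ℕ∞ :=
  ⨆ (a : V) (b : V) (c : V) (d : V), quadDelta G a b c d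

/-- `G` is `δ`-hyperbolic if its hyperbolicity is at most `δ`. -/
def IsHyperbolic (G : SimpleGraph V) (δ : ℕ) : Prop := hyperbolicity G ≤ (δ : ℕ∞)

/-- The equivalent four-point condition. -/
theorem isHyperbolic_iff (G : SimpleGraph V) (δ : ℕ) :
    IsHyperbolic G δ ↔ ∀ a b c d : V, G.edist a b + G.edist c d ≤
      max (G.edist a c + G.edist b d) (G.edist a d + G.edist b c) + (δ : ℕ∞) := by
  have key : ∀ a b c d : V, quadDelta G a b c d ≤ (δ : ℕ∞) →
      G.edist a b + G.edist c d ≤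
        max (G.edist a c + G.edist b d) (G.edist a d + G.edist b c) + (δ : ℕ∞) := by
    intro a b c d h
    unfold quadDelta at h
    generalize G.edist a b + G.edist c d = x at h ⊢
    generalize G.edist a c + G.edist b d = y at h ⊢
    generalize G.edist a d + G.edist b c = z at h ⊢
    dsimp only [absDiff] at h
    split_ifs at h with h1 h2
    · exact (h1.trans (min_le_left _ _)).trans
        ((le_max_left y z).trans (le_self_add (a := max y z) (b := (δ : ℕ∞))))
    · have h3 := tsub_le_iff_right.1 ((le_max_left _ _).trans h)
      rw [add_comm] at h3
      exact h3.trans (by gcongr; exact le_max_right y z)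
    · have h3 := tsub_le_iff_right.1 ((le_max_left _ _).trans h)
      rw [add_comm] at h3
      exact h3.trans (by gcongr; exact le_max_left y z)
  constructor
  · intro h a b c d
    refine key a b c d (le_trans ?_ h)
    exact le_iSup_of_le a (le_iSup_of_le b (le_iSup_of_le c (le_iSup_of_le d le_rfl)))
  · intro h
    refine iSup_le fun a => iSup_le fun b => iSup_le fun c => iSup_le fun d => ?_
    have e1 := h a b c d
    have e2 := h a c b d
    have e3 := h a d b c
    rw [G.edist_comm (u := c) (v := b)] at e2
    rw [G.edist_comm (u := d) (v := c), G.edist_comm (u := d) (v := b)] at e3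
    unfold quadDelta
    generalize G.edist a b + G.edist c d = x at e1 e2 e3 ⊢
    generalize G.edist a c + G.edist b d = y at e1 e2 e3 ⊢
    generalize G.edist a d + G.edist b c = z at e1 e2 e3 ⊢
    dsimp only [absDiff]
    have aux : ∀ u v w : ℕ∞, u ≤ w → v ≤ max u w + (δ : ℕ∞) → v - w ≤ (δ : ℕ∞) := by
      intro u v w huw hv
      rw [max_eq_right huw, add_comm] at hv
      exact tsub_le_iff_right.2 hv
    split_ifs with h1 h2
    · rw [le_min_iff] at h1
      refine max_le (aux x y z h1.2 e2) (aux x z y h1.1 e3)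
    · rw [le_min_iff] at h2
      refine max_le (aux y x z h2.2 e1) (aux y z x h2.1 ?_)
      rwa [max_comm]
    · rw [le_min_iff, not_and_or, not_le, not_le] at h1 h2
      have hz : z ≤ x ∧ z ≤ y := by
        rcases h1 with h1 | h1 <;> rcases h2 with h2 | h2 <;> constructor <;> order
      refine max_le (aux z x y hz.2 ?_) (aux z y x hz.1 ?_)
      · rwa [max_comm]
      · rwa [max_comm]

end Hyperbolicity

/-! ### Maximal paths and the minimum maximal paths cover number -/

section MaximalPaths

variable {V : Type*} [Fintype V]

/-- A path with at least two vertices whose inner vertices all have degree two and such that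
both endpoints have degree at least three, or one has degree at least three and the other
has degree two. -/
structure IsSegment (G : SimpleGraph V) [DecidableRel G.Adj] {u v : V} (p : G.Walk u v) :
    Prop where
  isPath : p.IsPath
  two_vertices : 2 ≤ p.support.length
  inner : ∀ w ∈ p.support, w ≠ u → w ≠ v → G.degree w = 2
  ends : (3 ≤ G.degree u ∧ 3 ≤ G.degree v) ∨ (3 ≤ G.degree u ∧ G.degree v = 2) ∨
    (G.degree u = 2 ∧ 3 ≤ G.degree v)

/-- A maximal path: a path as above that no longer such path extends. -/
structure IsMaximalPath (G : SimpleGraph V) [DecidableRel G.Adj] {u v : V} (p : G.Walk u v) :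
    Prop where
  isSegment : IsSegment G p
  maximal : ∀ {x y : V} (q : G.Walk x y), IsSegment G q → p.IsSubwalk q → q.length ≤ p.length

/-- A finite set of maximal paths that together contain all vertices. -/
def IsMaximalPathsCover (G : SimpleGraph V) [DecidableRel G.Adj]
    (S : Finset (Σ (u : V) (v : V), G.Walk u v)) : Prop :=
  (∀ P ∈ S, IsMaximalPath G P.2.2) ∧ ∀ w : V, ∃ P ∈ S, w ∈ P.2.2.support

/-- The minimum maximal paths cover number; it is `∞` if maximal paths cannot cover `G`. -/
noncomputable def coverNumber (G : SimpleGraph V) [DecidableRel G.Adj] : ℕ∞ :=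
  ⨅ (S : Finset (Σ (u : V) (v : V), G.Walk u v)) (_ : IsMaximalPathsCover G S), (S.card : ℕ∞)

end MaximalPaths

/-! ### Random access machine with a step count

Programs of a word RAM in structured form. There are registers, addressed by constants of the
program, and a memory, addressed indirectly through registers. -/

/-- Arithmetic operations on words (truncated subtraction, division rounding down). -/
inductive Op where
  | add
  | sub
  | mul
  | div

/-- The value of an arithmetic operation. -/
def Op.eval : Op → ℕ → ℕ → ℕ
  | .add, x, y => x + y
  | .sub, x, y => x - y
  | .mul, x, y => x * y
  | .div, x, y => x / y

/-- Programs; `r`, `a`, `b` are names of registers. -/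
inductive Prog where
  /-- do nothing -/
  | skip
  /-- `r := v` -/
  | const (r v : ℕ)
  /-- `r := a ∘ b` -/
  | arith (o : Op) (r a b : ℕ)
  /-- `r := memory[a]` -/
  | load (r a : ℕ)
  /-- `memory[a] := b` -/
  | store (a b : ℕ)
  /-- run `p`, then `q` -/
  | seq (p q : Prog)
  /-- if `a < b` then run `p` else run `q` -/
  | branch (a b : ℕ) (p q : Prog)
  /-- as long as `a < b` run `p` -/
  | loop (a b : ℕ) (p : Prog)

/-- The contents of the registers and of the memory. -/
structure State where
  reg : ℕ → ℕ
  mem : ℕ → ℕ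

/-- Write `v` to register `r`. -/
def State.setReg (s : State) (r v : ℕ) : State := ⟨Function.update s.reg r v, s.mem⟩

/-- Write `v` to memory cell `i`. -/
def State.setMem (s : State) (i v : ℕ) : State := ⟨s.reg, Function.update s.mem i v⟩

/-- `Exec B p s t s'`: started in `s`, the program `p` stops in `s'` after exactly `t` steps,
and no value larger than `B` is ever written to a register. Every instruction and every
evaluation of a test is one step. -/
inductive Exec (B : ℕ) : Prog → State → ℕ → State → Prop where
  | skip (s : State) : Exec B .skip s 1 s
  | const (s : State) (r v : ℕ) (h : v ≤ B) : Exec B (.const r v) s 1 (s.setReg r v)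
  | arith (s : State) (o : Op) (r a b : ℕ) (h : o.eval (s.reg a) (s.reg b) ≤ B) :
      Exec B (.arith o r a b) s 1 (s.setReg r (o.eval (s.reg a) (s.reg b)))
  | load (s : State) (r a : ℕ) (h : s.mem (s.reg a) ≤ B) :
      Exec B (.load r a) s 1 (s.setReg r (s.mem (s.reg a)))
  | store (s : State) (a b : ℕ) : Exec B (.store a b) s 1 (s.setMem (s.reg a) (s.reg b))
  | seq {s s' s'' : State} {p q : Prog} {t t' : ℕ} (h : Exec B p s t s')
      (h' : Exec B q s' t' s'') : Exec B (.seq p q) s (t + t') s''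
  | branch_true {s s' : State} {a b : ℕ} {p q : Prog} {t : ℕ} (hab : s.reg a < s.reg b)
      (h : Exec B p s t s') : Exec B (.branch a b p q) s (t + 1) s'
  | branch_false {s s' : State} {a b : ℕ} {p q : Prog} {t : ℕ} (hab : ¬ s.reg a < s.reg b)
      (h : Exec B q s t s') : Exec B (.branch a b p q) s (t + 1) s'
  | loop_true {s s' s'' : State} {a b : ℕ} {p : Prog} {t t' : ℕ} (hab : s.reg a < s.reg b)
      (h : Exec B p s t s') (h' : Exec B (.loop a b p) s' t' s'') :
      Exec B (.loop a b p) s (t + t' + 1) s''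
  | loop_false {s : State} {a b : ℕ} {p : Prog} (hab : ¬ s.reg a < s.reg b) :
      Exec B (.loop a b p) s 1 s

/-- Runs are deterministic. -/
theorem Exec.unique {B : ℕ} {p : Prog} {s s₁ s₂ : State} {t₁ t₂ : ℕ}
    (h₁ : Exec B p s t₁ s₁) (h₂ : Exec B p s t₂ s₂) : t₁ = t₂ ∧ s₁ = s₂ := by
  induction h₁ generalizing t₂ s₂ with
  | skip => cases h₂; exact ⟨rfl, rfl⟩
  | const => cases h₂; exact ⟨rfl, rfl⟩
  | arith => cases h₂; exact ⟨rfl, rfl⟩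
  | load => cases h₂; exact ⟨rfl, rfl⟩
  | store => cases h₂; exact ⟨rfl, rfl⟩
  | seq _ _ ih ih' =>
    cases h₂ with
    | seq g g' =>
      obtain ⟨rfl, rfl⟩ := ih g
      obtain ⟨rfl, rfl⟩ := ih' g'
      exact ⟨rfl, rfl⟩
  | branch_true hab _ ih =>
    cases h₂ with
    | branch_true _ g => obtain ⟨rfl, rfl⟩ := ih g; exact ⟨rfl, rfl⟩
    | branch_false hn _ => exact absurd hab hn
  | branch_false hab _ ih =>
    cases h₂ with
    | branch_true hn _ => exact absurd hn hab
    | branch_false _ g => obtain ⟨rfl, rfl⟩ := ih g; exact ⟨rfl, rfl⟩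
  | loop_true hab _ _ ih ih' =>
    cases h₂ with
    | loop_true _ g g' =>
      obtain ⟨rfl, rfl⟩ := ih g
      obtain ⟨rfl, rfl⟩ := ih' g'
      exact ⟨rfl, rfl⟩
    | loop_false hn => exact absurd hab hn
  | loop_false hab =>
    cases h₂ with
    | loop_true hn _ _ => exact absurd hn hab
    | loop_false _ => exact ⟨rfl, rfl⟩

/-! ### Input format -/

/-- `adj` lists the neighbours of every vertex of `G`, in any order and without repetition. -/
def IsAdjLists {n : ℕ} (G : SimpleGraph (Fin n)) (adj : Fin n → List (Fin n)) : Prop :=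
  ∀ v, (adj v).Nodup ∧ ∀ w, w ∈ adj v ↔ G.Adj v w

/-- The input as a list of words: `n`, then `δ`, then for `j = 0, …, n` the address at which
the adjacency list of vertex `j` starts (for `j = n`: the end of the last list), then the
adjacency lists of the vertices `0, …, n - 1` one after the other. -/
def encode {n : ℕ} (adj : Fin n → List (Fin n)) (δ : ℕ) : List ℕ :=
  let L : List (List ℕ) := List.ofFn fun v => (adj v).map Fin.val
  [n, δ] ++ (List.range (n + 1)).map (fun j => n + 3 + (L.take j).flatten.length) ++ L.flatten

/-- Initially the memory holds the input from address `0` on; everything else is `0`. -/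
def initState (l : List ℕ) : State := ⟨fun _ => 0, fun i => l.getD i 0⟩

end HypRAM

namespace HypRAM

/-! ### A language with variables, arrays and bounded loops -/

/-! Call special the vertices of degree other than two and all vertices of components that are
cycles. Every other vertex is an inner vertex of a chain, a path or closed walk of vertices of
degree two between special vertices. The pieces, single special vertices and chains, number `P`. A
maximal path meets at most three of them in the sense of `home`: those of its two endpoints and one
chain that contains all its inner vertices. Hence `P ≤ 3 * k` (`Dec.pieces_le`), and it suffices to
decide hyperbolicity in time `O(P ^ 4 * (n + m))`.

Along a chain the distance from a vertex `x` off the chain is the minimum of a rising and a falling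
line, so it has slope 1 or -1 except near one crossing point. If `x` lies on the chain, the same
holds on either side of `x`. Call `y` critical for `x` if `y` is special, or if the distance from
`x` has no slope at `y`, or if `x` and `y` are adjacent inner vertices. Ten candidates per piece
contain all critical vertices (`Dec.crit_cand`), so each `x` has at most `10 * P` candidates.

The combinatorial core is `Crit.found`: if the four-point condition fails, it fails for some `a, b,
c, d` such that `d` and some `u` are critical for `c`, `a` is critical for `u`, and `b` is critical
for `a`. Thus `n * (10 * P) ^ 4` quadruples suffice. Take a quadruple that maximizes the excess `D₁
- max (D₂, D₃)`, then `D₁`, then `-(D₂ + D₃)`, then a weighted sum of the positions of `a` and `c`.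
Maximality of `D₁` makes `a` and `b`, and likewise `c` and `d`, critical for each other
(`Top.crit`). If the quadruple cannot be found along critical pairs, then all four vertices are
inner vertices and all mixed distances have slopes at both ends (`Top.slope`). In that case `a` and
`b` can be moved together by a step `s` without decreasing their distance, and `c` and `d` by a step
`t` (`Dec.exists_move`). By `Dec.dist_nb_nb_le`, `D₂` and `D₃` then change by at most two linear
forms in `(s, t)` with coefficients in {-2, 0, 2}. A finite check (`exists_direction`) gives a step
that raises neither sum and, if it lowers neither, raises the weighted position. This contradicts
maximality.

The algorithm finds the pieces by following chains, relaxes a `P × P` matrix of distances between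
special vertices `n` times over all triples (`Known.succ`), and from then on evaluates any distance
in constant time (`Dec.dhat_eq`). It then tabulates the candidates and searches the quadruples.

For the machine model, the algorithm is written in a small language with variables, sixteen arrays
and counted loops, and `Stmt.comp_exec` shows that its compilation preserves effects, costs up to a
constant factor, and polynomial bounds on values. The rules for `Tr` reduce the remaining work to
loop invariants with costs. -/

/-- Expressions over variables and arrays. -/
inductive Ex where
  | v (x : ℕ)
  | c (k : ℕ)
  | op (o : Op) (e f : Ex)
  | rd (t : Fin 16) (e : Ex)

instance : Add Ex := ⟨.op .add⟩
instance : Sub Ex := ⟨.op .sub⟩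
instance : Mul Ex := ⟨.op .mul⟩
instance : Div Ex := ⟨.op .div⟩
instance (k : ℕ) : OfNat Ex k := ⟨.c k⟩

/-- Statements; `inp` reads the input, `rep x e s` runs `s` for `x = 0, …, e - 1`. -/
inductive Stmt where
  | skip
  | asg (x : ℕ) (e : Ex)
  | wr (t : Fin 16) (e f : Ex)
  | inp (x : ℕ) (e : Ex)
  | seq (s s' : Stmt)
  | ite (e f : Ex) (s s' : Stmt)
  | rep (x : ℕ) (e : Ex) (s : Stmt)

/-- Values of the variables and of the array cells. -/
structure HS where
  v : ℕ → ℕ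
  a : Fin 16 → ℕ → ℕ

/-- Assign `k` to the variable `x`. -/
def HS.sv (σ : HS) (x k : ℕ) : HS := ⟨Function.update σ.v x k, σ.a⟩

/-- Assign `k` to cell `i` of array `t`. -/
def HS.sa (σ : HS) (t : Fin 16) (i k : ℕ) : HS :=
  ⟨σ.v, Function.update σ.a t (Function.update (σ.a t) i k)⟩

@[simp] theorem HS.sv_v (σ : HS) (x k y : ℕ) : (σ.sv x k).v y = if y = x then k else σ.v y := by
  simp [HS.sv, Function.update_apply]
@[simp] theorem HS.sv_a (σ : HS) (x k : ℕ) : (σ.sv x k).a = σ.a := rfl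
@[simp] theorem HS.sa_v (σ : HS) (t : Fin 16) (i k : ℕ) : (σ.sa t i k).v = σ.v := rfl
@[simp] theorem HS.sa_a (σ : HS) (t t' : Fin 16) (i k : ℕ) :
    (σ.sa t i k).a t' = if t' = t then Function.update (σ.a t) i k else σ.a t' := by
  simp [HS.sa, Function.update_apply]

namespace Ex

/-- The value of an expression. -/
def eval : Ex → HS → ℕ
  | v x, σ => σ.v x
  | c k, _ => k
  | op o e f, σ => o.eval (e.eval σ) (f.eval σ)
  | rd t e, σ => σ.a t (e.eval σ)

@[simp] theorem eval_v (x : ℕ) (σ : HS) : (v x).eval σ = σ.v x := rfl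
@[simp] theorem eval_rd (t : Fin 16) (e : Ex) (σ : HS) : (rd t e).eval σ = σ.a t (e.eval σ) := rfl
@[simp] theorem eval_ofNat (k : ℕ) (σ : HS) :
    (no_index (OfNat.ofNat k : Ex)).eval σ = OfNat.ofNat k := rfl
@[simp] theorem eval_add (e f : Ex) (σ : HS) : (e + f).eval σ = e.eval σ + f.eval σ := rfl
@[simp] theorem eval_sub (e f : Ex) (σ : HS) : (e - f).eval σ = e.eval σ - f.eval σ := rfl
@[simp] theorem eval_mul (e f : Ex) (σ : HS) : (e * f).eval σ = e.eval σ * f.eval σ := rfl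
@[simp] theorem eval_div (e f : Ex) (σ : HS) : (e / f).eval σ = e.eval σ / f.eval σ := rfl

/-- All values met in the evaluation of `e` are at most `X ^ e.sz` if all cells are at most `X`. -/
def sz : Ex → ℕ
  | v _ => 1
  | c k => k + 1
  | op _ e f => e.sz + f.sz + 1
  | rd _ e => e.sz + 10

/-- Code that evaluates an expression into the register `3 * i + 1`. -/
def comp : Ex → ℕ → Prog
  | v x, i => .seq (.const (3 * i + 1) 0) (.arith .add (3 * i + 1) (3 * i + 1) (3 * x))
  | c k, i => .const (3 * i + 1) k
  | op o e f, i => .seq (e.comp i) (.seq (f.comp (i + 1))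
      (.arith o (3 * i + 1) (3 * i + 1) (3 * (i + 1) + 1)))
  | rd t e, i => .seq (e.comp i) (.seq (.const (3 * (i + 1) + 1) 16)
      (.seq (.arith .mul (3 * i + 1) (3 * i + 1) (3 * (i + 1) + 1))
      (.seq (.const (3 * (i + 1) + 1) t)
      (.seq (.arith .add (3 * i + 1) (3 * i + 1) (3 * (i + 1) + 1))
      (.seq (.arith .add (3 * i + 1) 2 (3 * i + 1))
      (.load (3 * i + 1) (3 * i + 1)))))))

/-- The running time of `comp`. -/
def time : Ex → ℕ
  | v _ => 2
  | c _ => 1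
  | op _ e f => e.time + (f.time + 1)
  | rd _ e => e.time + 6

end Ex

/-! ### Correctness, cost and word size of the compiled code -/

/-- All variables and array cells are at most `X`. -/
def HS.Bd (X : ℕ) (σ : HS) : Prop := (∀ x, σ.v x ≤ X) ∧ ∀ t i, σ.a t i ≤ X

theorem HS.Bd.sv {X : ℕ} {σ : HS} (h : σ.Bd X) {x k : ℕ} (hk : k ≤ X) : (σ.sv x k).Bd X := by
  refine ⟨fun y => ?_, h.2⟩
  rw [HS.sv_v]; split_ifs
  exacts [hk, h.1 y]

theorem HS.Bd.sa {X : ℕ} {σ : HS} (h : σ.Bd X) {t : Fin 16} {i k : ℕ} (hk : k ≤ X) :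
    (σ.sa t i k).Bd X := by
  refine ⟨h.1, fun t' j => ?_⟩
  rw [HS.sa_a]; split_ifs with ht
  · rw [Function.update_apply]; split_ifs
    exacts [hk, h.2 t j]
  · exact h.2 t' j

theorem Op.eval_le {X : ℕ} (hX : 2 ≤ X) (o : Op) {x y a b : ℕ} (hx : x ≤ X ^ a) (hy : y ≤ X ^ b) :
    o.eval x y ≤ X ^ (a + b + 1) := by
  have h1 : X ^ a ≤ X ^ (a + b) := Nat.pow_le_pow_right (by omega) (by omega)
  have h2 : X ^ b ≤ X ^ (a + b) := Nat.pow_le_pow_right (by omega) (by omega)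
  have h3 : X ^ (a + b) * 2 ≤ X ^ (a + b + 1) := by rw [pow_succ]; gcongr
  cases o with
  | add => simp only [Op.eval]; omega
  | sub => simp only [Op.eval]; omega
  | mul =>
    have : x * y ≤ X ^ a * X ^ b := Nat.mul_le_mul hx hy
    rw [← pow_add] at this
    simp only [Op.eval]; omega
  | div =>
    have : x / y ≤ x := Nat.div_le_self _ _
    simp only [Op.eval]; omega

theorem Ex.eval_le {X : ℕ} (hX : 2 ≤ X) {σ : HS} (hσ : σ.Bd X) (e : Ex) : e.eval σ ≤ X ^ e.sz := by
  induction e with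
  | v x => simpa [Ex.sz] using hσ.1 x
  | c k =>
    have h1 : k < 2 ^ k := Nat.lt_two_pow_self
    have h2 : 2 ^ k ≤ X ^ k := Nat.pow_le_pow_left hX k
    have h3 : X ^ k ≤ X ^ (k + 1) := Nat.pow_le_pow_right (by omega) (by omega)
    simp only [Ex.sz, Ex.eval]; omega
  | op o e f ihe ihf => exact Op.eval_le hX o ihe ihf
  | rd t e ih =>
    refine (hσ.2 t _).trans ?_
    simpa [Ex.sz] using Nat.pow_le_pow_right (n := X) (i := 1) (by omega) (Nat.le_add_left 1 (e.sz + 9))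

/-- The machine state `st` represents `σ`; the input `I` takes the cells below `E`. -/
structure Rel (E : ℕ) (I : ℕ → ℕ) (σ : HS) (st : State) : Prop where
  var : ∀ x, st.reg (3 * x) = σ.v x
  base : st.reg 2 = E
  arr : ∀ (t : Fin 16) i, st.mem (E + (i * 16 + t)) = σ.a t i
  input : ∀ i < E, st.mem i = I i

@[simp] theorem State.setReg_reg (s : State) (r v q : ℕ) :
    (s.setReg r v).reg q = if q = r then v else s.reg q := by
  simp [State.setReg, Function.update_apply]
@[simp] theorem State.setReg_mem (s : State) (r v : ℕ) : (s.setReg r v).mem = s.mem := rfl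
@[simp] theorem State.setMem_reg (s : State) (r v : ℕ) : (s.setMem r v).reg = s.reg := rfl
@[simp] theorem State.setMem_mem (s : State) (i v j : ℕ) :
    (s.setMem i v).mem j = if j = i then v else s.mem j := by
  simp [State.setMem, Function.update_apply]

/-- Registers divisible by three hold the variables and register 2 holds the base address of the
arrays. All other registers are scratch space or loop control, which `Rel` ignores. -/
theorem Rel.congr {E : ℕ} {I : ℕ → ℕ} {σ : HS} {st st' : State} (h : Rel E I σ st)
    (hm : st'.mem = st.mem) (hr : ∀ r, r % 3 = 0 ∨ r = 2 → st'.reg r = st.reg r) : Rel E I σ st' where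
  var x := by rw [hr _ (by omega), h.var]
  base := by rw [hr _ (by omega), h.base]
  arr t i := by rw [hm, h.arr]
  input i hi := by rw [hm, h.input i hi]

/-- The slack of ten in the exponent pays for the stride 16, the array number and the base address,
since `X ^ 9` is at least 512. -/
theorem addr_le {X E k a : ℕ} (hX : 2 ≤ X) (hE : E ≤ X) (h : k ≤ X ^ a) (t : Fin 16) :
    16 ≤ X ^ (a + 10) ∧ k * 16 ≤ X ^ (a + 10) ∧ k * 16 + t ≤ X ^ (a + 10) ∧
      E + (k * 16 + t) ≤ X ^ (a + 10) := by
  have hp : 1 ≤ X ^ a := Nat.one_le_pow _ _ (by omega)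
  have h1 : 2 ^ 9 ≤ X ^ 9 := Nat.pow_le_pow_left hX 9
  have h2 : X ^ (a + 10) = X ^ a * (X ^ 9 * X) := by ring
  have h3 : X ^ a * (2 ^ 9 * X) ≤ X ^ (a + 10) := by rw [h2]; gcongr
  have h4 : X ^ a * 2 ≤ X ^ a * X := by gcongr
  have h5 : 1 * X ≤ X ^ a * X := by gcongr
  have := t.isLt
  have h6 : X ^ a * (2 ^ 9 * X) = 2 ^ 9 * (X ^ a * X) := by ring
  rw [h6] at h3
  generalize X ^ (a + 10) = Y at *
  generalize X ^ a * X = Z at *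
  generalize X ^ a = W at *
  norm_num at h3
  refine ⟨?_, ?_, ?_, ?_⟩ <;> omega

/-- Temporaries are the registers congruent to 1 modulo 3, used as a stack: evaluation at level `i`
leaves the lower ones alone. This preserves the first operand while the second is computed. -/
theorem Ex.comp_exec {B X E : ℕ} {I : ℕ → ℕ} {σ : HS} (hX : 2 ≤ X) (hE : E ≤ X) (hσ : σ.Bd X)
    (e : Ex) : ∀ (i : ℕ) (st : State), Rel E I σ st → X ^ e.sz ≤ B →
      ∃ st', Exec B (e.comp i) st e.time st' ∧ st'.mem = st.mem ∧
        st'.reg (3 * i + 1) = e.eval σ ∧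
        ∀ r, (r % 3 = 1 → r < 3 * i + 1) → st'.reg r = st.reg r := by
  induction e with
  | v x =>
    intro i st h hB
    refine ⟨_, .seq (.const _ _ _ (Nat.zero_le _)) (.arith _ _ _ _ _ ?_), rfl, ?_, ?_⟩
    · have := hσ.1 x
      have h3 : 3 * x ≠ 3 * i + 1 := by omega
      simp only [Ex.sz, pow_one] at hB
      simp only [Op.eval, State.setReg_reg, h3, if_true, if_false, h.var]; omega
    · have h3 : 3 * x ≠ 3 * i + 1 := by omega
      simp [Op.eval, h3, h.var]
    · intro r hr
      have : r ≠ 3 * i + 1 := by intro h'; omega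
      simp [this]
  | c k =>
    intro i st h hB
    refine ⟨_, .const _ _ _ (((Ex.c k).eval_le hX hσ).trans hB), rfl, by simp [Ex.eval], ?_⟩
    intro r hr
    have : r ≠ 3 * i + 1 := by intro h'; omega
    simp [this]
  | op o e f ihe ihf =>
    intro i st h hB
    have h1 : X ^ e.sz ≤ B :=
      (Nat.pow_le_pow_right (by omega) (by simp only [Ex.sz]; omega)).trans hB
    have h2 : X ^ f.sz ≤ B :=
      (Nat.pow_le_pow_right (by omega) (by simp only [Ex.sz]; omega)).trans hB
    obtain ⟨s1, x1, m1, v1, r1⟩ := ihe i st h h1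
    have hs1 : Rel E I σ s1 := h.congr m1 fun r hr => r1 r (by omega)
    obtain ⟨s2, x2, m2, v2, r2⟩ := ihf (i + 1) s1 hs1 h2
    have e1 : s2.reg (3 * i + 1) = e.eval σ := by rw [r2 _ (by omega), v1]
    refine ⟨_, .seq x1 (.seq x2 (.arith _ _ _ _ _ ?_)), by simp [m1, m2], ?_, ?_⟩
    · rw [e1, v2]; exact ((Ex.op o e f).eval_le hX hσ).trans hB
    · simp [e1, v2, Ex.eval]
    · intro r hr
      have : r ≠ 3 * i + 1 := by intro h'; omega
      simp only [State.setReg_reg, this, if_false]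
      rw [r2 r (by omega), r1 r hr]
  | rd t e ih =>
    intro i st h hB
    have h1 : X ^ e.sz ≤ B :=
      (Nat.pow_le_pow_right (by omega) (by simp only [Ex.sz]; omega)).trans hB
    obtain ⟨s1, x1, m1, v1, r1⟩ := ih i st h h1
    obtain ⟨b1, b2, b3, b4⟩ := addr_le hX hE (e.eval_le hX hσ) t
    have hb : s1.reg 2 = E := by rw [r1 2 (by omega), h.base]
    have e1 : (3 * (i + 1) + 1 = 3 * i + 1) = False := by simp
    have e2 : (3 * i + 1 = 3 * (i + 1) + 1) = False := by simp
    have e3 : (2 = 3 * i + 1) = False := by simp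
    have e4 : (2 = 3 * (i + 1) + 1) = False := by simp
    simp only [Ex.sz] at hB
    refine ⟨_, .seq x1 (.seq (.const _ _ _ ?_) (.seq (.arith _ _ _ _ _ ?_) (.seq (.const _ _ _ ?_)
      (.seq (.arith _ _ _ _ _ ?_) (.seq (.arith _ _ _ _ _ ?_) (.load _ _ _ ?_)))))), ?_, ?_, ?_⟩
    · omega
    · simp only [Op.eval, State.setReg_reg, e2, if_true, if_false, v1]; omega
    · have := t.isLt; omega
    · simp only [Op.eval, State.setReg_reg, e1, e2, if_true, if_false, v1]; omega
    · simp only [Op.eval, State.setReg_reg, e1, e2, e3, e4, if_true, if_false, v1, hb]; omega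
    · simp only [Op.eval, State.setReg_reg, State.setReg_mem, e1, e2, e3, e4, if_true, if_false,
        v1, hb, m1, h.arr]
      refine (hσ.2 t _).trans (le_trans ?_ hB)
      simpa using Nat.pow_le_pow_right (n := X) (i := 1) (by omega) (Nat.le_add_left 1 (e.sz + 9))
    · simp [m1]
    · simp only [Op.eval, State.setReg_reg, State.setReg_mem, e1, e2, e3, e4, if_true, if_false,
        v1, hb, m1, h.arr, Ex.eval]
    · intro r hr
      have n1 : r ≠ 3 * i + 1 := by intro h'; omega
      have n2 : r ≠ 3 * (i + 1) + 1 := by intro h'; omega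
      simp only [State.setReg_reg, n1, n2, if_false]
      rw [r1 r hr]

/-- Iterate a state transformer that depends on the number of the iteration. -/
def iter (f : ℕ → HS → HS) : ℕ → HS → HS
  | 0, σ => σ
  | j + 1, σ => f j (iter f j σ)

namespace Stmt

/-- The effect of a statement. -/
def run (I : ℕ → ℕ) : Stmt → HS → HS
  | skip, σ => σ
  | asg x e, σ => σ.sv x (e.eval σ)
  | wr t e f, σ => σ.sa t (e.eval σ) (f.eval σ)
  | inp x e, σ => σ.sv x (I (e.eval σ))
  | seq s s', σ => s'.run I (s.run I σ)
  | ite e f s s', σ => if e.eval σ < f.eval σ then s.run I σ else s'.run I σ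
  | rep x e s, σ => iter (fun j τ => s.run I (τ.sv x j)) (e.eval σ) σ

/-- The number of steps of a statement, up to a constant factor. -/
def cost (I : ℕ → ℕ) : Stmt → HS → ℕ
  | skip, _ => 1
  | asg _ _, _ => 1
  | wr _ _ _, _ => 1
  | inp _ _, _ => 1
  | seq s s', σ => s.cost I σ + s'.cost I (s.run I σ)
  | ite e f s s', σ => (if e.eval σ < f.eval σ then s.cost I σ else s'.cost I σ) + 1
  | rep x e s, σ => 1 + ∑ j ∈ Finset.range (e.eval σ),
      (s.cost I ((iter (fun j τ => s.run I (τ.sv x j)) j σ).sv x j) + 1)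

/-- All values written are at most `X`, and only the first `E` cells of the input are read. -/
def Ok (I : ℕ → ℕ) (E X : ℕ) : Stmt → HS → Prop
  | skip, _ => True
  | asg _ e, σ => e.eval σ ≤ X
  | wr _ _ f, σ => f.eval σ ≤ X
  | inp _ e, σ => e.eval σ < E
  | seq s s', σ => s.Ok I E X σ ∧ s'.Ok I E X (s.run I σ)
  | ite e f s s', σ => (e.eval σ < f.eval σ → s.Ok I E X σ) ∧ (¬ e.eval σ < f.eval σ → s'.Ok I E X σ)
  | rep x e s, σ => e.eval σ ≤ X ∧ ∀ j < e.eval σ,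
      s.Ok I E X ((iter (fun j τ => s.run I (τ.sv x j)) j σ).sv x j)

/-- A bound on the exponents of the values met in the compiled code. -/
def sz : Stmt → ℕ
  | skip => 1
  | asg _ e => e.sz + 1
  | wr _ e f => e.sz + 10 + f.sz
  | inp _ e => e.sz + 1
  | seq s s' => s.sz + s'.sz
  | ite e f s s' => e.sz + f.sz + s.sz + s'.sz
  | rep _ e s => e.sz + s.sz + 1

/-- Code for a statement; loops at nesting depth `d` use the registers `6 * d + 5`, `6 * d + 8`. -/
def comp : Stmt → ℕ → Prog
  | skip, _ => .skip
  | asg x e, _ => .seq (e.comp 0) (.seq (.const 4 0) (.arith .add (3 * x) 1 4))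
  | wr t e f, _ => .seq (e.comp 0) (.seq (.const 4 16) (.seq (.arith .mul 1 1 4)
      (.seq (.const 4 t) (.seq (.arith .add 1 1 4) (.seq (.arith .add 1 2 1)
      (.seq (f.comp 1) (.store 1 4)))))))
  | inp x e, _ => .seq (e.comp 0) (.load (3 * x) 1)
  | seq s s', d => .seq (s.comp d) (s'.comp d)
  | ite e f s s', d => .seq (e.comp 0) (.seq (f.comp 1) (.branch 1 4 (s.comp d) (s'.comp d)))
  | rep x e s, d => .seq (e.comp 0) (.seq (.const 4 0) (.seq (.arith .add (6 * d + 8) 1 4)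
      (.seq (.const (6 * d + 5) 0) (.loop (6 * d + 5) (6 * d + 8)
        (.seq (.const 4 0) (.seq (.arith .add (3 * x) (6 * d + 5) 4) (.seq (s.comp (d + 1))
          (.seq (.const 4 1) (.arith .add (6 * d + 5) (6 * d + 5) 4)))))))))

/-- The factor between `cost` and the running time of the compiled code. -/
def factor : Stmt → ℕ
  | skip => 1
  | asg _ e => e.time + 2
  | wr _ e f => e.time + f.time + 6
  | inp _ e => e.time + 1
  | seq s s' => s.factor + s'.factor
  | ite e f s s' => e.time + f.time + 1 + s.factor + s'.factor
  | rep _ e s => e.time + s.factor + 10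

theorem Ok.bd {I : ℕ → ℕ} {E X : ℕ} (hI : ∀ i < E, I i ≤ X) (s : Stmt) : ∀ {σ : HS},
    s.Ok I E X σ → σ.Bd X → (s.run I σ).Bd X := by
  induction s with
  | skip => intro σ _ h; exact h
  | asg x e => intro σ hs h; exact h.sv hs
  | wr t e f => intro σ hs h; exact h.sa hs
  | inp x e => intro σ hs h; exact h.sv (hI _ hs)
  | seq s s' ih ih' => intro σ hs h; exact ih' hs.2 (ih hs.1 h)
  | ite e f s s' ih ih' =>
    intro σ hs h
    simp only [run]; split_ifs with hc
    exacts [ih (hs.1 hc) h, ih' (hs.2 hc) h]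
  | rep x e s ih =>
    intro σ hs h
    have key : ∀ j ≤ e.eval σ, (iter (fun j τ => s.run I (τ.sv x j)) j σ).Bd X := by
      intro j
      induction j with
      | zero => intro _; exact h
      | succ j ihj =>
        intro hj
        have := hs.1
        exact ih (hs.2 j hj) ((ihj (by omega)).sv (by omega))
    exact key _ le_rfl

end Stmt

theorem Rel.setVar {E : ℕ} {I : ℕ → ℕ} {σ : HS} {st st' : State} (h : Rel E I σ st) {x k : ℕ}
    (hm : st'.mem = st.mem) (hx : st'.reg (3 * x) = k)
    (hr : ∀ r, r % 3 ≠ 1 → r ≠ 3 * x → st'.reg r = st.reg r) : Rel E I (σ.sv x k) st' where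
  var y := by
    rw [HS.sv_v]; split_ifs with hy
    · rw [hy, hx]
    · rw [hr _ (by omega) (by omega), h.var]
  base := by rw [hr _ (by omega) (by omega), h.base]
  arr t i := by rw [hm, h.arr]; rfl
  input i hi := by rw [hm, h.input i hi]

/-- The sixteen arrays are interleaved with stride 16, so distinct cells have distinct addresses,
all beyond the input. -/
theorem Rel.setArr {E : ℕ} {I : ℕ → ℕ} {σ : HS} {st : State} (h : Rel E I σ st) (t : Fin 16)
    (i k : ℕ) : Rel E I (σ.sa t i k) (st.setMem (E + (i * 16 + t)) k) where
  var y := h.var y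
  base := h.base
  arr t' j := by
    have h1 := t.isLt
    have h2 := t'.isLt
    rw [State.setMem_mem, HS.sa_a, h.arr]
    by_cases ht : t' = t
    · subst ht
      by_cases hj : j = i
      · subst hj; simp
      · have : E + (j * 16 + (t' : ℕ)) ≠ E + (i * 16 + t') := by omega
        rw [if_neg this, if_pos rfl, Function.update_of_ne hj]
    · have : (t' : ℕ) ≠ t := fun h' => ht (Fin.ext h')
      have : E + (j * 16 + (t' : ℕ)) ≠ E + (i * 16 + t) := by omega
      rw [if_neg this, if_neg ht]
  input j hj := by
    have : j ≠ E + (i * 16 + (t : ℕ)) := by omega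
    rw [State.setMem_mem, if_neg this, h.input j hj]

theorem pow_le_of_le {X B a b : ℕ} (hX : 2 ≤ X) (hab : a ≤ b) (h : X ^ b ≤ B) : X ^ a ≤ B :=
  (Nat.pow_le_pow_right (by omega) hab).trans h

/-- The last clause protects the counters and bounds of the enclosing loops, which sit in registers
congruent to 2 modulo 3 and below those of depth `d`. As the counter is separate from the loop
variable and the bound is evaluated once, a body may overwrite its variables freely. -/
theorem Stmt.comp_exec {B X E : ℕ} {I : ℕ → ℕ} (hX : 2 ≤ X) (hE : E ≤ X) (hI : ∀ i < E, I i ≤ X)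
    (s : Stmt) : ∀ (d : ℕ) (σ : HS) (st : State), Rel E I σ st → σ.Bd X → s.Ok I E X σ →
      X ^ s.sz ≤ B →
      ∃ t st', Exec B (s.comp d) st t st' ∧ t ≤ s.factor * s.cost I σ ∧
        Rel E I (s.run I σ) st' ∧ ∀ r, r % 3 = 2 → r < 6 * d + 5 → st'.reg r = st.reg r := by
  induction s with
  | skip =>
    intro d σ st h hσ hs hB
    exact ⟨1, st, .skip _, by simp [factor, cost], h, fun _ _ _ => rfl⟩
  | asg x e =>
    intro d σ st h hσ hs hB
    have hB1 := pow_le_of_le hX (by simp only [sz]; omega : 1 ≤ (asg x e).sz) hB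
    obtain ⟨s1, x1, m1, v1, r1⟩ := e.comp_exec (I := I) hX hE hσ 0 st h
      (pow_le_of_le hX (by simp only [sz]; omega) hB)
    simp only [mul_zero, zero_add] at v1
    have hs' : e.eval σ ≤ X := hs
    rw [pow_one] at hB1
    have hv : (s1.setReg 4 0).reg 1 = e.eval σ := by simp [v1]
    refine ⟨_, _, .seq x1 (.seq (.const _ _ _ (Nat.zero_le _)) (.arith _ _ _ _ _ ?_)), ?_, ?_, ?_⟩
    · rw [hv]; simp only [Op.eval, State.setReg_reg, if_true]; omega
    · simp only [factor, cost]; omega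
    · refine h.setVar (x := x) (by simp [m1]) ?_ ?_
      · simp [Op.eval, v1]
      · intro r hr hrx
        have : r ≠ 4 := by rintro rfl; simp at hr
        simp only [State.setReg_reg, hrx, this, if_false]
        exact r1 r (by omega)
    · intro r hr _
      have h1 : r ≠ 4 := by rintro rfl; simp at hr
      have h2 : r ≠ 3 * x := by omega
      simp only [State.setReg_reg, h1, h2, if_false]
      exact r1 r (by omega)
  | wr t e f =>
    intro d σ st h hσ hs hB
    simp only [sz] at hB
    obtain ⟨s1, x1, m1, v1, r1⟩ := e.comp_exec (I := I) hX hE hσ 0 st h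
      (pow_le_of_le hX (by omega) hB)
    simp only [mul_zero, zero_add] at v1
    obtain ⟨b1, b2, b3, b4⟩ := addr_le hX hE (e.eval_le hX hσ) t
    have hB2 := pow_le_of_le hX (by omega : e.sz + 10 ≤ e.sz + 10 + f.sz) hB
    have hb : s1.reg 2 = E := by rw [r1 2 (by omega), h.base]
    let s2 := (((((s1.setReg 4 16).setReg 1 (e.eval σ * 16)).setReg 4 t).setReg 1
      (e.eval σ * 16 + t)).setReg 1 (E + (e.eval σ * 16 + t)))
    have y1 : Exec B (.const 4 16) s1 1 (s1.setReg 4 16) := .const _ _ _ (by omega)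
    have y2 : Exec B (.arith .mul 1 1 4) (s1.setReg 4 16) 1
        ((s1.setReg 4 16).setReg 1 (e.eval σ * 16)) := by
      have := Exec.arith (B := B) (s1.setReg 4 16) .mul 1 1 4
      simp only [Op.eval, State.setReg_reg, if_true, v1, (by decide : ¬ (1 = 4)), if_false] at this
      exact this (by omega)
    have y3 : Exec B (.const 4 t) ((s1.setReg 4 16).setReg 1 (e.eval σ * 16)) 1 _ :=
      .const _ _ _ (by have := t.isLt; omega)
    have y4 : Exec B (.arith .add 1 1 4) (((s1.setReg 4 16).setReg 1 (e.eval σ * 16)).setReg 4 t) 1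
        ((((s1.setReg 4 16).setReg 1 (e.eval σ * 16)).setReg 4 t).setReg 1 (e.eval σ * 16 + t)) := by
      have := Exec.arith (B := B) (((s1.setReg 4 16).setReg 1 (e.eval σ * 16)).setReg 4 t) .add 1 1 4
      simp only [Op.eval, State.setReg_reg, if_true, (by decide : ¬ (1 = 4)), if_false] at this
      exact this (by omega)
    have y5 : Exec B (.arith .add 1 2 1) ((((s1.setReg 4 16).setReg 1 (e.eval σ * 16)).setReg 4 t).setReg 1
          (e.eval σ * 16 + t)) 1 s2 := by
      have := Exec.arith (B := B) ((((s1.setReg 4 16).setReg 1 (e.eval σ * 16)).setReg 4 t).setReg 1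
        (e.eval σ * 16 + t)) .add 1 2 1
      simp only [Op.eval, State.setReg_reg, if_true, (by decide : ¬ (2 = 4)), (by decide : ¬ (2 = 1)),
        hb, if_false] at this
      exact this (by omega)
    have hr2 : ∀ r, r % 3 ≠ 1 → s2.reg r = s1.reg r := by
      intro r hr
      have h1 : r ≠ 4 := by rintro rfl; simp at hr
      have h2 : r ≠ 1 := by rintro rfl; simp at hr
      simp [s2, h1, h2]
    have hs2 : Rel E I σ s2 := h.congr (by simp [s2, m1]) fun r hr => by
      rw [hr2 r (by omega), r1 r (by omega)]
    obtain ⟨s3, x3, m3, v3, r3⟩ := f.comp_exec (I := I) hX hE hσ 1 s2 hs2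
      (pow_le_of_le hX (by omega) hB)
    have hv1 : s3.reg 1 = E + (e.eval σ * 16 + t) := by rw [r3 1 (by omega)]; simp [s2]
    have hs3 : Rel E I σ s3 := hs2.congr m3 fun r hr => r3 r (by omega)
    refine ⟨_, _, .seq x1 (.seq y1 (.seq y2 (.seq y3 (.seq y4 (.seq y5 (.seq x3
      (.store _ _ _))))))), ?_, ?_, ?_⟩
    · simp only [factor, cost]; omega
    · have := hs3.setArr t (e.eval σ) (f.eval σ)
      rw [hv1]
      norm_num at v3
      rw [v3]; exact this
    · intro r hr _
      rw [State.setMem_reg, r3 r (by omega), hr2 r (by omega), r1 r (by omega)]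
  | inp x e =>
    intro d σ st h hσ hs hB
    have hB1 := pow_le_of_le hX (by simp only [sz]; omega : 1 ≤ (inp x e).sz) hB
    rw [pow_one] at hB1
    obtain ⟨s1, x1, m1, v1, r1⟩ := e.comp_exec (I := I) hX hE hσ 0 st h
      (pow_le_of_le hX (by simp only [sz]; omega) hB)
    simp only [mul_zero, zero_add] at v1
    have hs' : e.eval σ < E := hs
    have hv : s1.mem (s1.reg 1) = I (e.eval σ) := by rw [v1, m1, h.input _ hs']
    refine ⟨_, _, .seq x1 (.load _ _ _ ?_), ?_, ?_, ?_⟩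
    · rw [hv]; exact (hI _ hs').trans hB1
    · simp only [factor, cost]; omega
    · refine h.setVar (x := x) (by simp [m1]) ?_ ?_
      · simp [hv]
      · intro r hr hrx
        simp only [State.setReg_reg, hrx, if_false]
        exact r1 r (by omega)
    · intro r hr _
      have h2 : r ≠ 3 * x := by omega
      simp only [State.setReg_reg, h2, if_false]
      exact r1 r (by omega)
  | seq s s' ih ih' =>
    intro d σ st h hσ hs hB
    simp only [sz] at hB
    obtain ⟨t1, s1, x1, c1, h1, r1⟩ := ih d σ st h hσ hs.1 (pow_le_of_le hX (by omega) hB)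
    obtain ⟨t2, s2, x2, c2, h2, r2⟩ := ih' d _ s1 h1 (Ok.bd hI s hs.1 hσ) hs.2
      (pow_le_of_le hX (by omega) hB)
    refine ⟨_, _, .seq x1 x2, ?_, h2, fun r hr hd => by rw [r2 r hr hd, r1 r hr hd]⟩
    simp only [factor, cost]
    nlinarith [Nat.zero_le (s.factor * s'.cost I (s.run I σ)), Nat.zero_le (s'.factor * s.cost I σ)]
  | ite e f s s' ih ih' =>
    intro d σ st h hσ hs hB
    simp only [sz] at hB
    obtain ⟨s1, x1, m1, v1, r1⟩ := e.comp_exec (I := I) hX hE hσ 0 st h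
      (pow_le_of_le hX (by omega) hB)
    have hs1 : Rel E I σ s1 := h.congr m1 fun r hr => r1 r (by omega)
    obtain ⟨s2, x2, m2, v2, r2⟩ := f.comp_exec (I := I) hX hE hσ 1 s1 hs1
      (pow_le_of_le hX (by omega) hB)
    have hs2 : Rel E I σ s2 := hs1.congr m2 fun r hr => r2 r (by omega)
    have e1 : s2.reg 1 = e.eval σ := by rw [r2 1 (by omega)]; exact v1
    have e2 : s2.reg 4 = f.eval σ := v2
    by_cases hc : e.eval σ < f.eval σ
    · obtain ⟨t, s3, x3, c3, h3, r3⟩ := ih d σ s2 hs2 hσ (hs.1 hc) (pow_le_of_le hX (by omega) hB)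
      refine ⟨_, s3, .seq x1 (.seq x2 (.branch_true (by rw [e1, e2]; exact hc) x3)), ?_, ?_, ?_⟩
      · simp only [factor, cost, if_pos hc]
        nlinarith [Nat.zero_le ((e.time + f.time + s'.factor) * s.cost I σ)]
      · simpa only [run, if_pos hc] using h3
      · intro r hr hd; rw [r3 r hr hd, r2 r (by omega), r1 r (by omega)]
    · obtain ⟨t, s3, x3, c3, h3, r3⟩ := ih' d σ s2 hs2 hσ (hs.2 hc) (pow_le_of_le hX (by omega) hB)
      refine ⟨_, s3, .seq x1 (.seq x2 (.branch_false (by rw [e1, e2]; exact hc) x3)), ?_, ?_, ?_⟩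
      · simp only [factor, cost, if_neg hc]
        nlinarith [Nat.zero_le ((e.time + f.time + s.factor) * s'.cost I σ)]
      · simpa only [run, if_neg hc] using h3
      · intro r hr hd; rw [r3 r hr hd, r2 r (by omega), r1 r (by omega)]
  | rep x e s ih =>
    intro d σ st h hσ hs hB
    simp only [sz] at hB
    obtain ⟨s1, x1, m1, v1, r1⟩ := e.comp_exec (I := I) hX hE hσ 0 st h
      (pow_le_of_le hX (by omega) hB)
    simp only [mul_zero, zero_add] at v1
    have hXB : X ≤ B := by simpa using pow_le_of_le hX (by omega : 1 ≤ e.sz + s.sz + 1) hB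
    set N := e.eval σ with hN
    have hNX : N ≤ X := hs.1
    set τ : ℕ → HS := fun j => iter (fun j τ => s.run I (τ.sv x j)) j σ with hτ
    have hbd : ∀ j ≤ N, (τ j).Bd X := by
      intro j
      induction j with
      | zero => intro _; exact hσ
      | succ j ihj =>
        intro hj
        exact Ok.bd hI s (hs.2 j hj) ((ihj (by omega)).sv (by omega))
    -- Induction on the number `k` of iterations that remain after the first `j`.
    have main : ∀ k j (st : State), j + k = N → Rel E I (τ j) st → st.reg (6 * d + 5) = j →
        st.reg (6 * d + 8) = N → ∃ t st', Exec B (.loop (6 * d + 5) (6 * d + 8)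
          (.seq (.const 4 0) (.seq (.arith .add (3 * x) (6 * d + 5) 4) (.seq (s.comp (d + 1))
          (.seq (.const 4 1) (.arith .add (6 * d + 5) (6 * d + 5) 4)))))) st t st' ∧
          t ≤ 1 + (s.factor + 6) * ∑ i ∈ Finset.range k, (s.cost I ((τ (j + i)).sv x (j + i)) + 1) ∧
          Rel E I (τ N) st' ∧ ∀ r, r % 3 = 2 → r < 6 * d + 5 → st'.reg r = st.reg r := by
      intro k
      induction k with
      | zero =>
        intro j st hj hst hc hb
        obtain rfl : j = N := by omega
        exact ⟨1, st, .loop_false (by rw [hc, hb]; omega), by simp, hst, fun _ _ _ => rfl⟩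
      | succ k ihk =>
        intro j st hj hst hc hb
        have hjN : j < N := by omega
        have y1 : Exec B (.const 4 0) st 1 (st.setReg 4 0) := .const _ _ _ (Nat.zero_le _)
        have y2 : Exec B (.arith .add (3 * x) (6 * d + 5) 4) (st.setReg 4 0) 1
            ((st.setReg 4 0).setReg (3 * x) j) := by
          have := Exec.arith (B := B) (st.setReg 4 0) .add (3 * x) (6 * d + 5) 4
          have h4 : 6 * d + 5 ≠ 4 := by omega
          simp only [Op.eval, State.setReg_reg, h4, hc, if_true, if_false, add_zero] at this
          exact this (by omega)
        have h2 : Rel E I ((τ j).sv x j) ((st.setReg 4 0).setReg (3 * x) j) := by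
          refine hst.setVar rfl (by simp) ?_
          intro r hr hrx
          have : r ≠ 4 := by rintro rfl; simp at hr
          simp [hrx, this]
        obtain ⟨t3, s3, y3, c3, h3, r3⟩ := ih (d + 1) _ _ h2 ((hbd j (by omega)).sv (by omega))
          (hs.2 j hjN) (pow_le_of_le hX (by omega) hB)
        have e5 : s3.reg (6 * d + 5) = j := by
          rw [r3 _ (by omega) (by omega)]
          have h1 : 6 * d + 5 ≠ 3 * x := by omega
          have h2 : 6 * d + 5 ≠ 4 := by omega
          simp only [State.setReg_reg, h1, h2, if_false, hc]
        have e8 : s3.reg (6 * d + 8) = N := by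
          rw [r3 _ (by omega) (by omega)]
          have h1 : 6 * d + 8 ≠ 3 * x := by omega
          have h2 : 6 * d + 8 ≠ 4 := by omega
          simp only [State.setReg_reg, h1, h2, if_false, hb]
        have y4 : Exec B (.const 4 1) s3 1 (s3.setReg 4 1) := .const _ _ _ (by omega)
        have y5 : Exec B (.arith .add (6 * d + 5) (6 * d + 5) 4) (s3.setReg 4 1) 1
            ((s3.setReg 4 1).setReg (6 * d + 5) (j + 1)) := by
          have := Exec.arith (B := B) (s3.setReg 4 1) .add (6 * d + 5) (6 * d + 5) 4
          have h4 : 6 * d + 5 ≠ 4 := by omega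
          simp only [Op.eval, State.setReg_reg, h4, e5, if_true, if_false] at this
          exact this (by omega)
        have h5 : Rel E I (τ (j + 1)) ((s3.setReg 4 1).setReg (6 * d + 5) (j + 1)) := by
          refine ⟨fun y => ?_, ?_, fun t i => h3.arr t i, fun i hi => h3.input i hi⟩
          · have h1 : 3 * y ≠ 6 * d + 5 := by omega
            have h2 : 3 * y ≠ 4 := by omega
            simp only [State.setReg_reg, h1, h2, if_false]
            exact h3.var y
          · have h1 : 2 ≠ 6 * d + 5 := by omega
            simp only [State.setReg_reg, h1, (by decide : ¬ (2 = 4)), if_false]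
            exact h3.base
        obtain ⟨t6, s6, y6, c6, h6, r6⟩ := ihk (j + 1) _ (by omega) h5 (by simp) (by
          have h1 : 6 * d + 8 ≠ 6 * d + 5 := by omega
          have h2 : 6 * d + 8 ≠ 4 := by omega
          simp only [State.setReg_reg, h1, h2, if_false, e8])
        refine ⟨_, s6, .loop_true (by rw [hc, hb]; exact hjN)
          (.seq y1 (.seq y2 (.seq y3 (.seq y4 y5)))) y6, ?_, h6, ?_⟩
        · rw [Finset.sum_range_succ']
          have : ∀ i, s.cost I ((τ (j + (i + 1))).sv x (j + (i + 1))) + 1 =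
              s.cost I ((τ (j + 1 + i)).sv x (j + 1 + i)) + 1 := fun i => by
            rw [show j + (i + 1) = j + 1 + i by omega]
          rw [Finset.sum_congr rfl fun i _ => this i, add_zero]
          set S := ∑ i ∈ Finset.range k, (s.cost I ((τ (j + 1 + i)).sv x (j + 1 + i)) + 1)
          nlinarith [Nat.zero_le (s.cost I ((τ j).sv x j))]
        · intro r hr hd
          have n1 : r ≠ 6 * d + 5 := by omega
          have n2 : r ≠ 4 := by omega
          have n3 : r ≠ 3 * x := by omega
          rw [r6 r hr hd]
          simp only [State.setReg_reg, n1, n2, if_false]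
          rw [r3 r hr (by omega)]
          simp [n2, n3]
    have hb2 : (s1.setReg 4 0).reg 1 = N := by simp [v1]
    have y2 : Exec B (.arith .add (6 * d + 8) 1 4) (s1.setReg 4 0) 1
        ((s1.setReg 4 0).setReg (6 * d + 8) N) := by
      have := Exec.arith (B := B) (s1.setReg 4 0) .add (6 * d + 8) 1 4
      rw [hb2] at this
      simp only [Op.eval, State.setReg_reg, if_true, add_zero] at this
      exact this (by omega)
    obtain ⟨t3, s3, y3, c3, h3, r3⟩ := main N 0
      (((s1.setReg 4 0).setReg (6 * d + 8) N).setReg (6 * d + 5) 0) (by omega) (by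
        refine h.congr (by simp [m1]) fun r hr => ?_
        have n1 : r ≠ 6 * d + 5 := by omega
        have n2 : r ≠ 4 := by omega
        have n3 : r ≠ 6 * d + 8 := by omega
        simp only [State.setReg_reg, n1, n2, n3, if_false]
        exact r1 r (by omega)) (by simp) (by simp)
    refine ⟨_, s3, .seq x1 (.seq (.const _ _ _ (Nat.zero_le _)) (.seq y2 (.seq
      (.const _ _ _ (Nat.zero_le _)) y3))), ?_, h3, ?_⟩
    · simp only [factor, cost]
      simp only [zero_add] at c3
      set S := ∑ j ∈ Finset.range N, (s.cost I ((τ j).sv x j) + 1)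
      nlinarith [Nat.zero_le S, Nat.zero_le (e.time * S)]
    · intro r hr hd
      have n1 : r ≠ 6 * d + 5 := by omega
      have n2 : r ≠ 4 := by omega
      have n3 : r ≠ 6 * d + 8 := by omega
      rw [r3 r hr hd]
      simp only [State.setReg_reg, n1, n2, n3, if_false]
      exact r1 r (by omega)

end HypRAM
-- Frame property and program logic with costs
namespace HypRAM

namespace Stmt

/-- The variables that a statement may change. -/
def wv : Stmt → List ℕ
  | skip => []
  | asg x _ => [x]
  | wr _ _ _ => []
  | inp x _ => [x]
  | seq s s' => s.wv ++ s'.wv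
  | ite _ _ s s' => s.wv ++ s'.wv
  | rep x _ s => x :: s.wv

/-- The arrays that a statement may change. -/
def wa : Stmt → List (Fin 16)
  | skip => []
  | asg _ _ => []
  | wr t _ _ => [t]
  | inp _ _ => []
  | seq s s' => s.wa ++ s'.wa
  | ite _ _ s s' => s.wa ++ s'.wa
  | rep _ _ s => s.wa

end Stmt

/-- `σ'` agrees with `σ` on everything that `s` does not change. -/
def Fr (s : Stmt) (σ σ' : HS) : Prop :=
  (∀ x, x ∉ s.wv → σ'.v x = σ.v x) ∧ ∀ t, t ∉ s.wa → σ'.a t = σ.a t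

theorem Fr.refl (s : Stmt) (σ : HS) : Fr s σ σ := ⟨fun _ _ => rfl, fun _ _ => rfl⟩

theorem Fr.trans {s : Stmt} {σ σ' σ'' : HS} (h : Fr s σ σ') (h' : Fr s σ' σ'') : Fr s σ σ'' :=
  ⟨fun x hx => (h'.1 x hx).trans (h.1 x hx), fun x hx => (h'.2 x hx).trans (h.2 x hx)⟩

theorem Fr.sub {s s' : Stmt} {σ σ' : HS} (h : Fr s σ σ') (hv : s.wv ⊆ s'.wv) (ha : s.wa ⊆ s'.wa) :
    Fr s' σ σ' :=
  ⟨fun x hx => h.1 x fun h' => hx (hv h'), fun x hx => h.2 x fun h' => hx (ha h')⟩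

theorem Fr.rep_step {I : ℕ → ℕ} {x : ℕ} {e : Ex} {s : Stmt} {σ : HS} {j : ℕ}
    (ih : ∀ σ, Fr s σ (s.run I σ)) : Fr (.rep x e s) σ (s.run I (σ.sv x j)) := by
  constructor
  · intro y hy
    simp only [Stmt.wv, List.mem_cons, not_or] at hy
    rw [(ih _).1 y hy.2, HS.sv_v, if_neg hy.1]
  · intro t ht
    rw [(ih _).2 t ht]; rfl

theorem Fr.iter {I : ℕ → ℕ} {x : ℕ} {e : Ex} {s : Stmt} {σ : HS}
    (ih : ∀ σ, Fr s σ (s.run I σ)) (j : ℕ) :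
    Fr (.rep x e s) σ (iter (fun j τ => s.run I (τ.sv x j)) j σ) := by
  induction j with
  | zero => exact .refl _ _
  | succ j ihj => exact ihj.trans (Fr.rep_step ih)

theorem Stmt.run_fr (I : ℕ → ℕ) (s : Stmt) : ∀ σ : HS, Fr s σ (s.run I σ) := by
  induction s with
  | skip => intro σ; exact .refl _ _
  | asg x e =>
    intro σ
    refine ⟨fun y hy => ?_, fun _ _ => rfl⟩
    simp only [wv, List.mem_singleton] at hy
    simp [run, hy]
  | wr t e f =>
    intro σ
    refine ⟨fun _ _ => rfl, fun t' ht => ?_⟩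
    simp only [wa, List.mem_singleton] at ht
    simp [run, ht]
  | inp x e =>
    intro σ
    refine ⟨fun y hy => ?_, fun _ _ => rfl⟩
    simp only [wv, List.mem_singleton] at hy
    simp [run, hy]
  | seq s s' ih ih' =>
    intro σ
    exact ((ih σ).sub (by simp [wv]) (by simp [wa])).trans
      ((ih' _).sub (by simp [wv]) (by simp [wa]))
  | ite e f s s' ih ih' =>
    intro σ
    simp only [run]
    split_ifs
    · exact (ih σ).sub (by simp [wv]) (by simp [wa])
    · exact (ih' σ).sub (by simp [wv]) (by simp [wa])
  | rep x e s ih => intro σ; exact Fr.iter ih _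

/-- Started in `σ`, the statement `s` is executed without overflow, and its final state and its
cost satisfy `Q`. -/
def Tr (I : ℕ → ℕ) (E X : ℕ) (s : Stmt) (σ : HS) (Q : HS → ℕ → Prop) : Prop :=
  s.Ok I E X σ ∧ Q (s.run I σ) (s.cost I σ)

section Rules

variable {I : ℕ → ℕ} {E X : ℕ} {σ : HS} {Q : HS → ℕ → Prop}

theorem Tr.skip : Tr I E X .skip σ Q ↔ Q σ 1 := by simp [Tr, Stmt.Ok, Stmt.run, Stmt.cost]

theorem Tr.asg {x : ℕ} {e : Ex} :
    Tr I E X (.asg x e) σ Q ↔ e.eval σ ≤ X ∧ Q (σ.sv x (e.eval σ)) 1 := Iff.rfl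

theorem Tr.wr {t : Fin 16} {e f : Ex} :
    Tr I E X (.wr t e f) σ Q ↔ f.eval σ ≤ X ∧ Q (σ.sa t (e.eval σ) (f.eval σ)) 1 := Iff.rfl

theorem Tr.inp {x : ℕ} {e : Ex} :
    Tr I E X (.inp x e) σ Q ↔ e.eval σ < E ∧ Q (σ.sv x (I (e.eval σ))) 1 := Iff.rfl

theorem Tr.seq {s s' : Stmt} : Tr I E X (.seq s s') σ Q ↔
    Tr I E X s σ fun σ' t => Tr I E X s' σ' fun σ'' t' => Q σ'' (t + t') := by
  simp [Tr, Stmt.Ok, Stmt.run, Stmt.cost, and_assoc]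

theorem Tr.ite {e f : Ex} {s s' : Stmt} : Tr I E X (.ite e f s s') σ Q ↔
    (e.eval σ < f.eval σ → Tr I E X s σ fun σ' t => Q σ' (t + 1)) ∧
    (¬ e.eval σ < f.eval σ → Tr I E X s' σ fun σ' t => Q σ' (t + 1)) := by
  by_cases h : e.eval σ < f.eval σ <;> simp [Tr, Stmt.Ok, Stmt.run, Stmt.cost, h]

/-- The frame `Fr` comes for free from the syntax of `s`, so specifications need not list what stays
unchanged. -/
theorem Tr.conseq {s : Stmt} {Q' : HS → ℕ → Prop} (h : Tr I E X s σ Q')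
    (hQ : ∀ σ' t, Fr s σ σ' → Q' σ' t → Q σ' t) : Tr I E X s σ Q :=
  ⟨h.1, hQ _ _ (s.run_fr I σ) h.2⟩

/-- The invariant sees the time spent so far, which permits amortized bounds, such as those by the
number of pieces created or by a sum of degrees. -/
theorem Tr.rep {x : ℕ} {e : Ex} {s : Stmt} (Inv : ℕ → HS → ℕ → Prop) (hN : e.eval σ ≤ X)
    (h0 : Inv 0 σ 0)
    (hstep : ∀ j < e.eval σ, ∀ σ' t, Fr (.rep x e s) σ σ' → Inv j σ' t →
      Tr I E X s (σ'.sv x j) fun σ'' t' => Inv (j + 1) σ'' (t + t' + 1))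
    (hQ : ∀ σ' t, Fr (.rep x e s) σ σ' → Inv (e.eval σ) σ' t → Q σ' (t + 1)) :
    Tr I E X (.rep x e s) σ Q := by
  have hfr := Fr.iter (x := x) (e := e) (σ := σ) (s.run_fr I)
  have key : ∀ j ≤ e.eval σ, Inv j (iter (fun j τ => s.run I (τ.sv x j)) j σ)
      (∑ i ∈ Finset.range j, (s.cost I ((iter (fun j τ => s.run I (τ.sv x j)) i σ).sv x i) + 1)) := by
    intro j
    induction j with
    | zero => intro _; exact h0
    | succ j ih =>
      intro hj
      rw [Finset.sum_range_succ, ← add_assoc]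
      exact (hstep j hj _ _ (hfr j) (ih (by omega))).2
  refine ⟨⟨hN, fun j hj => (hstep j hj _ _ (hfr j) (key j hj.le)).1⟩, ?_⟩
  have := hQ _ _ (hfr _) (key _ le_rfl)
  simpa only [Stmt.cost, Stmt.run, add_comm] using this

/-- Loops whose body has a fixed time bound. -/
theorem Tr.rep_le {x : ℕ} {e : Ex} {s : Stmt} (Inv : ℕ → HS → Prop) (T : ℕ) (hN : e.eval σ ≤ X)
    (h0 : Inv 0 σ)
    (hstep : ∀ j < e.eval σ, ∀ σ', Fr (.rep x e s) σ σ' → Inv j σ' →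
      Tr I E X s (σ'.sv x j) fun σ'' t => Inv (j + 1) σ'' ∧ t ≤ T)
    (hQ : ∀ σ' t, Fr (.rep x e s) σ σ' → Inv (e.eval σ) σ' → t ≤ e.eval σ * (T + 1) + 1 → Q σ' t) :
    Tr I E X (.rep x e s) σ Q := by
  refine Tr.rep (fun j σ' t => Inv j σ' ∧ t ≤ j * (T + 1)) hN ⟨h0, by simp⟩ ?_ ?_
  · rintro j hj σ' t hF ⟨hI, ht⟩
    refine (hstep j hj σ' hF hI).conseq ?_
    rintro σ'' t' - ⟨h1, h2⟩
    refine ⟨h1, ?_⟩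
    rw [Nat.add_mul]; omega
  · rintro σ' t hF ⟨hI, ht⟩
    exact hQ σ' _ hF hI (by omega)

/-- Loops that look for a value of the loop variable with a certain property. -/
theorem Tr.rep_search {x r : ℕ} {e : Ex} {s : Stmt} (V : ℕ → Prop) (T : ℕ) (hN : e.eval σ ≤ X)
    (hr : σ.v r ≤ 1)
    (hstep : ∀ j < e.eval σ, ∀ σ', Fr (.rep x e s) σ σ' → σ'.v r ≤ 1 →
      Tr I E X s (σ'.sv x j) fun σ'' t =>
        (σ''.v r ≤ 1 ∧ (σ''.v r = 0 ↔ σ'.v r = 0 ∨ V j)) ∧ t ≤ T) :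
    Tr I E X (.rep x e s) σ fun σ' t =>
      (σ'.v r ≤ 1 ∧ (σ'.v r = 0 ↔ σ.v r = 0 ∨ ∃ j < e.eval σ, V j)) ∧ t ≤ e.eval σ * (T + 1) + 1 := by
  refine Tr.rep_le (fun j σ' => σ'.v r ≤ 1 ∧ (σ'.v r = 0 ↔ σ.v r = 0 ∨ ∃ i < j, V i)) T hN
    ⟨hr, by simp⟩ ?_ fun σ' t _ h ht => ⟨h, ht⟩
  rintro j hj σ' hF ⟨h1, h2⟩
  refine (hstep j hj σ' hF h1).conseq ?_
  rintro σ'' t - ⟨⟨h3, h4⟩, h5⟩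
  refine ⟨⟨h3, ?_⟩, h5⟩
  rw [h4, h2, or_assoc]
  refine or_congr Iff.rfl ⟨?_, ?_⟩
  · rintro (⟨i, hi, hV⟩ | hV)
    exacts [⟨i, by omega, hV⟩, ⟨j, by omega, hV⟩]
  · rintro ⟨i, hi, hV⟩
    rcases Nat.lt_succ_iff_lt_or_eq.1 hi with h | rfl
    exacts [.inl ⟨i, h, hV⟩, .inr hV]

end Rules

/-- The program that computes the length of the input and then executes `s`. -/
def Stmt.prog (s : Stmt) : Prog :=
  .seq (.const 1 0) (.seq (.load 1 1) (.seq (.const 4 2) (.seq (.arith .add 1 1 4)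
    (.seq (.load 2 1) (s.comp 0)))))

/-- Cell `n + 2` of the input holds the end of the last adjacency list, which is the length of the
input. It becomes the base address of the arrays; fetching it takes the five extra steps. -/
theorem Stmt.prog_exec {s : Stmt} {l : List ℕ} {X B : ℕ} {Q : HS → ℕ → Prop} (hX : 2 ≤ X)
    (hl : l.length ≤ X) (hI : ∀ i < l.length, l.getD i 0 ≤ X)
    (hend : l.getD (l.getD 0 0 + 2) 0 = l.length) (h0 : l.getD 0 0 + 2 ≤ X)
    (hB : X ^ s.sz ≤ B) (hXB : X ≤ B)
    (h : Tr (fun i => l.getD i 0) l.length X s ⟨fun _ => 0, fun _ _ => 0⟩ Q) :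
    ∃ t st σ t', Exec B s.prog (initState l) t st ∧ Q σ t' ∧ t ≤ s.factor * t' + 5 ∧
      st.reg 0 = σ.v 0 := by
  set n := l.getD 0 0 with hn
  have y1 : Exec B (.const 1 0) (initState l) 1 ((initState l).setReg 1 0) := .const _ _ _ (by omega)
  have y2 : Exec B (.load 1 1) ((initState l).setReg 1 0) 1
      (((initState l).setReg 1 0).setReg 1 n) := by
    have := Exec.load (B := B) ((initState l).setReg 1 0) 1 1
    simp only [State.setReg_reg, State.setReg_mem, if_true] at this
    exact this (by show l.getD 0 0 ≤ B; omega)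
  have y3 : Exec B (.const 4 2) (((initState l).setReg 1 0).setReg 1 n) 1 _ :=
    .const _ _ _ (by omega)
  have y4 : Exec B (.arith .add 1 1 4) ((((initState l).setReg 1 0).setReg 1 n).setReg 4 2) 1
      (((((initState l).setReg 1 0).setReg 1 n).setReg 4 2).setReg 1 (n + 2)) := by
    have := Exec.arith (B := B) ((((initState l).setReg 1 0).setReg 1 n).setReg 4 2) .add 1 1 4
    simp only [Op.eval, State.setReg_reg, if_true, (by decide : ¬ (1 = 4)), if_false] at this
    exact this (by omega)
  have y5 : Exec B (.load 2 1) (((((initState l).setReg 1 0).setReg 1 n).setReg 4 2).setReg 1 (n + 2)) 1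
      ((((((initState l).setReg 1 0).setReg 1 n).setReg 4 2).setReg 1 (n + 2)).setReg 2 l.length) := by
    have := Exec.load (B := B)
      (((((initState l).setReg 1 0).setReg 1 n).setReg 4 2).setReg 1 (n + 2)) 2 1
    simp only [State.setReg_reg, State.setReg_mem, if_true] at this
    have e : (initState l).mem (n + 2) = l.length := hend
    rw [e] at this
    exact this (by omega)
  obtain ⟨t, st, x, ht, hR, -⟩ := s.comp_exec (I := fun i => l.getD i 0) hX hl hI 0
    ⟨fun _ => 0, fun _ _ => 0⟩
    ((((((initState l).setReg 1 0).setReg 1 n).setReg 4 2).setReg 1 (n + 2)).setReg 2 l.length)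
    (by
      refine ⟨fun x => ?_, by simp, fun t i => ?_, fun i hi => rfl⟩
      · have h1 : 3 * x ≠ 1 := by omega
        have h2 : 3 * x ≠ 2 := by omega
        have h4 : 3 * x ≠ 4 := by omega
        simp [h1, h2, h4, initState]
      · simp [initState])
    (by constructor <;> simp) h.1 hB
  refine ⟨_, st, _, _, .seq y1 (.seq y2 (.seq y3 (.seq y4 (.seq y5 x)))), h.2, by omega, ?_⟩
  simpa using hR.var 0

end HypRAM
namespace HypRAM

/-! ### Decompositions into chains -/

section Chains

variable {V : Type*}

/-- A decomposition of a graph: a piece `e < P` is either a single special vertex (`len e = 0`) or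
a chain `w e 0, …, w e (len e)` between special vertices whose inner vertices have no neighbours
outside the chain. Every vertex is at position `pos v` of its piece `home v`. -/
structure Dec (G : SimpleGraph V) (P : ℕ) (len : ℕ → ℕ) (w : ℕ → ℕ → V) (home pos : V → ℕ) :
    Prop where
  home_lt : ∀ v, home v < P
  w_pos : ∀ v, w (home v) (pos v) = v
  pos_cases : ∀ v, (pos v = 0 ∧ len (home v) = 0) ∨ (0 < pos v ∧ pos v < len (home v))
  first : ∀ e < P, len (home (w e 0)) = 0
  last : ∀ e < P, len (home (w e (len e))) = 0
  inner : ∀ e < P, ∀ j, 0 < j → j < len e → home (w e j) = e ∧ pos (w e j) = j ∧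
    ∀ y, G.Adj (w e j) y ↔ y = w e (j - 1) ∨ y = w e (j + 1)
  surj : ∀ e < P, ∃ v, home v = e

/-- Every interior point has a neighbour that is lower by one. Descending from `j` therefore leads
to one of the ends with slope 1, which gives the lower bound; the Lipschitz condition gives the
upper bound. -/
theorem segment {g : ℕ → ℕ} {l r : ℕ}
    (lip : ∀ j, l ≤ j → j < r → g (j + 1) ≤ g j + 1 ∧ g j ≤ g (j + 1) + 1)
    (low : ∀ j, l < j → j < r → g (j - 1) + 1 = g j ∨ g (j + 1) + 1 = g j)
    {j : ℕ} (hl : l ≤ j) (hr : j ≤ r) : g j = min (g l + (j - l)) (g r + (r - j)) := by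
  have up : ∀ k, l + k ≤ r → g (l + k) ≤ g l + k := by
    intro k
    induction k with
    | zero => simp
    | succ k ih =>
      intro hk
      have := (lip (l + k) (by omega) (by omega)).1
      have := ih (by omega)
      rw [← add_assoc]; omega
  have down : ∀ k, l + k ≤ r → g (r - k) ≤ g r + k := by
    intro k
    induction k with
    | zero => simp
    | succ k ih =>
      intro hk
      have h1 := (lip (r - (k + 1)) (by omega) (by omega)).2
      rw [show r - (k + 1) + 1 = r - k by omega] at h1
      have := ih (by omega)
      omega
  have lower : ∀ m j, l ≤ j → j ≤ r → g j = m → min (g l + (j - l)) (g r + (r - j)) ≤ m := by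
    intro m
    induction m using Nat.strong_induction_on with
    | _ m ih =>
      intro j hl hr hm
      by_cases h1 : j = l
      · subst h1; simp [hm]
      by_cases h2 : j = r
      · subst h2; simp [hm]
      rcases low j (by omega) (by omega) with h | h
      · have := ih (m - 1) (by omega) (j - 1) (by omega) (by omega) (by omega)
        omega
      · have := ih (m - 1) (by omega) (j + 1) (by omega) (by omega) (by omega)
        omega
  have h1 := up (j - l) (by omega)
  have h2 := down (r - j) (by omega)
  have h3 := lower _ j hl hr rfl
  rw [show l + (j - l) = j by omega] at h1
  rw [show r - (r - j) = j by omega] at h2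
  omega

variable {G : SimpleGraph V}

theorem dist_le_succ_of_adj {x y z : V} (h : G.Reachable x y) (hyz : G.Adj y z) :
    G.dist x z ≤ G.dist x y + 1 := by
  obtain ⟨p, hp⟩ := h.exists_walk_length_eq_dist
  have := G.dist_le (p.concat hyz)
  rw [SimpleGraph.Walk.length_concat] at this
  omega

theorem exists_adj_dist {x y : V} (h : G.Reachable x y) (hne : x ≠ y) :
    ∃ z, G.Adj y z ∧ G.dist x z + 1 = G.dist x y := by
  obtain ⟨p, hp⟩ := h.symm.exists_walk_length_eq_dist
  cases p with
  | nil => exact absurd rfl hne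
  | cons hyz q =>
    refine ⟨_, hyz, ?_⟩
    have h1 := G.dist_le q.reverse
    have h2 := dist_le_succ_of_adj ⟨q.reverse⟩ hyz.symm
    rw [SimpleGraph.Walk.length_cons] at hp
    rw [SimpleGraph.Walk.length_reverse] at h1
    rw [G.dist_comm (u := y)] at hp
    omega

namespace Dec

variable {P : ℕ} {len : ℕ → ℕ} {w : ℕ → ℕ → V} {home pos : V → ℕ}

theorem pos_eq_zero (D : Dec G P len w home pos) {v : V} (h : len (home v) = 0) : pos v = 0 := by
  rcases D.pos_cases v with h' | h' <;> omega

theorem w_zero (D : Dec G P len w home pos) {v : V} (h : len (home v) = 0) : w (home v) 0 = v := by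
  rw [← D.pos_eq_zero h, D.w_pos]

theorem pos_mem (D : Dec G P len w home pos) {v : V} (h : len (home v) ≠ 0) :
    0 < pos v ∧ pos v < len (home v) := by
  rcases D.pos_cases v with h' | h' <;> omega

/-- A piece of length one would have no vertex of its own, against `surj`. Edges between two special
vertices thus belong to no piece. -/
theorem len_ne_one (D : Dec G P len w home pos) {e : ℕ} (he : e < P) : len e ≠ 1 := by
  obtain ⟨v, rfl⟩ := D.surj e he
  rcases D.pos_cases v with h | h <;> omega

theorem adj_succ (D : Dec G P len w home pos) {e j : ℕ} (he : e < P) (hj : j < len e) :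
    G.Adj (w e j) (w e (j + 1)) := by
  have := D.len_ne_one he
  by_cases h : 0 < j
  · exact ((D.inner e he j h hj).2.2 _).2 (.inr rfl)
  · exact (((D.inner e he (j + 1) (by omega) (by omega)).2.2 _).2 (.inl (by simp))).symm

theorem reachable_w (D : Dec G P len w home pos) {e : ℕ} (he : e < P) {i j : ℕ} (hi : i ≤ len e)
    (hj : j ≤ len e) : G.Reachable (w e i) (w e j) := by
  have : ∀ j ≤ len e, G.Reachable (w e 0) (w e j) := by
    intro j
    induction j with
    | zero => intro _; rfl
    | succ j ih => intro hj; exact (ih (by omega)).trans (D.adj_succ he hj).reachable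
  exact (this i hi).symm.trans (this j hj)

/-- An inner vertex of the stretch other than `x` has a neighbour nearer to `x`, and its only
neighbours are on the chain, so `segment` applies. Stretches rather than whole chains are needed
when `x` itself lies on the chain. -/
theorem dist_sub (D : Dec G P len w home pos) {e : ℕ} (he : e < P) {x : V} {l r j : ℕ}
    (hrl : r ≤ len e) (hx : G.Reachable x (w e l)) (hne : ∀ j, l < j → j < r → x ≠ w e j)
    (hl : l ≤ j) (hr : j ≤ r) :
    G.dist x (w e j) = min (G.dist x (w e l) + (j - l)) (G.dist x (w e r) + (r - j)) := by
  have hreach : ∀ j ≤ r, G.Reachable x (w e j) :=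
    fun j hj => hx.trans (D.reachable_w he (by omega) (by omega))
  refine segment (g := fun j => G.dist x (w e j)) (l := l) (r := r) ?_ ?_ hl hr
  · intro j h1 h2
    exact ⟨dist_le_succ_of_adj (hreach j (by omega)) (D.adj_succ he (by omega)),
      dist_le_succ_of_adj (hreach (j + 1) (by omega)) (D.adj_succ he (by omega)).symm⟩
  · intro j h1 h2
    obtain ⟨z, hz, hd⟩ := exists_adj_dist (hreach j (by omega)) (hne j h1 h2)
    rcases ((D.inner e he j (by omega) (by omega)).2.2 z).1 hz with rfl | rfl
    exacts [.inl hd, .inr hd]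

/-- Distances to the vertices of a chain from a vertex that is not an inner vertex of it. -/
theorem dist_chain (D : Dec G P len w home pos) {e : ℕ} (he : e < P) {x : V} {j : ℕ}
    (hx : G.Reachable x (w e 0)) (hne : len e = 0 ∨ home x ≠ e) (hj : j ≤ len e) :
    G.dist x (w e j) = min (G.dist x (w e 0) + j) (G.dist x (w e (len e)) + (len e - j)) := by
  have := D.dist_sub he (r := len e) le_rfl hx (fun i h1 h2 h => ?_) (Nat.zero_le j) hj
  · simpa using this
  · rcases hne with h' | h'
    · omega
    · exact h' (h ▸ (D.inner e he i h1 h2).1)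

theorem ne_special {len : ℕ → ℕ} {home : V → ℕ} {e : ℕ} {x : V} (hx : len (home x) = 0) : len e = 0 ∨ home x ≠ e := by
  by_cases h : home x = e
  · left; rw [← h, hx]
  · exact .inr h

theorem ne_first (D : Dec G P len w home pos) {e : ℕ} (he : e < P) (hl : len e ≠ 0) {j : ℕ}
    (h0 : 0 < j) (hj : j < len e) {x : V} (hx : len (home x) = 0) : x ≠ w e j := by
  rintro rfl
  rw [(D.inner e he j h0 hj).1] at hx
  exact hl hx

/-- Distances within a chain. -/
theorem dist_same (D : Dec G P len w home pos) {e : ℕ} (he : e < P) {i j : ℕ} (hij : i ≤ j)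
    (hj : j ≤ len e) : G.dist (w e i) (w e j) =
      min (j - i) (G.dist (w e 0) (w e (len e)) + (len e - (j - i))) := by
  have hne : ∀ k, i < k → k < len e → w e i ≠ w e k := by
    intro k h1 h2 h
    by_cases h0 : 0 < i
    · have h3 := (D.inner e he i h0 (by omega)).2.1
      have h4 := (D.inner e he k (by omega) (by omega)).2.1
      rw [h] at h3; omega
    · obtain rfl : i = 0 := by omega
      exact D.ne_first he (by omega) (by omega) h2 (D.first e he) h
  have h1 := D.dist_sub he le_rfl (SimpleGraph.Reachable.refl _) hne hij hj
  -- The way from position `i` to the far end is either direct or leaves through the near end; the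
  -- direct one never helps to reach `j` from behind.
  have h2 := D.dist_chain he (x := w e (len e)) (j := i) (D.reachable_w he le_rfl (by omega))
    (ne_special (D.last e he)) (by omega)
  rw [SimpleGraph.dist_self] at h1 h2
  rw [G.dist_comm (u := w e (len e)) (v := w e i),
    G.dist_comm (u := w e (len e)) (v := w e 0)] at h2
  omega

/-- The neighbour of an inner vertex at offset `s = 1` or `s = -1` on its chain. -/
def nb (w : ℕ → ℕ → V) (home pos : V → ℕ) (v : V) (s : ℤ) : V :=
  w (home v) ((pos v : ℤ) + s).toNat

theorem nb_zero (D : Dec G P len w home pos) (v : V) : nb w home pos v 0 = v := by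
  simp [nb, D.w_pos]

theorem nb_one (v : V) : nb w home pos v 1 = w (home v) (pos v + 1) := by
  rw [nb, show ((pos v : ℤ) + 1).toNat = pos v + 1 by omega]

theorem nb_neg_one (v : V) : nb w home pos v (-1) = w (home v) (pos v - 1) := by
  rw [nb, show ((pos v : ℤ) + -1).toNat = pos v - 1 by omega]

theorem adj_iff_nb (D : Dec G P len w home pos) {v : V} (hv : len (home v) ≠ 0) (y : V) :
    G.Adj v y ↔ y = nb w home pos v (-1) ∨ y = nb w home pos v 1 := by
  have h := D.pos_mem hv
  have := (D.inner _ (D.home_lt v) _ h.1 h.2).2.2 y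
  rw [D.w_pos] at this
  rw [this, nb_one, nb_neg_one]

theorem adj_nb (D : Dec G P len w home pos) {v : V} (hv : len (home v) ≠ 0) {s : ℤ}
    (hs : s = 1 ∨ s = -1) : G.Adj v (nb w home pos v s) := by
  rw [D.adj_iff_nb hv]
  rcases hs with rfl | rfl <;> simp

/-- The ends of a chain are special, so a neighbour that is not special is still an inner vertex and
its position is determined. -/
theorem pos_nb (D : Dec G P len w home pos) {v : V} (hv : len (home v) ≠ 0) {s : ℤ}
    (hs : -1 ≤ s ∧ s ≤ 1) (h : len (home (nb w home pos v s)) ≠ 0) :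
    (pos (nb w home pos v s) : ℤ) = pos v + s := by
  have hp := D.pos_mem hv
  have hlt := D.home_lt v
  unfold nb at h ⊢
  have h0 : ((pos v : ℤ) + s).toNat ≠ 0 := by
    intro h'; rw [h'] at h; exact h (D.first _ hlt)
  have hl : ((pos v : ℤ) + s).toNat ≠ len (home v) := by
    intro h'; rw [h'] at h; exact h (D.last _ hlt)
  rw [(D.inner _ hlt _ (by omega) (by omega)).2.1]
  omega

theorem reachable_nb (D : Dec G P len w home pos) {v : V} (hv : len (home v) ≠ 0) {s : ℤ}
    (hs : -1 ≤ s ∧ s ≤ 1) : G.Reachable v (nb w home pos v s) := by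
  have hp := D.pos_mem hv
  have := D.reachable_w (D.home_lt v) (i := pos v) (j := ((pos v : ℤ) + s).toNat) (by omega) (by omega)
  rwa [D.w_pos] at this

end Dec

/-! ### Slopes of distances, and moves of pairs along chains -/

/-- The distance to `x` changes at the inner vertex `y` with slope `ρ` along the chain of `y`. -/
def Slope (G : SimpleGraph V) (w : ℕ → ℕ → V) (home pos : V → ℕ) (x y : V) (ρ : ℤ) : Prop :=
  (ρ = 1 ∨ ρ = -1) ∧
    ∀ s : ℤ, -1 ≤ s ∧ s ≤ 1 → (G.dist x (Dec.nb w home pos y s) : ℤ) = G.dist x y + s * ρ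

namespace Dec

variable {P : ℕ} {len : ℕ → ℕ} {w : ℕ → ℕ → V} {home pos : V → ℕ}

theorem slope_of (D : Dec G P len w home pos) {x y : V} {ρ : ℤ} (hρ : ρ = 1 ∨ ρ = -1)
    (h1 : (G.dist x (nb w home pos y 1) : ℤ) = G.dist x y + ρ)
    (h2 : (G.dist x (nb w home pos y (-1)) : ℤ) = G.dist x y - ρ) : Slope G w home pos x y ρ := by
  refine ⟨hρ, fun s hs => ?_⟩
  obtain rfl | rfl | rfl : s = -1 ∨ s = 0 ∨ s = 1 := by omega
  · rw [h2]; ring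
  · rw [D.nb_zero]; ring
  · rw [h1]; ring

/-- Moving both ends of a pair whose distance has slopes at both ends. -/
theorem dist_nb_nb_le (D : Dec G P len w home pos) {a c : V} (ha : len (home a) ≠ 0)
    (hc : len (home c) ≠ 0) (hac : G.Reachable a c) (h2 : 2 ≤ G.dist a c) {α γ : ℤ}
    (hα : Slope G w home pos c a α) (hγ : Slope G w home pos a c γ) {s t : ℤ}
    (hs : -1 ≤ s ∧ s ≤ 1) (ht : -1 ≤ t ∧ t ≤ 1) :
    (G.dist (nb w home pos a s) (nb w home pos c t) : ℤ) ≤ G.dist a c + s * α + t * γ := by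
  have e1 := hα.2 s hs
  have e2 := hγ.2 t ht
  rw [G.dist_comm (u := c), G.dist_comm (u := c)] at e1
  have ra := D.reachable_nb ha hs
  have rc := D.reachable_nb hc ht
  by_cases ht0 : t = 0
  · subst ht0; rw [D.nb_zero]; omega
  by_cases hs0 : s = 0
  · subst hs0; rw [D.nb_zero]; omega
  have hs' : s = 1 ∨ s = -1 := by omega
  have ht' : t = 1 ∨ t = -1 := by omega
  have hsα : s * α = 1 ∨ s * α = -1 := by
    rcases hs' with rfl | rfl <;> rcases hα.1 with rfl | rfl <;> simp
  have htγ : t * γ = 1 ∨ t * γ = -1 := by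
    rcases ht' with rfl | rfl <;> rcases hγ.1 with rfl | rfl <;> simp
  have up1 := dist_le_succ_of_adj (ra.symm.trans hac) (D.adj_nb hc ht')
  have up2 := dist_le_succ_of_adj (rc.symm.trans hac.symm) (D.adj_nb ha hs')
  rw [G.dist_comm (u := nb w home pos c t), G.dist_comm (u := nb w home pos c t)] at up2
  -- If one of the two moves increases the distance, the slope for the other move and one edge
  -- suffice.
  rcases htγ with ht1 | ht1
  · omega
  rcases hsα with hs1 | hs1
  · omega
  -- both ends move towards each other
  have hne : nb w home pos c t ≠ a := by
    intro h; rw [h, SimpleGraph.dist_self] at e2; omega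
  obtain ⟨z, hz, hd⟩ := exists_adj_dist (rc.symm.trans hac.symm) hne
  have e3 := hα.2 (-s) (by omega)
  rw [G.dist_comm (u := c), G.dist_comm (u := c)] at e3
  have hz' : z = nb w home pos a s ∨ z = nb w home pos a (-s) := by
    have := (D.adj_iff_nb ha z).1 hz
    rcases hs' with rfl | rfl
    · tauto
    · simpa using this
  rcases hz' with rfl | rfl
  · rw [G.dist_comm (u := nb w home pos c t), G.dist_comm (u := nb w home pos c t)] at hd
    omega
  -- On the wrong side, `z` would be at distance at most `G.dist a c - 1` from `c`, whereas the
  -- slope at `a` puts it at `G.dist a c + 1`.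
  · exfalso
    have ra' := D.reachable_nb ha (s := -s) (by omega)
    have up := dist_le_succ_of_adj (x := nb w home pos a (-s)) (ra'.symm.trans (hac.trans rc))
      (D.adj_nb hc ht').symm
    rw [G.dist_comm (u := nb w home pos c t), G.dist_comm (u := nb w home pos c t)] at hd
    have : -s * α = 1 := by rw [neg_mul]; omega
    omega

/-- The ends of a pair at locally maximal distance can be moved together. -/
theorem exists_move (D : Dec G P len w home pos) {a b : V} (ha : len (home a) ≠ 0)
    (hb : len (home b) ≠ 0) (hab : G.Reachable a b)
    (hfar : ∀ s : ℤ, -1 ≤ s ∧ s ≤ 1 → G.dist (nb w home pos a s) b ≤ G.dist a b)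
    (hs : ∀ u, len (home u) = 0 → G.Reachable a u → ∃ ρ, Slope G w home pos u a ρ) :
    ∃ η : ℤ, (η = 1 ∨ η = -1) ∧ ∀ s : ℤ, -1 ≤ s ∧ s ≤ 1 →
      G.dist a b ≤ G.dist (nb w home pos a s) (nb w home pos b (η * s)) := by
  have hpa := D.pos_mem ha
  have hpb := D.pos_mem hb
  have hlb := D.home_lt b
  by_cases hh : home a = home b
  -- On a common chain the distance depends only on the difference of positions, so both vertices
  -- are translated alike.
  · refine ⟨1, .inl rfl, fun s hs => ?_⟩
    rw [one_mul]
    have key : ∀ i j : ℕ, i ≤ len (home b) → j ≤ len (home b) →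
        ((i : ℤ) + s).toNat ≤ len (home b) → ((j : ℤ) + s).toNat ≤ len (home b) →
        0 ≤ i + s → 0 ≤ j + s → i ≤ j →
        G.dist (w (home b) i) (w (home b) j) =
          G.dist (w (home b) ((i : ℤ) + s).toNat) (w (home b) ((j : ℤ) + s).toNat) := by
      intro i j h1 h2 h3 h4 h5 h6 h7
      rw [D.dist_same hlb h7 h2, D.dist_same hlb (by omega) h4,
        show ((j : ℤ) + s).toNat - ((i : ℤ) + s).toNat = j - i by omega]
    rw [hh] at hpa
    unfold nb
    conv_lhs => rw [← D.w_pos a, ← D.w_pos b]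
    rw [hh]
    rcases le_total (pos a) (pos b) with h | h
    · exact (key _ _ (by omega) (by omega) (by omega) (by omega) (by omega) (by omega) h).le
    · rw [G.dist_comm, key _ _ (by omega) (by omega) (by omega) (by omega) (by omega) (by omega) h,
        G.dist_comm]
  · have rr : ∀ j ≤ len (home b), G.Reachable a (w (home b) j) := fun j hj =>
      hab.trans (by
        have := D.reachable_w hlb (i := pos b) (j := j) (by omega) hj
        rwa [D.w_pos] at this)
    obtain ⟨ρ, hρ⟩ := hs _ (D.first _ hlb) (rr 0 (by omega))
    obtain ⟨ρ', hρ'⟩ := hs _ (D.last _ hlb) (rr _ le_rfl)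
    -- A shortest way from the moved `a` enters the chain of `b` through one of its ends, and the
    -- distances to both ends have slopes at `a`.
    have form : ∀ (s : ℤ), -1 ≤ s ∧ s ≤ 1 → ∀ j ≤ len (home b),
        (G.dist (nb w home pos a s) (w (home b) j) : ℤ) =
        min (G.dist (w (home b) 0) a + s * ρ + j)
          (G.dist (w (home b) (len (home b))) a + s * ρ' + (len (home b) - j : ℕ)) := by
      intro s hs j hj
      have hne : len (home b) = 0 ∨ home (nb w home pos a s) ≠ home b := by
        by_cases h0 : len (home (nb w home pos a s)) = 0
        · exact ne_special h0
        right
        have h1 : ((pos a : ℤ) + s).toNat ≠ 0 := by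
          intro h'; rw [nb, h'] at h0; exact h0 (D.first _ (D.home_lt a))
        have h2 : ((pos a : ℤ) + s).toNat ≠ len (home a) := by
          intro h'; rw [nb, h'] at h0; exact h0 (D.last _ (D.home_lt a))
        rw [nb, (D.inner _ (D.home_lt a) _ (by omega) (by omega)).1]
        exact hh
      rw [D.dist_chain hlb ((D.reachable_nb ha hs).symm.trans (rr 0 (by omega))) hne hj]
      have e1 := hρ.2 s hs
      have e2 := hρ'.2 s hs
      rw [G.dist_comm] at e1 e2
      push_cast
      rw [e1, e2]
    have hd := form 0 (by omega) (pos b) hpb.2.le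
    rw [D.nb_zero, D.w_pos] at hd
    simp only [zero_mul, add_zero] at hd
    -- With equal slopes, moving `a` by `ρ` would raise both branches of the minimum, so `b` would
    -- be farther away than `hfar` allows.
    have hopp : ρ' = -ρ := by
      have h1 := form ρ (by rcases hρ.1 with h | h <;> omega) (pos b) hpb.2.le
      have h2 := hfar ρ (by rcases hρ.1 with h | h <;> omega)
      rw [D.w_pos] at h1
      rcases hρ.1 with rfl | rfl <;> rcases hρ'.1 with rfl | rfl <;> simp at h1 ⊢ <;> omega
    -- As the slopes are opposite, moving `b` by `-ρ * s` compensates the change in both branches at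
    -- once.
    refine ⟨-ρ, by rcases hρ.1 with h | h <;> omega, fun s hs => ?_⟩
    have hs' : -1 ≤ -ρ * s ∧ -ρ * s ≤ 1 := by
      rcases hρ.1 with rfl | rfl <;> constructor <;> omega
    have h1 := form s hs ((pos b : ℤ) + -ρ * s).toNat (by omega)
    rw [hopp] at h1
    rw [show nb w home pos b (-ρ * s) = w (home b) ((pos b : ℤ) + -ρ * s).toNat from rfl]
    have e : s * -ρ = -ρ * s := by ring
    have e' : s * ρ = -(-ρ * s) := by ring
    rw [e, e'] at h1
    generalize -ρ * s = q at *
    omega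

end Dec

end Chains

end HypRAM
namespace HypRAM

/-! ### Violating quadruples and critical pairs -/

section Candidates

variable {V : Type*}

/-- The quadruple lies in one component and shows that `G` is not `δ`-hyperbolic. -/
def Violates (G : SimpleGraph V) (δ : ℕ) (a b c d : V) : Prop :=
  (G.Reachable a b ∧ G.Reachable a c ∧ G.Reachable a d) ∧
    max (G.dist a c + G.dist b d) (G.dist a d + G.dist b c) + δ < G.dist a b + G.dist c d

/-- If `D₂` and `D₃` are both finite, the four vertices lie in one component. In all other cases the
right-hand side of the four-point condition is infinite. -/
theorem isHyperbolic_iff_not_violates (G : SimpleGraph V) (δ : ℕ) :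
    IsHyperbolic G δ ↔ ∀ a b c d, ¬ Violates G δ a b c d := by
  rw [isHyperbolic_iff]
  have hmax : ∀ x y : ℕ, max (x : ℕ∞) y = (max x y : ℕ) := fun x y => Nat.mono_cast.map_max.symm
  constructor
  · rintro h a b c d ⟨⟨hab, hac, had⟩, hlt⟩
    have := h a b c d
    rw [← hab.coe_dist_eq_edist, ← hac.coe_dist_eq_edist, ← had.coe_dist_eq_edist,
      ← (hac.symm.trans had).coe_dist_eq_edist, ← (hab.symm.trans had).coe_dist_eq_edist,
      ← (hab.symm.trans hac).coe_dist_eq_edist] at this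
    norm_cast at this
    rw [hmax] at this
    norm_cast at this
    omega
  · intro h a b c d
    by_cases hr : G.Reachable a b ∧ G.Reachable a c ∧ G.Reachable a d
    · have : ¬ max (G.dist a c + G.dist b d) (G.dist a d + G.dist b c) + δ <
        G.dist a b + G.dist c d := fun hlt => h a b c d ⟨hr, hlt⟩
      obtain ⟨hab, hac, had⟩ := hr
      rw [← hab.coe_dist_eq_edist, ← hac.coe_dist_eq_edist, ← had.coe_dist_eq_edist,
        ← (hac.symm.trans had).coe_dist_eq_edist, ← (hab.symm.trans had).coe_dist_eq_edist,
        ← (hab.symm.trans hac).coe_dist_eq_edist]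
      norm_cast
      rw [hmax]
      norm_cast
      omega
    · suffices G.edist a c + G.edist b d = ⊤ ∨ G.edist a d + G.edist b c = ⊤ by
        rcases this with h | h <;> simp [h]
      by_contra hcon
      rw [not_or] at hcon
      have h1 : G.Reachable a c := SimpleGraph.edist_ne_top_iff_reachable.1 fun h' => hcon.1 (by simp [h'])
      have h3 : G.Reachable a d := SimpleGraph.edist_ne_top_iff_reachable.1 fun h' => hcon.2 (by simp [h'])
      have h4 : G.Reachable b c := SimpleGraph.edist_ne_top_iff_reachable.1 fun h' => hcon.2 (by simp [h'])
      exact hr ⟨h1.trans h4.symm, h1, h3⟩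

theorem exists_lex_max {α : Type*} [Finite α] {S : Set α} (hS : S.Nonempty) (f₁ f₂ f₃ f₄ : α → ℤ) :
    ∃ x ∈ S, ∀ y ∈ S, f₁ y ≤ f₁ x ∧ (f₁ y = f₁ x → f₂ y ≤ f₂ x ∧ (f₂ y = f₂ x → f₃ y ≤ f₃ x ∧
      (f₃ y = f₃ x → f₄ y ≤ f₄ x))) := by
  obtain ⟨x₁, h₁, m₁⟩ := Set.exists_max_image S f₁ S.toFinite hS
  obtain ⟨x₂, h₂, m₂⟩ := Set.exists_max_image {x ∈ S | f₁ x = f₁ x₁} f₂ (Set.toFinite _) ⟨x₁, h₁, rfl⟩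
  obtain ⟨x₃, h₃, m₃⟩ := Set.exists_max_image {x ∈ S | f₁ x = f₁ x₁ ∧ f₂ x = f₂ x₂} f₃
    (Set.toFinite _) ⟨x₂, h₂.1, h₂.2, rfl⟩
  obtain ⟨x₄, h₄, m₄⟩ := Set.exists_max_image {x ∈ S | f₁ x = f₁ x₁ ∧ f₂ x = f₂ x₂ ∧ f₃ x = f₃ x₃} f₄
    (Set.toFinite _) ⟨x₃, h₃.1, h₃.2.1, h₃.2.2, rfl⟩
  obtain ⟨hx, e1, e2, e3⟩ := h₄
  refine ⟨x₄, hx, fun y hy => ⟨e1 ▸ m₁ y hy, fun y1 => ⟨e2 ▸ m₂ y ⟨hy, y1.trans e1⟩,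
    fun y2 => ⟨e3 ▸ m₃ y ⟨hy, y1.trans e1, y2.trans e2⟩, fun y3 =>
      m₄ y ⟨hy, y1.trans e1, y2.trans e2, y3.trans e3⟩⟩⟩⟩⟩

/-- Excess `D₁ - max (D₂, D₃)` of a quadruple. -/
noncomputable def excess (G : SimpleGraph V) (q : V × V × V × V) : ℤ :=
  (G.dist q.1 q.2.1 + G.dist q.2.2.1 q.2.2.2 : ℕ) -
    (max (G.dist q.1 q.2.2.1 + G.dist q.2.1 q.2.2.2) (G.dist q.1 q.2.2.2 + G.dist q.2.1 q.2.2.1) : ℕ)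

/-- The sum `D₁` of a quadruple. -/
noncomputable def firstSum (G : SimpleGraph V) (q : V × V × V × V) : ℤ :=
  (G.dist q.1 q.2.1 + G.dist q.2.2.1 q.2.2.2 : ℕ)

/-- The vertices of the quadruple lie in one component. -/
def Conn (G : SimpleGraph V) (q : V × V × V × V) : Prop :=
  G.Reachable q.1 q.2.1 ∧ G.Reachable q.1 q.2.2.1 ∧ G.Reachable q.1 q.2.2.2

/-- The quadruple maximizes the excess, and `D₁` among those. -/
def Top (G : SimpleGraph V) (q : V × V × V × V) : Prop :=
  Conn G q ∧ ∀ q', Conn G q' → excess G q' ≤ excess G q ∧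
    (excess G q' = excess G q → firstSum G q' ≤ firstSum G q)

variable {G : SimpleGraph V} {a b c d : V}

theorem Top.congr {q q' : V × V × V × V} (h : Top G q) (hc : Conn G q')
    (h1 : excess G q' = excess G q) (h2 : firstSum G q' = firstSum G q) : Top G q' :=
  ⟨hc, fun p hp => by rw [h1, h2]; exact h.2 p hp⟩

theorem Top.conn (h : Top G (a, b, c, d)) :
    G.Reachable a b ∧ G.Reachable a c ∧ G.Reachable a d := h.1

theorem Top.swap (h : Top G (a, b, c, d)) : Top G (b, a, c, d) := by
  obtain ⟨h1, h2, h3⟩ := h.conn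
  refine h.congr ⟨h1.symm, h1.symm.trans h2, h1.symm.trans h3⟩ ?_ ?_
  · simp only [excess, G.dist_comm (u := b) (v := a), max_comm, add_comm]
  · simp only [firstSum, G.dist_comm (u := b) (v := a)]

theorem Top.rot (h : Top G (a, b, c, d)) : Top G (c, d, a, b) := by
  obtain ⟨h1, h2, h3⟩ := h.conn
  refine h.congr ⟨h2.symm.trans h3, h2.symm, h2.symm.trans h1⟩ ?_ ?_
  · simp only [excess, G.dist_comm (u := c) (v := a), G.dist_comm (u := d) (v := b),
      G.dist_comm (u := c) (v := b), G.dist_comm (u := d) (v := a)]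
    rw [add_comm (G.dist c d), add_comm (G.dist b c)]
  · simp only [firstSum, add_comm]

/-- A step of `a` changes `D₂` and `D₃` by at most one. If it raised `D₁`, the excess would not drop
and `D₁` would be larger. -/
theorem Top.far (h : Top G (a, b, c, d)) {a' : V} (ha : G.Adj a a') : G.dist a' b ≤ G.dist a b := by
  by_contra! hlt
  obtain ⟨h1, h2, h3⟩ := h.conn
  have hm := h.2 (a', b, c, d) ⟨ha.symm.reachable.trans h1, ha.symm.reachable.trans h2,
    ha.symm.reachable.trans h3⟩
  have e1 := dist_le_succ_of_adj h2.symm ha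
  have e2 := dist_le_succ_of_adj h3.symm ha
  have e3 := dist_le_succ_of_adj h1.symm ha
  rw [G.dist_comm, G.dist_comm (u := c) (v := a)] at e1
  rw [G.dist_comm, G.dist_comm (u := d) (v := a)] at e2
  rw [G.dist_comm, G.dist_comm (u := b) (v := a)] at e3
  simp only [excess, firstSum] at hm
  omega

section

variable {P : ℕ} {len : ℕ → ℕ} {w : ℕ → ℕ → V} {home pos : V → ℕ} {F : V → V → Prop} {δ : ℕ}

/-- `F x y` holds for all `y` that are critical for the distance to `x`. -/
structure Crit (G : SimpleGraph V) (len : ℕ → ℕ) (w : ℕ → ℕ → V) (home pos : V → ℕ)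
    (F : V → V → Prop) : Prop where
  special : ∀ x y, len (home y) = 0 → F x y
  slope : ∀ x y, len (home y) ≠ 0 → G.Reachable x y → (¬ ∃ ρ, Slope G w home pos x y ρ) → F x y
  near : ∀ x y, len (home x) ≠ 0 → len (home y) ≠ 0 → G.dist x y = 1 → F x y

/-- The distance to `a` has a local minimum at `a`, hence no slope there. -/
theorem Crit.refl (hF : Crit G len w home pos F) (a : V) : F a a := by
  by_cases ha : len (home a) = 0
  · exact hF.special _ _ ha
  · refine hF.slope _ _ ha (.refl _) ?_
    rintro ⟨ρ, hρ, h⟩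
    have h1 := h 1 (by omega)
    have h2 := h (-1) (by omega)
    rw [SimpleGraph.dist_self] at h1 h2
    rcases hρ with rfl | rfl <;> omega

/-- A slope at `a` would allow a step away from `b`, against `Top.far`. -/
theorem Top.crit (D : Dec G P len w home pos) (hF : Crit G len w home pos F)
    (h : Top G (a, b, c, d)) : F b a := by
  by_cases ha : len (home a) = 0
  · exact hF.special _ _ ha
  · refine hF.slope _ _ ha h.conn.1.symm ?_
    rintro ⟨ρ, hρ, hs⟩
    have h1 := h.far (D.adj_nb ha hρ)
    have h2 := hs ρ (by omega)
    rw [G.dist_comm, G.dist_comm (u := b)] at h2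
    rcases hρ with rfl | rfl <;> omega

/-- A special quadruple can be found along critical pairs. -/
def Found (G : SimpleGraph V) (F : V → V → Prop) (δ : ℕ) : Prop :=
  ∃ c d u a b, F c d ∧ F c u ∧ F u a ∧ F a b ∧ Violates G δ a b c d

/-- The pairs `c, d` and `a, b` are critical by maximality, so only a link from `c` to `a` in two
critical steps is missing. Counting `d`, `u`, `a` and `b` over the candidates of an arbitrary `c`
gives the exponent four. -/
theorem Top.found (D : Dec G P len w home pos) (hF : Crit G len w home pos F)
    (h : Top G (a, b, c, d)) (hδ : ∃ p, Conn G p ∧ (δ : ℤ) < excess G p) {u : V} (h1 : F c u) (h2 : F u a) :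
    Found G F δ := by
  obtain ⟨p, hp, hlt⟩ := hδ
  refine ⟨c, d, u, a, b, h.rot.swap.crit D hF, h1, h2, h.swap.crit D hF, h.1, ?_⟩
  have := (h.2 p hp).1
  generalize excess G p = x at *
  simp only [excess] at this
  omega

/-- Each failure would supply the missing link: with `u = a` if `a` is special or has no slope
towards `c`, and with `u` itself if `u` is special and its distance has no slope at `a`. -/
theorem Top.slope (D : Dec G P len w home pos) (hF : Crit G len w home pos F)
    (hno : ¬ Found G F δ) (h : Top G (a, b, c, d)) (hδ : ∃ p, Conn G p ∧ (δ : ℤ) < excess G p) :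
    len (home a) ≠ 0 ∧ (∃ ρ, Slope G w home pos c a ρ) ∧
      ∀ u, len (home u) = 0 → G.Reachable a u → ∃ ρ, Slope G w home pos u a ρ := by
  have ha : len (home a) ≠ 0 := fun ha =>
    hno (h.found D hF hδ (hF.special c a ha) (hF.refl a))
  refine ⟨ha, ?_, fun u hu hr => ?_⟩
  · by_contra hs
    exact hno (h.found D hF hδ (hF.slope c a ha h.conn.2.1.symm hs) (hF.refl a))
  · by_contra hs
    exact hno (h.found D hF hδ (hF.special c u hu) (hF.slope u a ha hr.symm hs))

/-- Distances zero and one between inner vertices are critical by `Crit.refl` and by the field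
`near`. -/
theorem Top.two_le (D : Dec G P len w home pos) (hF : Crit G len w home pos F)
    (hno : ¬ Found G F δ) (h : Top G (a, b, c, d)) (hδ : ∃ p, Conn G p ∧ (δ : ℤ) < excess G p) :
    2 ≤ G.dist a c := by
  by_contra! hlt
  have ha := (h.slope D hF hno hδ).1
  have hc : len (home c) ≠ 0 := fun hc =>
    hno (h.rot.found D hF hδ (hF.special a c hc) (hF.refl c))
  have hca : F c a := by
    by_cases h0 : G.dist a c = 0
    · rw [h.conn.2.1.dist_eq_zero_iff] at h0
      rw [h0]; exact hF.refl c
    · exact hF.near c a hc ha (by rw [G.dist_comm]; omega)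
  exact hno (h.found D hF hδ hca (hF.refl a))

/-- The two forms bound the changes of `D₂` and `D₃`. A step on which both vanish can be reversed,
and in the given range `3 * s + t` vanishes only at zero, so the sign can be chosen to make it
positive. -/
theorem exists_direction : ∀ A ∈ ({-2, 0, 2} : Finset ℤ), ∀ B ∈ ({-2, 0, 2} : Finset ℤ),
    ∀ A' ∈ ({-2, 0, 2} : Finset ℤ), ∀ B' ∈ ({-2, 0, 2} : Finset ℤ),
    ∃ s ∈ ({-1, 0, 1} : Finset ℤ), ∃ t ∈ ({-1, 0, 1} : Finset ℤ),
      s * A + t * B ≤ 0 ∧ s * A' + t * B' ≤ 0 ∧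
      ¬ (s * A + t * B = 0 ∧ s * A' + t * B' = 0 ∧ 3 * s + t ≤ 0) := by
  decide

/-- If `G` is not `δ`-hyperbolic then this is shown by a quadruple that can be found along
critical pairs. -/
theorem Crit.found [Finite V] (D : Dec G P len w home pos) (hF : Crit G len w home pos F)
    (hv : ∃ a b c d, Violates G δ a b c d) : Found G F δ := by
  by_contra hno
  have hδ : ∃ p, Conn G p ∧ (δ : ℤ) < excess G p := by
    obtain ⟨a, b, c, d, h1, h2⟩ := hv
    exact ⟨(a, b, c, d), h1, by simp only [excess]; omega⟩
  -- The first two keys give `Top`. The third detects a drop of only one of `D₂` and `D₃`, and the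
  -- fourth excludes moves that leave all sums unchanged; its weights are those of
  -- `exists_direction`.
  obtain ⟨⟨a, b, c, d⟩, hq, hmax⟩ := exists_lex_max (S := {q | Conn G q}) (hδ.imp fun _ h => h.1)
    (excess G) (firstSum G)
    (fun q => -(G.dist q.1 q.2.2.1 + G.dist q.2.1 q.2.2.2 + G.dist q.1 q.2.2.2 +
      G.dist q.2.1 q.2.2.1 : ℕ)) (fun q => 3 * pos q.1 + pos q.2.2.1)
  have T1 : Top G (a, b, c, d) := ⟨hq, fun q' h => ⟨(hmax q' h).1, fun e => ((hmax q' h).2 e).1⟩⟩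
  have T2 : Top G (b, a, c, d) := T1.swap
  have T3 : Top G (c, d, a, b) := T1.rot
  have T4 : Top G (d, c, a, b) := T3.swap
  have T5 : Top G (a, b, d, c) := T4.rot
  have T6 : Top G (b, a, d, c) := T5.swap
  have T7 : Top G (c, d, b, a) := T2.rot
  have T8 : Top G (d, c, b, a) := T7.swap
  obtain ⟨ha, ⟨αc, hαc⟩, sa⟩ := T1.slope D hF hno hδ
  obtain ⟨hb, ⟨βc, hβc⟩, -⟩ := T2.slope D hF hno hδ
  obtain ⟨hc, ⟨γa, hγa⟩, sc⟩ := T3.slope D hF hno hδ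
  obtain ⟨hd, ⟨δa, hδa⟩, -⟩ := T4.slope D hF hno hδ
  obtain ⟨-, ⟨αd, hαd⟩, -⟩ := T5.slope D hF hno hδ
  obtain ⟨-, ⟨βd, hβd⟩, -⟩ := T6.slope D hF hno hδ
  obtain ⟨-, ⟨γb, hγb⟩, -⟩ := T7.slope D hF hno hδ
  obtain ⟨-, ⟨δb, hδb⟩, -⟩ := T8.slope D hF hno hδ
  have far : ∀ {a b c d : V}, Top G (a, b, c, d) → len (home a) ≠ 0 → ∀ s : ℤ, -1 ≤ s ∧ s ≤ 1 →
      G.dist (Dec.nb w home pos a s) b ≤ G.dist a b := by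
    intro a b c d T ha s hs
    by_cases h0 : s = 0
    · rw [h0, D.nb_zero]
    · exact T.far (D.adj_nb ha (by omega))
  obtain ⟨rab, rac, rad⟩ := T1.conn
  have rcd := rac.symm.trans rad
  obtain ⟨η, hη, mη⟩ := D.exists_move ha hb rab (far T1 ha) sa
  obtain ⟨θ, hθ, mθ⟩ := D.exists_move hc hd rcd (far T3 hc) sc
  -- The coefficients are sums of two signs, which brings them into the range of the finite check.
  have hA : αc + η * βd ∈ ({-2, 0, 2} : Finset ℤ) := by
    rcases hαc.1 with rfl | rfl <;> rcases hβd.1 with rfl | rfl <;> rcases hη with rfl | rfl <;> decide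
  have hB : γa + θ * δb ∈ ({-2, 0, 2} : Finset ℤ) := by
    rcases hγa.1 with rfl | rfl <;> rcases hδb.1 with rfl | rfl <;> rcases hθ with rfl | rfl <;> decide
  have hA' : αd + η * βc ∈ ({-2, 0, 2} : Finset ℤ) := by
    rcases hαd.1 with rfl | rfl <;> rcases hβc.1 with rfl | rfl <;> rcases hη with rfl | rfl <;> decide
  have hB' : γb + θ * δa ∈ ({-2, 0, 2} : Finset ℤ) := by
    rcases hγb.1 with rfl | rfl <;> rcases hδa.1 with rfl | rfl <;> rcases hθ with rfl | rfl <;> decide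
  obtain ⟨s, hs, t, ht, l2, l3, hn⟩ := exists_direction _ hA _ hB _ hA' _ hB'
  apply hn
  have hs' : -1 ≤ s ∧ s ≤ 1 := by
    simp only [Finset.mem_insert, Finset.mem_singleton] at hs; omega
  have ht' : -1 ≤ t ∧ t ≤ 1 := by
    simp only [Finset.mem_insert, Finset.mem_singleton] at ht; omega
  have hs2 : -1 ≤ η * s ∧ η * s ≤ 1 := by rcases hη with rfl | rfl <;> omega
  have ht2 : -1 ≤ θ * t ∧ θ * t ≤ 1 := by rcases hθ with rfl | rfl <;> omega
  have e1 := mη s hs'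
  have e2 := mθ t ht'
  have u1 := D.dist_nb_nb_le ha hc rac (T1.two_le D hF hno hδ) hαc hγa hs' ht'
  have u2 := D.dist_nb_nb_le hb hd (rab.symm.trans rad) (T6.two_le D hF hno hδ) hβd hδb hs2 ht2
  have u3 := D.dist_nb_nb_le ha hd rad (T5.two_le D hF hno hδ) hαd hδa hs' ht2
  have u4 := D.dist_nb_nb_le hb hc (rab.symm.trans rac) (T2.two_le D hF hno hδ) hβc hγb hs2 ht'
  have ra := D.reachable_nb ha hs'
  have hconn : Conn G (Dec.nb w home pos a s, Dec.nb w home pos b (η * s), Dec.nb w home pos c t,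
      Dec.nb w home pos d (θ * t)) :=
    ⟨ra.symm.trans (rab.trans (D.reachable_nb hb hs2)),
      ra.symm.trans (rac.trans (D.reachable_nb hc ht')),
      ra.symm.trans (rad.trans (D.reachable_nb hd ht2))⟩
  have k2 : s * (αc + η * βd) + t * (γa + θ * δb) =
    s * αc + t * γa + η * s * βd + θ * t * δb := by ring
  have k3 : s * (αd + η * βc) + t * (γb + θ * δa) =
    s * αd + θ * t * δa + η * s * βc + t * γb := by ring
  rw [k2] at l2 ⊢
  rw [k3] at l3 ⊢
  -- `D₁` does not drop by `e1` and `e2`, and `D₂` and `D₃` do not rise by `u1`, `u2`, `u3` and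
  -- `u4`. So the moved quadruple is maximal in the first two keys as well.
  obtain ⟨m1, m2⟩ := hmax _ hconn
  have f1 : excess G (Dec.nb w home pos a s, Dec.nb w home pos b (η * s), Dec.nb w home pos c t,
      Dec.nb w home pos d (θ * t)) = excess G (a, b, c, d) := by
    refine le_antisymm m1 ?_
    simp only [excess]
    omega
  obtain ⟨m2, m3⟩ := m2 f1
  have f2 : firstSum G (Dec.nb w home pos a s, Dec.nb w home pos b (η * s), Dec.nb w home pos c t,
      Dec.nb w home pos d (θ * t)) = firstSum G (a, b, c, d) := by
    refine le_antisymm m2 ?_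
    simp only [firstSum]
    omega
  obtain ⟨m3, m4⟩ := m3 f2
  -- Being `Top` again, the moved quadruple again consists of inner vertices, so the positions of
  -- `a` and `c` changed by exactly `s` and `t`.
  have T := T1.congr hconn f1 f2
  have p1 := D.pos_nb ha hs' (T.slope D hF hno hδ).1
  have p2 := D.pos_nb hc ht' (T.rot.slope D hF hno hδ).1
  simp only at m3 m4
  rw [p1, p2] at m4
  push_cast at m3
  refine ⟨by omega, by omega, ?_⟩
  have := m4 (by push_cast; omega)
  omega

end

end Candidates

end HypRAM
namespace HypRAM

/-! ### Ten candidates per piece, and distances through special vertices -/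

section Positions

variable {V : Type*} {G : SimpleGraph V} {P : ℕ} {len : ℕ → ℕ} {w : ℕ → ℕ → V} {home pos : V → ℕ}

/-- Candidates for critical positions on a chain of length `L` whose ends have the distances `α`
and `β` from a vertex at position `i`. -/
def candPos (α β L i : ℕ) : ℕ → ℕ
  | 0 => 0
  | 1 => i
  | 2 => i + 1
  | 3 => i - 1
  | 4 => (β + L - α) / 2
  | 5 => (β + L - α) / 2 + 1
  | 6 => (β + L + i) / 2
  | 7 => (β + L + i) / 2 + 1
  | 8 => (i - α) / 2
  | _ => (i - α) / 2 + 1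

/-- The candidates for vertices that are critical with respect to `x`. -/
def Cand (P : ℕ) (len : ℕ → ℕ) (w : ℕ → ℕ → V) (pos : V → ℕ) (dh : V → V → ℕ) (x y : V) : Prop :=
  ∃ g < P, ∃ r < 10, y = w g (min (len g) (candPos (dh x (w g 0)) (dh x (w g (len g))) (len g)
    (pos x) r))

/-- The minimum of the rising line `p + k` and the falling line `q - k` has a slope unless `k` is
within 1/2 of their crossing. Half of `q - p`, rounded down, and its successor cover these
positions. -/
theorem Dec.mid_of_not_slope (D : Dec G P len w home pos) {x y : V} (hy : len (home y) ≠ 0)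
    (hs : ¬ ∃ ρ, Slope G w home pos x y ρ) {p q : ℤ}
    (h : ∀ k : ℕ, pos y - 1 ≤ k → k ≤ pos y + 1 →
      (G.dist x (w (home y) k) : ℤ) = min (p + k) (q - k)) :
    -1 ≤ 2 * pos y + p - q ∧ 2 * pos y + p - q ≤ 1 := by
  have hp := D.pos_mem hy
  have h0 := h (pos y) (by omega) (by omega)
  have h1 := h (pos y + 1) (by omega) (by omega)
  have h2 := h (pos y - 1) (by omega) (by omega)
  rw [D.w_pos] at h0
  by_contra hcon
  rw [not_and_or] at hcon
  refine hs ?_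
  rcases hcon with h' | h'
  · exact ⟨1, D.slope_of (.inl rfl) (by rw [Dec.nb_one]; omega) (by rw [Dec.nb_neg_one]; omega)⟩
  · exact ⟨-1, D.slope_of (.inr rfl) (by rw [Dec.nb_one]; omega) (by rw [Dec.nb_neg_one]; omega)⟩

/-- Candidate 0 serves special vertices, 1 serves `x` itself, and 2 and 3 its neighbours. The others
are crossings: 4 and 5 of the lines from both ends of a chain without `x`; 6 and 7 of the lines from
`x` and the last end; 8 and 9 of those from the first end and `x`. In the relevant cases the
triangle inequality makes the truncated subtractions exact. -/
theorem Dec.crit_cand (D : Dec G P len w home pos) {dh : V → V → ℕ}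
    (hdh : ∀ x y, G.Reachable x y → dh x y = G.dist x y) :
    Crit G len w home pos (Cand P len w pos dh) where
  special x y hy := ⟨home y, D.home_lt y, 0, by omega, by simp [candPos, D.w_zero hy]⟩
  near x y hx hy hd := by
    have hp := D.pos_mem hx
    rcases (D.adj_iff_nb hx y).1 (SimpleGraph.dist_eq_one_iff_adj.1 hd) with h | h
    · rw [Dec.nb_neg_one] at h
      refine ⟨home x, D.home_lt x, 3, by omega, ?_⟩
      rw [h, candPos, min_eq_right (by omega)]
    · rw [Dec.nb_one] at h
      refine ⟨home x, D.home_lt x, 2, by omega, ?_⟩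
      rw [h, candPos, min_eq_right (by omega)]
  slope x y hy hr hs := by
    have hp := D.pos_mem hy
    have hlt := D.home_lt y
    have rr : ∀ j ≤ len (home y), G.Reachable x (w (home y) j) := fun j hj =>
      hr.trans (by
        have := D.reachable_w hlt (i := pos y) (j := j) (by omega) hj
        rwa [D.w_pos] at this)
    have key : ∀ r < 10, candPos (G.dist x (w (home y) 0)) (G.dist x (w (home y) (len (home y))))
        (len (home y)) (pos x) r = pos y → Cand P len w pos dh x y := by
      intro r hr10 h
      refine ⟨home y, hlt, r, hr10, ?_⟩
      rw [hdh _ _ (rr 0 (by omega)), hdh _ _ (rr _ le_rfl), h, min_eq_right hp.2.le, D.w_pos]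
    by_cases hh : home x = home y
    · have hpx := D.pos_mem (v := x) (by rw [hh]; exact hy)
      rw [hh] at hpx
      have hx : w (home y) (pos x) = x := by rw [← hh, D.w_pos]
      have hne : ∀ j, 0 < j → j < len (home y) → j ≠ pos x → x ≠ w (home y) j := by
        intro j h1 h2 h3 h
        have := (D.inner _ hlt j h1 h2).2.1
        rw [← h] at this; omega
      rcases lt_trichotomy (pos x) (pos y) with h | h | h
      · have hm := D.mid_of_not_slope hy hs (p := -pos x)
          (q := G.dist x (w (home y) (len (home y))) + len (home y)) (by
          intro k h1 h2
          have := D.dist_sub hlt (l := pos x) (r := len (home y)) (j := k) le_rfl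
            (rr _ (by omega)) (fun j h1 h2 => hne j (by omega) h2 (by omega)) (by omega) (by omega)
          rw [hx, SimpleGraph.dist_self] at this
          omega)
        rcases (by omega : (G.dist x (w (home y) (len (home y))) + len (home y) + pos x) / 2 = pos y ∨
          (G.dist x (w (home y) (len (home y))) + len (home y) + pos x) / 2 + 1 = pos y) with h' | h'
        exacts [key 6 (by omega) h', key 7 (by omega) h']
      · exact key 1 (by omega) h
      · have hm := D.mid_of_not_slope hy hs (p := G.dist x (w (home y) 0)) (q := pos x) (by
          intro k h1 h2
          have := D.dist_sub hlt (l := 0) (r := pos x) (j := k) (by omega)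
            (rr _ (by omega)) (fun j h1 h2 => hne j (by omega) (by omega) (by omega)) (by omega)
            (by omega)
          rw [hx, SimpleGraph.dist_self] at this
          omega)
        have h0 := D.dist_sub hlt (l := 0) (r := pos x) (x := w (home y) 0) (j := pos x) (by omega)
          (.refl _) (fun j h1 h2 => D.ne_first hlt hy (by omega) (by omega) (D.first _ hlt))
          (by omega) le_rfl
        rw [hx, SimpleGraph.dist_self, G.dist_comm] at h0
        rcases (by omega : (pos x - G.dist x (w (home y) 0)) / 2 = pos y ∨
          (pos x - G.dist x (w (home y) 0)) / 2 + 1 = pos y) with h' | h'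
        exacts [key 8 (by omega) h', key 9 (by omega) h']
    · have h0 := fun j (hj : j ≤ len (home y)) =>
        D.dist_chain hlt (j := j) (rr 0 (by omega)) (.inr hh) hj
      have hm := D.mid_of_not_slope hy hs (p := G.dist x (w (home y) 0))
        (q := G.dist x (w (home y) (len (home y))) + len (home y)) (by
        intro k h1 h2
        have := h0 k (by omega)
        omega)
      have h1 := h0 0 (by omega)
      rcases (by omega : (G.dist x (w (home y) (len (home y))) + len (home y) -
          G.dist x (w (home y) 0)) / 2 = pos y ∨ (G.dist x (w (home y) (len (home y))) +
          len (home y) - G.dist x (w (home y) 0)) / 2 + 1 = pos y) with h' | h'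
      exacts [key 4 (by omega) h', key 5 (by omega) h']

/-! ### Distances from the distances between special vertices -/

/-- `M` represents the distances between special vertices, with values from `n` on for pairs in
different components. -/
structure IsMat (G : SimpleGraph V) (n : ℕ) (len : ℕ → ℕ) (home : V → ℕ) (M : ℕ → ℕ → ℕ) : Prop where
  eq : ∀ x y, len (home x) = 0 → len (home y) = 0 → G.Reachable x y → M (home x) (home y) = G.dist x y
  le : ∀ x y, len (home x) = 0 → len (home y) = 0 → ¬ G.Reachable x y → n ≤ M (home x) (home y)

/-- The distance of `x` and `y`, computed from the distances of special vertices. -/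
def dhat (n : ℕ) (len : ℕ → ℕ) (w : ℕ → ℕ → V) (home pos : V → ℕ) (M : ℕ → ℕ → ℕ) (x y : V) : ℕ :=
  let e := home x
  let f := home y
  let p := home (w e 0)
  let q := home (w e (len e))
  let r := home (w f 0)
  let s := home (w f (len f))
  min (min (min (pos x + (M p r + pos y)) (pos x + (M p s + (len f - pos y))))
    (min ((len e - pos x) + (M q r + pos y)) ((len e - pos x) + (M q s + (len f - pos y)))))
    ((pos x - pos y) + (pos y - pos x) + n * ((e - f) + (f - e)))

theorem Dec.pos_le (D : Dec G P len w home pos) (v : V) : pos v ≤ len (home v) := by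
  rcases D.pos_cases v with h | h <;> omega

theorem Dec.reachable_of_pos (D : Dec G P len w home pos) (v : V) {j : ℕ} (hj : j ≤ len (home v)) :
    G.Reachable v (w (home v) j) := by
  have := D.reachable_w (D.home_lt v) (D.pos_le v) hj
  rwa [D.w_pos] at this

/-- A shortest path runs through an end of each of the two pieces or stays inside a common one. The
last alternative in `dhat` is the direct way; for different pieces the multiple of `n` in it exceeds
every distance and disables it. -/
theorem Dec.dhat_eq (D : Dec G P len w home pos) {n : ℕ} (hn : ∀ x y, G.dist x y < n)
    {M : ℕ → ℕ → ℕ} (hM : IsMat G n len home M) {x y : V} (h : G.Reachable x y) :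
    dhat n len w home pos M x y = G.dist x y := by
  have hx := D.home_lt x
  have hy := D.home_lt y
  have rx0 := D.reachable_of_pos x (Nat.zero_le _)
  have rxl := D.reachable_of_pos x le_rfl
  have ry0 := D.reachable_of_pos y (Nat.zero_le _)
  have ryl := D.reachable_of_pos y le_rfl
  have px := D.pos_le x
  have py := D.pos_le y
  have e1 := hM.eq _ _ (D.first _ hx) (D.first _ hy) (rx0.symm.trans (h.trans ry0))
  have e2 := hM.eq _ _ (D.first _ hx) (D.last _ hy) (rx0.symm.trans (h.trans ryl))
  have e3 := hM.eq _ _ (D.last _ hx) (D.first _ hy) (rxl.symm.trans (h.trans ry0))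
  have e4 := hM.eq _ _ (D.last _ hx) (D.last _ hy) (rxl.symm.trans (h.trans ryl))
  simp only [dhat, e1, e2, e3, e4]
  -- distances from the ends of the piece of `x` to `y`
  have f1 := D.dist_chain hy (j := pos y) (rx0.symm.trans (h.trans ry0))
    (ne_special (D.first _ hx)) py
  have f2 := D.dist_chain hy (j := pos y) (rxl.symm.trans (h.trans ry0))
    (ne_special (D.last _ hx)) py
  rw [D.w_pos] at f1 f2
  by_cases hh : home x = home y
  · rw [hh, show home y - home y + (home y - home y) = 0 by omega, mul_zero, add_zero]
    rw [hh] at f1 f2 px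
    have wx : w (home y) (pos x) = x := by rw [← hh, D.w_pos]
    have g1 := D.dist_chain hy (j := pos y) (x := w (home y) 0) (.refl _)
      (ne_special (D.first _ hy)) py
    have s1 := D.dist_same hy (i := 0) (j := len (home y)) (by omega) le_rfl
    rw [SimpleGraph.dist_self, SimpleGraph.dist_self]
    rw [G.dist_comm (u := w (home y) (len (home y)))]
    rcases le_total (pos x) (pos y) with h' | h'
    · have := D.dist_same hy h' py
      rw [wx, D.w_pos] at this
      rw [this]
      omega
    · have := D.dist_same hy h' px
      rw [wx, D.w_pos, G.dist_comm] at this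
      rw [this]
      omega
  · have f3 := D.dist_chain hx (x := y) (j := pos x) (h.symm.trans rx0) (.inr (Ne.symm hh)) px
    rw [D.w_pos, G.dist_comm (u := y) (v := x), G.dist_comm (u := y) (v := w (home x) 0),
      G.dist_comm (u := y) (v := w (home x) (len (home x)))] at f3
    have h1 : 1 ≤ home x - home y + (home y - home x) := by omega
    have h2 : n * 1 ≤ n * (home x - home y + (home y - home x)) := Nat.mul_le_mul_left n h1
    have hlt := hn x y
    rw [min_eq_left]
    · rw [min_add_add_left, min_add_add_left, ← f1, ← f2, f3, add_comm, add_comm (len _ - _)]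
    · rw [min_add_add_left, min_add_add_left, ← f1, ← f2]
      clear f1 f2 e1 e2 e3 e4
      omega

/-- All four matrix entries are at least `n`, and the direct way is disabled because the pieces
differ. -/
theorem Dec.le_dhat (D : Dec G P len w home pos) {n : ℕ}
    {M : ℕ → ℕ → ℕ} (hM : IsMat G n len home M) {x y : V} (h : ¬ G.Reachable x y) :
    n ≤ dhat n len w home pos M x y := by
  have hx := D.home_lt x
  have hy := D.home_lt y
  have rx0 := D.reachable_of_pos x (Nat.zero_le _)
  have rxl := D.reachable_of_pos x le_rfl
  have ry0 := D.reachable_of_pos y (Nat.zero_le _)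
  have ryl := D.reachable_of_pos y le_rfl
  have e1 := hM.le _ _ (D.first _ hx) (D.first _ hy) fun h' => h (rx0.trans (h'.trans ry0.symm))
  have e2 := hM.le _ _ (D.first _ hx) (D.last _ hy) fun h' => h (rx0.trans (h'.trans ryl.symm))
  have e3 := hM.le _ _ (D.last _ hx) (D.first _ hy) fun h' => h (rxl.trans (h'.trans ry0.symm))
  have e4 := hM.le _ _ (D.last _ hx) (D.last _ hy) fun h' => h (rxl.trans (h'.trans ryl.symm))
  have hh : home x ≠ home y := fun hh => h (rx0.trans (by rw [hh]; exact ry0.symm))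
  have h1 : 1 ≤ home x - home y + (home y - home x) := by omega
  have h2 : n * 1 ≤ n * (home x - home y + (home y - home x)) := Nat.mul_le_mul_left n h1
  simp only [dhat]
  omega

end Positions

end HypRAM
namespace HypRAM

/-! ### The number of pieces and the cover number -/

section Counting

variable {V : Type*} [Fintype V] {G : SimpleGraph V} [DecidableRel G.Adj] {P : ℕ} {len : ℕ → ℕ}
  {w : ℕ → ℕ → V} {home pos : V → ℕ}

/-- Special vertices of degree two occur only in components all of whose vertices are like that. -/
def TightSpecials (G : SimpleGraph V) [DecidableRel G.Adj] (len : ℕ → ℕ) (home : V → ℕ) : Prop :=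
  ∀ v, len (home v) = 0 → G.degree v = 2 → ∀ y, G.Adj v y → G.degree y = 2 ∧ len (home y) = 0

/-- Tightness prevents `y` from being special, since its neighbour `x` is not. So `y` is not an end
of the chain of `x` and remains inside it. -/
theorem Dec.home_eq_of_adj (D : Dec G P len w home pos) (hN : TightSpecials G len home) {x y : V}
    (hx : len (home x) ≠ 0) (hxy : G.Adj x y) (hy : G.degree y = 2) :
    len (home y) ≠ 0 ∧ home y = home x := by
  have hy' : len (home y) ≠ 0 := fun h => hx (hN y h hy x hxy.symm).2
  refine ⟨hy', ?_⟩
  have hp := D.pos_mem hx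
  have hlt := D.home_lt x
  rcases (D.adj_iff_nb hx y).1 hxy with h | h
  · rw [Dec.nb_neg_one] at h
    have : pos x - 1 ≠ 0 := fun h0 => hy' (by rw [h, h0]; exact D.first _ hlt)
    rw [h]; exact (D.inner _ hlt _ (by omega) (by omega)).1
  · rw [Dec.nb_one] at h
    have : pos x + 1 ≠ len (home x) := fun h0 => hy' (by rw [h, h0]; exact D.last _ hlt)
    rw [h]; exact (D.inner _ hlt _ (by omega) (by omega)).1

theorem Dec.home_eq_of_walk (D : Dec G P len w home pos) (hN : TightSpecials G len home) {x v : V}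
    (q : G.Walk x v) : q.IsPath → len (home x) ≠ 0 →
      (∀ y ∈ q.support, y ≠ v → G.degree y = 2) → ∀ y ∈ q.support, y ≠ v → home y = home x := by
  induction q with
  | nil =>
    intro _ _ _ y hy hyv
    rw [SimpleGraph.Walk.support_nil, List.mem_singleton] at hy
    exact absurd hy hyv
  | @cons x x' v h q ih =>
    intro hq hx hdeg y hy hyv
    rw [SimpleGraph.Walk.support_cons, List.mem_cons] at hy
    rcases hy with rfl | hy
    · rfl
    have hq' := ((SimpleGraph.Walk.cons_isPath_iff _ _).1 hq).1
    by_cases hxv : x' = v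
    · subst hxv
      obtain rfl := (SimpleGraph.Walk.isPath_iff_nil.1 hq').eq_nil
      simp only [SimpleGraph.Walk.support_nil, List.mem_singleton] at hy
      exact absurd hy hyv
    · obtain ⟨h1, h2⟩ := D.home_eq_of_adj hN hx h
        (hdeg x' (by simp) hxv)
      rw [← h2]
      exact ih hq' h1 (fun z hz => hdeg z (by simp [hz])) y hy hyv

/-- The vertex after `u`, if it is an inner vertex of the path, has degree two and a neighbour of
degree at least three, so by tightness it is not special. From there the path cannot leave its chain
before `v`. -/
theorem Dec.home_eq_of_branch (D : Dec G P len w home pos) (hN : TightSpecials G len home) {u v : V}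
    {p : G.Walk u v} (hp : p.IsPath) (hu : 3 ≤ G.degree u)
    (hin : ∀ x ∈ p.support, x ≠ u → x ≠ v → G.degree x = 2) :
    ∃ e, ∀ x ∈ p.support, x ≠ u → x ≠ v → home x = e := by
  cases p with
  | nil => exact ⟨0, fun x hx h => absurd (by simpa using hx) h⟩
  | @cons _ x _ h q =>
    refine ⟨home x, fun y hy hyu hyv => ?_⟩
    obtain ⟨hq, hnot⟩ := (SimpleGraph.Walk.cons_isPath_iff _ _).1 hp
    have hy' : y ∈ q.support := by simpa [hyu] using hy
    by_cases hxv : x = v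
    · subst hxv
      obtain rfl := (SimpleGraph.Walk.isPath_iff_nil.1 hq).eq_nil
      simp only [SimpleGraph.Walk.support_nil, List.mem_singleton] at hy'
      exact absurd hy' hyv
    · have hx2 : G.degree x = 2 := hin x (by simp) h.ne' hxv
      have hx : len (home x) ≠ 0 := fun h0 => by
        have := (hN x h0 hx2 u h.symm).1
        omega
      refine D.home_eq_of_walk hN q hq hx (fun z hz hzv => hin z (by simp [hz]) ?_ hzv) y hy' hyv
      rintro rfl
      exact hnot hz

theorem Dec.home_eq_of_segment (D : Dec G P len w home pos) (hN : TightSpecials G len home) {u v : V}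
    {p : G.Walk u v} (hp : IsSegment G p) :
    ∃ e, ∀ x ∈ p.support, x ≠ u → x ≠ v → home x = e := by
  by_cases hu : 3 ≤ G.degree u
  · exact D.home_eq_of_branch hN hp.isPath hu hp.inner
  · have hv : 3 ≤ G.degree v := by rcases hp.ends with h | h | h <;> omega
    obtain ⟨e, he⟩ := D.home_eq_of_branch hN (p := p.reverse) hp.isPath.reverse hv
      (fun x hx h1 h2 => hp.inner x (by simpa using hx) h2 h1)
    exact ⟨e, fun x hx h1 h2 => he x (by simpa using hx) h2 h1⟩

/-- The number of pieces is at most three times the number of paths in a cover. -/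
theorem Dec.pieces_le (D : Dec G P len w home pos) (hN : TightSpecials G len home) {k : ℕ}
    (hk : coverNumber G = (k : ℕ∞)) : P ≤ 3 * k := by
  classical
  have hlt : coverNumber G < ((k + 1 : ℕ) : ℕ∞) := by
    rw [hk]; exact_mod_cast Nat.lt_succ_self k
  simp only [coverNumber, iInf_lt_iff] at hlt
  obtain ⟨S, ⟨hS1, hS2⟩, hcard⟩ := hlt
  have hcard : S.card ≤ k := by
    have : S.card < k + 1 := by exact_mod_cast hcard
    omega
  choose f hf using fun e : Fin P => D.surj e e.2
  choose Q hQ hQm using fun e : Fin P => hS2 (f e)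
  -- A representative of each piece is either the first endpoint, the last endpoint or an inner
  -- vertex of its path. In the last case the path alone determines the piece, so path and tag
  -- determine it in all cases.
  let tag : Fin P → Fin 3 := fun e => if f e = (Q e).1 then 0 else if f e = (Q e).2.1 then 1 else 2
  have hinj : Function.Injective fun e : Fin P => ((⟨Q e, hQ e⟩ : S), tag e) := by
    intro e e' h
    simp only [Prod.mk.injEq, Subtype.mk.injEq] at h
    obtain ⟨hQe, ht⟩ := h
    have hhome : home (f e) = home (f e') := by
      obtain ⟨c, hc⟩ := D.home_eq_of_segment hN (hS1 _ (hQ e)).isSegment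
      have m2 := hQm e'
      simp only [tag] at ht
      rw [← hQe] at m2 ht
      by_cases h1 : f e = (Q e).1
      · by_cases h1' : f e' = (Q e).1
        · rw [h1, h1']
        · exfalso
          rw [if_pos h1, if_neg h1'] at ht
          split_ifs at ht <;> exact absurd ht (by decide)
      · by_cases h1' : f e' = (Q e).1
        · exfalso
          rw [if_neg h1, if_pos h1'] at ht
          split_ifs at ht <;> exact absurd ht (by decide)
        · rw [if_neg h1, if_neg h1'] at ht
          by_cases h2 : f e = (Q e).2.1
          · by_cases h2' : f e' = (Q e).2.1
            · rw [h2, h2']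
            · rw [if_pos h2, if_neg h2'] at ht
              exact absurd ht (by decide)
          · by_cases h2' : f e' = (Q e).2.1
            · rw [if_neg h2, if_pos h2'] at ht
              exact absurd ht (by decide)
            · rw [hc _ (hQm e) h1 h2, hc _ m2 h1' h2']
    rw [hf, hf] at hhome
    exact Fin.ext hhome
  have := Fintype.card_le_of_injective _ hinj
  rw [Fintype.card_prod, Fintype.card_coe, Fintype.card_fin, Fintype.card_fin] at this
  omega

end Counting

end HypRAM
namespace HypRAM

/-! ### Partial decompositions -/

/-- A partial decomposition into `P` pieces of a graph with vertices `0, …, n - 1` and adjacency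
relation `A`. The vertices of the pieces are listed in `W` below `top`, piece `e` from `st e` on;
`hm v` is the successor of the piece of `v`, or `0` if `v` lies in no piece yet. -/
structure Part (n : ℕ) (A : ℕ → ℕ → Prop) (P top : ℕ) (hm ps st ln W : ℕ → ℕ) : Prop where
  hm_le : ∀ v < n, hm v ≤ P
  w_ps : ∀ v < n, hm v ≠ 0 → W (st (hm v - 1) + ps v) = v
  ps_cases : ∀ v < n, hm v ≠ 0 →
    (ps v = 0 ∧ ln (hm v - 1) = 0) ∨ (0 < ps v ∧ ps v < ln (hm v - 1))
  st_top : ∀ e < P, st e + ln e < top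
  w_lt : ∀ e < P, ∀ j ≤ ln e, W (st e + j) < n ∧ hm (W (st e + j)) ≠ 0
  first : ∀ e < P, ln (hm (W (st e)) - 1) = 0
  last : ∀ e < P, ln (hm (W (st e + ln e)) - 1) = 0
  inner : ∀ e < P, ∀ j, 0 < j → j < ln e → hm (W (st e + j)) = e + 1 ∧ ps (W (st e + j)) = j ∧
    ∀ y < n, A (W (st e + j)) y ↔ y = W (st e + (j - 1)) ∨ y = W (st e + (j + 1))
  surj : ∀ e < P, ∃ v < n, hm v = e + 1
  top_le : top ≤ P * (n + 1)
  ln_le : ∀ e < P, ln e ≤ n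

/-- A chain that is being followed from the special vertex `v`; the vertices `W (top + j)` with
`0 < j < L` have been marked. -/
structure Follow (n : ℕ) (A : ℕ → ℕ → Prop) (P top : ℕ) (hm₀ ps₀ W₀ : ℕ → ℕ) (v L : ℕ)
    (hm ps W : ℕ → ℕ) : Prop where
  old_hm : ∀ y, hm₀ y ≠ 0 → hm y = hm₀ y ∧ ps y = ps₀ y
  old_W : ∀ i < top, W i = W₀ i
  one_le : 1 ≤ L
  start : W top = v
  first_new : hm₀ (W (top + 1)) = 0
  new : ∀ y, hm₀ y = 0 → hm y ≠ 0 → hm y = P + 1 ∧ 0 < ps y ∧ ps y < L ∧ W (top + ps y) = y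
  inner : ∀ j, 0 < j → j < L → W (top + j) < n ∧ hm₀ (W (top + j)) = 0 ∧
    hm (W (top + j)) = P + 1 ∧ ps (W (top + j)) = j ∧
    ∀ y < n, A (W (top + j)) y ↔ y = W (top + (j - 1)) ∨ y = W (top + (j + 1))
  cur_lt : W (top + L) < n
  cur_adj : A (W (top + L)) (W (top + (L - 1)))
  cur_ne : 2 ≤ L → W (top + L) ≠ W (top + (L - 2))

section

variable {n : ℕ} {A : ℕ → ℕ → Prop} {P top : ℕ} {hm ps st ln W : ℕ → ℕ}

theorem Part.empty : Part n A 0 0 (fun _ => 0) ps st ln W := by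
  constructor <;> simp

theorem Part.pieces_le (h : Part n A P top hm ps st ln W) : P ≤ n := by
  choose f hf hf' using fun e : Fin P => h.surj e e.2
  have := Fintype.card_le_of_injective (fun e : Fin P => (⟨f e, hf e⟩ : Fin n)) (by
    intro e e' h'
    have h' : f e = f e' := by simpa using h'
    have h1 := hf' e
    rw [h', hf' e'] at h1
    exact Fin.ext (by omega))
  simpa using this

/-- The new entries lie beyond all old pieces, and an unmarked vertex occurs in none of them. -/
theorem Part.single (h : Part n A P top hm ps st ln W) {v : ℕ} (hv : v < n) (h0 : hm v = 0) :
    Part n A (P + 1) (top + 1) (Function.update hm v (P + 1)) (Function.update ps v 0)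
      (Function.update st P top) (Function.update ln P 0) (Function.update W top v) := by
  have hP : ∀ y < n, y ≠ v → hm y ≠ 0 → hm y - 1 ≠ P ∧ hm y - 1 < P := fun y hy _ h0 => by
    have := h.hm_le y hy
    omega
  have hW : ∀ e < P, ∀ j ≤ ln e, st e + j ≠ top := fun e he j hj => by
    have := h.st_top e he; omega
  have hne : ∀ e < P, ∀ j ≤ ln e, W (st e + j) ≠ v := fun e he j hj h' => by
    have := (h.w_lt e he j hj).2
    rw [h'] at this; exact this h0
  have hW0 : ∀ e < P, st e ≠ top := fun e he => hW e he 0 (by omega)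
  have hne0 : ∀ e < P, W (st e) ≠ v := fun e he => hne e he 0 (by omega)
  have eW : ∀ e < P, ∀ j ≤ ln e, Function.update W top v (st e + j) = W (st e + j) :=
    fun e he j hj => Function.update_of_ne (hW e he j hj) _ _
  have old : ∀ e < P, Function.update st P top e = st e ∧ Function.update ln P 0 e = ln e :=
    fun e he => ⟨Function.update_of_ne (by omega) _ _, Function.update_of_ne (by omega) _ _⟩
  have cases : ∀ e < P + 1, e < P ∨ e = P := fun e he => by omega
  refine ⟨?_, ?_, ?_, ?_, ?_, ?_, ?_, ?_, ?_, ?_, ?_⟩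
  · intro y hy
    by_cases hyv : y = v
    · simp [hyv]
    · rw [Function.update_of_ne hyv]
      have := h.hm_le y hy; omega
  · intro y hy hm'
    by_cases hyv : y = v
    · simp [hyv]
    · rw [Function.update_of_ne hyv] at hm' ⊢
      obtain ⟨h1, h2⟩ := hP y hy hyv hm'
      rw [Function.update_of_ne hyv, (old _ h2).1, eW _ h2, h.w_ps y hy hm']
      rcases h.ps_cases y hy hm' with h | h <;> omega
  · intro y hy hm'
    by_cases hyv : y = v
    · simp [hyv]
    · rw [Function.update_of_ne hyv] at hm' ⊢
      obtain ⟨h1, h2⟩ := hP y hy hyv hm'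
      rw [Function.update_of_ne hyv, (old _ h2).2]
      exact h.ps_cases y hy hm'
  · intro e he
    rcases cases e he with he | rfl
    · rw [(old e he).1, (old e he).2]
      have := h.st_top e he; omega
    · simp
  · intro e he j hj
    rcases cases e he with he | rfl
    · rw [(old e he).2] at hj
      rw [(old e he).1, eW e he j hj, Function.update_of_ne (hne e he j hj)]
      exact h.w_lt e he j hj
    · obtain rfl : j = 0 := by simpa using hj
      simp [hv]
  · intro e he
    rcases cases e he with he | rfl
    · have e1 := eW e he 0 (by omega)
      rw [add_zero] at e1
      have h2 := h.w_lt e he 0 (by omega)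
      rw [add_zero] at h2
      rw [(old e he).1, e1, Function.update_of_ne (hne0 e he),
        (old _ (hP _ h2.1 (hne0 e he) h2.2).2).2]
      exact h.first e he
    · simp
  · intro e he
    rcases cases e he with he | rfl
    · have h2 := h.w_lt e he _ le_rfl
      rw [(old e he).1, (old e he).2, eW e he _ le_rfl, Function.update_of_ne (hne e he _ le_rfl),
        (old _ (hP _ h2.1 (hne e he _ le_rfl) h2.2).2).2]
      exact h.last e he
    · simp
  · intro e he j h0 hj
    rcases cases e he with he | rfl
    · rw [(old e he).2] at hj
      have hn := hne e he j hj.le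
      rw [(old e he).1, eW e he j hj.le, eW e he (j - 1) (by omega), eW e he (j + 1) hj,
        Function.update_of_ne hn, Function.update_of_ne hn]
      exact h.inner e he j h0 hj
    · simp at hj
  · intro e he
    rcases cases e he with he | rfl
    · obtain ⟨y, hy, hy'⟩ := h.surj e he
      refine ⟨y, hy, ?_⟩
      rw [Function.update_of_ne, hy']
      rintro rfl; omega
    · exact ⟨v, hv, by simp⟩
  · have := h.top_le
    rw [Nat.add_mul]; omega
  · intro e he
    rcases cases e he with he | rfl
    · rw [(old e he).2]; exact h.ln_le e he
    · simp

variable {hm' ps' W' : ℕ → ℕ} {v L : ℕ}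

theorem Follow.init {u : ℕ} (hu : u < n) (hu0 : hm u = 0) (hA : A u v) :
    Follow n A P top hm ps W v 1 hm ps (Function.update (Function.update W top v) (top + 1) u) := by
  refine ⟨fun y _ => ⟨rfl, rfl⟩, fun i hi => ?_, le_rfl, ?_, ?_, fun y h1 h2 => absurd h1 h2,
    fun j h1 h2 => by omega, ?_, ?_, fun h => by omega⟩
  · rw [Function.update_of_ne (by omega), Function.update_of_ne (by omega)]
  · rw [Function.update_of_ne (by omega), Function.update_self]
  · rw [Function.update_self]; exact hu0
  · rw [Function.update_self]; exact hu
  · rw [Function.update_self]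
    simpa using hA

/-- The vertices at positions below `L` are distinct: the first was marked before, the others were
not and carry their positions. So `n` rounds suffice to follow any chain. -/
theorem Follow.le (h : Follow n A P top hm ps W v L hm' ps' W') (hv : v < n) (hv0 : hm v ≠ 0) :
    L ≤ n := by
  have := Finset.card_le_card_of_injOn (s := Finset.range L) (t := Finset.range n)
    (fun j => W' (top + j)) (by
      intro j hj
      simp only [Finset.coe_range, Set.mem_Iio] at hj ⊢
      by_cases h0 : j = 0
      · rw [h0, add_zero, h.start]; exact hv
      · exact (h.inner j (by omega) hj).1) (by
      have key : ∀ i j, i < L → j < L → W' (top + i) = W' (top + j) → i ≤ j := by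
        intro i j hi hj hij
        by_contra! hlt
        have h1 := h.inner i (by omega) hi
        by_cases h0 : j = 0
        · rw [h0, add_zero, h.start] at hij
          rw [hij] at h1; exact hv0 h1.2.1
        · have h2 := h.inner j (by omega) hj
          rw [hij] at h1
          have e1 := h1.2.2.2.1
          have e2 := h2.2.2.2.1
          omega
      intro i hi j hj hij
      simp only [Finset.coe_range, Set.mem_Iio] at hi hj
      exact le_antisymm (key i j hi hj hij) (key j i hj hi hij.symm))
  simpa using this

/-- One of the two neighbours of the current vertex is its predecessor, so subtracting that from the
sum of both yields the other one. This rules out turning back. -/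
theorem Follow.step (h : Follow n A P top hm ps W v L hm' ps' W') (hsymm : ∀ x y, A x y → A y x)
    (hlt : ∀ x y, A x y → y < n) (h0 : hm' (W' (top + L)) = 0) {y₀ y₁ : ℕ} (hy : y₀ ≠ y₁)
    (hadj : ∀ y, A (W' (top + L)) y ↔ y = y₀ ∨ y = y₁) :
    y₀ + y₁ - W' (top + (L - 1)) < n ∧
    Follow n A P top hm ps W v (L + 1) (Function.update hm' (W' (top + L)) (P + 1))
      (Function.update ps' (W' (top + L)) L)
      (Function.update W' (top + (L + 1)) (y₀ + y₁ - W' (top + (L - 1)))) := by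
  have hL := h.one_le
  have hprev := (hadj _).1 h.cur_adj
  set c := W' (top + L) with hc
  set p := W' (top + (L - 1)) with hp
  obtain ⟨q, hq, hqp, hqadj⟩ : ∃ q, y₀ + y₁ - p = q ∧ q ≠ p ∧ ∀ y, A c y ↔ y = p ∨ y = q := by
    rcases hprev with h' | h'
    · exact ⟨y₁, by omega, by omega, by rw [h']; exact hadj⟩
    · exact ⟨y₀, by omega, by omega, by rw [h']; intro y; rw [hadj, or_comm]⟩
  rw [hq]
  have hqn : q < n := hlt c q ((hqadj q).2 (.inr rfl))
  have hm0 : hm c = 0 := by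
    by_contra h'
    rw [(h.old_hm c h').1] at h0
    exact h' h0
  have hcj : ∀ j, 0 < j → j < L → W' (top + j) ≠ c := by
    intro j h1 h2 h3
    have := (h.inner j h1 h2).2.2.1
    rw [h3] at this; omega
  have eW : ∀ j ≤ L, Function.update W' (top + (L + 1)) q (top + j) = W' (top + j) :=
    fun j hj => Function.update_of_ne (by omega) _ _
  refine ⟨hqn, ⟨?_, ?_, by omega, ?_, ?_, ?_, ?_, ?_, ?_, ?_⟩⟩
  · intro y hy
    have : y ≠ c := by rintro rfl; exact hy hm0
    rw [Function.update_of_ne this, Function.update_of_ne this]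
    exact h.old_hm y hy
  · intro i hi
    rw [Function.update_of_ne (by omega)]; exact h.old_W i hi
  · rw [Function.update_of_ne (by omega)]; exact h.start
  · rw [eW 1 hL]; exact h.first_new
  · intro y h1 h2
    by_cases hyc : y = c
    · rw [hyc, Function.update_self, Function.update_self, eW L le_rfl]
      exact ⟨rfl, by omega, by omega, rfl⟩
    · rw [Function.update_of_ne hyc] at h2 ⊢
      obtain ⟨e1, e2, e3, e4⟩ := h.new y h1 h2
      rw [Function.update_of_ne hyc, eW _ e3.le]
      exact ⟨e1, e2, by omega, e4⟩
  · intro j h1 h2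
    rw [eW j (by omega)]
    by_cases hj : j = L
    · subst hj
      rw [← hc, Function.update_self, Function.update_self, Function.update_self,
        eW (j - 1) (by omega)]
      exact ⟨h.cur_lt, hm0, rfl, rfl, fun y _ => hqadj y⟩
    · have hjL : j < L := by omega
      rw [Function.update_of_ne (hcj j h1 hjL), Function.update_of_ne (hcj j h1 hjL),
        eW (j - 1) (by omega), eW (j + 1) hjL]
      exact h.inner j h1 hjL
  · rw [Function.update_self]; exact hqn
  · rw [Function.update_self, show L + 1 - 1 = L by omega, eW L le_rfl]
    exact hsymm _ _ ((hqadj q).2 (.inr rfl))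
  · intro _
    rw [Function.update_self, show L + 1 - 2 = L - 1 by omega, eW (L - 1) (by omega)]
    exact hqp

/-- The predecessor of the current vertex was unmarked at the start. The inner vertices of older
chains have only marked neighbours, so the current vertex is not one of them. Nor is it an inner
vertex of the present chain, whose two neighbours are already in use: that would mean a return to
`v`, a loop or a step back. Only a special vertex remains, possibly `v` itself. -/
theorem Follow.special (h : Follow n A P top hm ps W v L hm' ps' W')
    (hpart : Part n A P top hm ps st ln W) (hirr : ∀ x, ¬ A x x)
    (hv0 : hm v ≠ 0) (hcur : hm' (W' (top + L)) ≠ 0) :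
    2 ≤ L ∧ hm (W' (top + L)) ≠ 0 ∧ ln (hm (W' (top + L)) - 1) = 0 := by
  have hL := h.one_le
  have hL2 : 2 ≤ L := by
    by_contra hlt
    obtain rfl : L = 1 := by omega
    have := (h.new _ h.first_new hcur).2
    omega
  obtain ⟨q1, q2, q3, q4, -⟩ := h.inner (L - 1) (by omega) (by omega)
  have hadj := h.cur_adj
  have hm0 : hm (W' (top + L)) ≠ 0 := by
    intro h0
    obtain ⟨e1, e2, e3, e4⟩ := h.new _ h0 hcur
    set j := ps' (W' (top + L)) with hj
    have hj1 := (h.inner j e2 e3).2.2.2.2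
    rw [e4] at hj1
    rcases (hj1 _ q1).1 hadj with h' | h'
    · by_cases h1 : j - 1 = 0
      · rw [h1, add_zero, h.start] at h'
        rw [h'] at q2; exact hv0 q2
      · have := (h.inner (j - 1) (by omega) (by omega)).2.2.2.1
        rw [← h'] at this; omega
    · by_cases h1 : j + 1 = L
      · rw [h', h1] at hadj; exact hirr _ hadj
      · have := (h.inner (j + 1) (by omega) (by omega)).2.2.2.1
        rw [← h'] at this
        have hjL : j = L - 2 := by omega
        rw [hjL] at e4
        exact h.cur_ne hL2 e4.symm
  refine ⟨hL2, hm0, ?_⟩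
  by_contra hln
  have hc := h.cur_lt
  have hle := hpart.hm_le _ hc
  rcases hpart.ps_cases _ hc hm0 with h' | ⟨h1, h2⟩
  · exact hln h'.2
  · have hw := hpart.w_ps _ hc hm0
    have hin := (hpart.inner (hm (W' (top + L)) - 1) (by omega) _ h1 h2).2.2
    rw [hw] at hin
    rcases (hin _ q1).1 hadj with h' | h'
    · have := (hpart.w_lt (hm (W' (top + L)) - 1) (by omega) _
        (by omega : ps (W' (top + L)) - 1 ≤ _)).2
      rw [← h'] at this; exact this q2
    · have := (hpart.w_lt (hm (W' (top + L)) - 1) (by omega) _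
        (by omega : ps (W' (top + L)) + 1 ≤ _)).2
      rw [← h'] at this; exact this q2

theorem Follow.part (h : Follow n A P top hm ps W v L hm' ps' W')
    (hpart : Part n A P top hm ps st ln W) (hirr : ∀ x, ¬ A x x)
    (hv : v < n) (hv0 : hm v ≠ 0) (hsp : ln (hm v - 1) = 0) (hcur : hm' (W' (top + L)) ≠ 0) :
    Part n A (P + 1) (top + (L + 1)) hm' ps' (Function.update st P top) (Function.update ln P L) W' := by
  obtain ⟨hL2, hc0, hcs⟩ := h.special hpart hirr hv0 hcur
  have hLn := h.le hv hv0
  have old : ∀ e < P, Function.update st P top e = st e ∧ Function.update ln P L e = ln e :=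
    fun e he => ⟨Function.update_of_ne (by omega) _ _, Function.update_of_ne (by omega) _ _⟩
  have cases : ∀ e < P + 1, e < P ∨ e = P := fun e he => by omega
  have eW : ∀ e < P, ∀ j ≤ ln e, W' (st e + j) = W (st e + j) := fun e he j hj => by
    have := hpart.st_top e he
    exact h.old_W _ (by omega)
  have hmlt : ∀ y < n, hm y ≠ 0 → hm y - 1 < P := fun y hy h0 => by
    have := hpart.hm_le y hy; omega
  have sp : ∀ y < n, hm y ≠ 0 → ln (hm y - 1) = 0 → Function.update ln P L (hm' y - 1) = 0 := by
    intro y hy h0 hl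
    rw [(h.old_hm y h0).1, (old _ (hmlt y hy h0)).2, hl]
  refine ⟨?_, ?_, ?_, ?_, ?_, ?_, ?_, ?_, ?_, ?_, ?_⟩
  · intro y hy
    by_cases h0 : hm y = 0
    · by_cases h1 : hm' y = 0
      · omega
      · exact (h.new y h0 h1).1.le
    · rw [(h.old_hm y h0).1]
      have := hpart.hm_le y hy; omega
  · intro y hy h1
    by_cases h0 : hm y = 0
    · obtain ⟨e1, e2, e3, e4⟩ := h.new y h0 h1
      rw [e1, Nat.add_sub_cancel, Function.update_self, e4]
    · rw [(h.old_hm y h0).1, (h.old_hm y h0).2, (old _ (hmlt y hy h0)).1, eW _ (hmlt y hy h0),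
        hpart.w_ps y hy h0]
      rcases hpart.ps_cases y hy h0 with h | h <;> omega
  · intro y hy h1
    by_cases h0 : hm y = 0
    · obtain ⟨e1, e2, e3, e4⟩ := h.new y h0 h1
      rw [e1, Nat.add_sub_cancel, Function.update_self]
      exact .inr ⟨e2, e3⟩
    · rw [(h.old_hm y h0).1, (h.old_hm y h0).2, (old _ (hmlt y hy h0)).2]
      exact hpart.ps_cases y hy h0
  · intro e he
    rcases cases e he with he | rfl
    · rw [(old e he).1, (old e he).2]
      have := hpart.st_top e he; omega
    · rw [Function.update_self, Function.update_self]; omega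
  · intro e he j hj
    rcases cases e he with he | rfl
    · rw [(old e he).2] at hj
      rw [(old e he).1, eW e he j hj]
      obtain ⟨h1, h2⟩ := hpart.w_lt e he j hj
      exact ⟨h1, by rw [(h.old_hm _ h2).1]; exact h2⟩
    · rw [Function.update_self] at hj ⊢
      by_cases h0 : j = 0
      · rw [h0, add_zero, h.start, (h.old_hm v hv0).1]
        exact ⟨hv, hv0⟩
      · by_cases h1 : j = L
        · rw [h1]; exact ⟨h.cur_lt, hcur⟩
        · obtain ⟨e1, e2, e3, -⟩ := h.inner j (by omega) (by omega)
          exact ⟨e1, by omega⟩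
  · intro e he
    rcases cases e he with he | rfl
    · have h1 := hpart.w_lt e he 0 (by omega)
      have e1 := eW e he 0 (by omega)
      rw [add_zero] at h1 e1
      rw [(old e he).1, e1]
      exact sp _ h1.1 h1.2 (hpart.first e he)
    · rw [Function.update_self, h.start]
      exact sp v hv hv0 hsp
  · intro e he
    rcases cases e he with he | rfl
    · have h1 := hpart.w_lt e he _ le_rfl
      rw [(old e he).1, (old e he).2, eW e he _ le_rfl]
      exact sp _ h1.1 h1.2 (hpart.last e he)
    · rw [Function.update_self, Function.update_self]
      exact sp _ h.cur_lt hc0 hcs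
  · intro e he j h0 hj
    rcases cases e he with he | rfl
    · rw [(old e he).2] at hj
      rw [(old e he).1, eW e he j hj.le, eW e he (j - 1) (by omega), eW e he (j + 1) hj]
      have h1 := (hpart.w_lt e he j hj.le).2
      rw [(h.old_hm _ h1).1, (h.old_hm _ h1).2]
      exact hpart.inner e he j h0 hj
    · rw [Function.update_self] at hj ⊢
      obtain ⟨e1, e2, e3, e4, e5⟩ := h.inner j h0 hj
      exact ⟨e3, e4, e5⟩
  · intro e he
    rcases cases e he with he | rfl
    · obtain ⟨y, hy, hy'⟩ := hpart.surj e he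
      refine ⟨y, hy, ?_⟩
      rw [(h.old_hm y (by omega)).1, hy']
    · obtain ⟨e1, e2, e3, -⟩ := h.inner 1 (by omega) (by omega)
      exact ⟨_, e1, e3⟩
  · have := hpart.top_le
    rw [Nat.add_mul]; omega
  · intro e he
    rcases cases e he with he | rfl
    · rw [(old e he).2]; exact hpart.ln_le e he
    · rw [Function.update_self]; exact hLn

end

/-- The adjacency relation of a graph on `Fin n`, on natural numbers. -/
def NAdj {n : ℕ} (G : SimpleGraph (Fin n)) (x y : ℕ) : Prop :=
  ∃ (hx : x < n) (hy : y < n), G.Adj ⟨x, hx⟩ ⟨y, hy⟩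

/-- All listed vertices are below `n`, so the reduction modulo `n` in `Fin.ofNat` does nothing. The
shift by one in `hm`, which reserved 0 for unmarked vertices, disappears. -/
theorem Part.dec {n : ℕ} [NeZero n] {G : SimpleGraph (Fin n)} {P top : ℕ} {hm ps st ln W : ℕ → ℕ}
    (h : Part n (NAdj G) P top hm ps st ln W) (hall : ∀ v < n, hm v ≠ 0) :
    Dec G P ln (fun e j => Fin.ofNat n (W (st e + j))) (fun v => hm v - 1) (fun v => ps v) := by
  have hlt : ∀ v : Fin n, hm v - 1 < P := fun v => by
    have := h.hm_le v v.2
    have := hall v v.2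
    omega
  have hval : ∀ e < P, ∀ j ≤ ln e, ((Fin.ofNat n (W (st e + j)) : Fin n) : ℕ) = W (st e + j) :=
    fun e he j hj => Nat.mod_eq_of_lt (h.w_lt e he j hj).1
  refine ⟨hlt, ?_, fun v => h.ps_cases v v.2 (hall v v.2), ?_, ?_, ?_, ?_⟩
  · intro v
    ext
    rw [hval _ (hlt v), h.w_ps v v.2 (hall v v.2)]
    rcases h.ps_cases v v.2 (hall v v.2) with h | h <;> omega
  · intro e he
    rw [hval e he 0 (by omega)]; exact h.first e he
  · intro e he
    rw [hval e he _ le_rfl]; exact h.last e he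
  · intro e he j h0 hj
    obtain ⟨h1, h2, h3⟩ := h.inner e he j h0 hj
    have hv := hval e he j hj.le
    refine ⟨by rw [hv]; omega, by rw [hv]; exact h2, fun y => ?_⟩
    have := h3 y y.2
    rw [Fin.ext_iff, Fin.ext_iff, hval e he (j - 1) (by omega), hval e he (j + 1) hj, ← this]
    constructor
    · intro ha
      refine ⟨(h.w_lt e he j hj.le).1, y.2, ?_⟩
      convert ha using 1
      exact Fin.ext hv.symm
    · rintro ⟨hx, hy, ha⟩
      convert ha using 1
      exact Fin.ext hv
  · intro e he
    obtain ⟨v, hv, hv'⟩ := h.surj e he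
    exact ⟨⟨v, hv⟩, by simp [hv']⟩

end HypRAM
namespace HypRAM

/-! ### Computing the decomposition -/

/-- Degree of vertex `v`, read off the input. -/
def dgA (a : ℕ → ℕ) (v : ℕ) : ℕ := a (v + 3) - a (v + 2)

/-- Neighbour number `i` of vertex `v`, read off the input. -/
def nbrA (a : ℕ → ℕ) (v i : ℕ) : ℕ := a (a (v + 2) + i)

/-- The array `a` holds the adjacency lists of `G`. -/
structure GrRep {n : ℕ} (G : SimpleGraph (Fin n)) [DecidableRel G.Adj] (a : ℕ → ℕ) : Prop where
  adj_iff : ∀ v < n, ∀ y, NAdj G v y ↔ ∃ i < dgA a v, nbrA a v i = y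
  ne : ∀ v < n, dgA a v = 2 → nbrA a v 0 ≠ nbrA a v 1
  degree : ∀ v : Fin n, dgA a v = G.degree v
  sum : ∑ v ∈ Finset.range n, dgA a v = 2 * G.edgeFinset.card

def dgE (e : Ex) : Ex := .rd 0 (e + 3) - .rd 0 (e + 2)
def nbrE (e i : Ex) : Ex := .rd 0 (.rd 0 (e + 2) + i)
def neE (e f : Ex) : Ex := (e - f) + (f - e)

@[simp] theorem eval_dgE (e : Ex) (σ : HS) : (dgE e).eval σ = dgA (σ.a 0) (e.eval σ) := rfl
@[simp] theorem eval_nbrE (e i : Ex) (σ : HS) :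
    (nbrE e i).eval σ = nbrA (σ.a 0) (e.eval σ) (i.eval σ) := rfl
@[simp] theorem eval_neE (e f : Ex) (σ : HS) :
    (neE e f).eval σ = (e.eval σ - f.eval σ) + (f.eval σ - e.eval σ) := rfl

open Ex (v rd)

/-- Make vertex `v 5` a piece of its own. -/
def mkSingle : Stmt :=
  .seq (.wr 1 (v 5) (v 3 + 1)) (.seq (.wr 2 (v 5) 0) (.seq (.wr 3 (v 3) (v 4))
    (.seq (.wr 4 (v 3) 0) (.seq (.wr 5 (v 4) (v 5)) (.seq (.asg 3 (v 3 + 1)) (.asg 4 (v 4 + 1)))))))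

/-- Extend the current chain by one vertex. -/
def stepChain : Stmt :=
  .seq (.asg 9 (rd 5 (v 4 + v 8))) (.seq (.wr 1 (v 9) (v 3 + 1)) (.seq (.wr 2 (v 9) (v 8))
    (.seq (.wr 5 (v 4 + (v 8 + 1)) (nbrE (v 9) 0 + nbrE (v 9) 1 - rd 5 (v 4 + (v 8 - 1))))
    (.asg 8 (v 8 + 1)))))

/-- Follow the chain that starts with vertex `v 5` and its neighbour number `v 6`. -/
def followChain : Stmt :=
  .seq (.wr 5 (v 4) (v 5)) (.seq (.wr 5 (v 4 + 1) (nbrE (v 5) (v 6))) (.seq (.asg 8 1)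
    (.seq (.rep 7 (v 1) (.ite (rd 1 (rd 5 (v 4 + v 8))) 1 stepChain .skip))
    (.seq (.wr 3 (v 3) (v 4)) (.seq (.wr 4 (v 3) (v 8)) (.seq (.asg 3 (v 3 + 1))
    (.asg 4 (v 4 + (v 8 + 1)))))))))

/-- Single pieces for the vertices of degree other than two. -/
def passOne : Stmt := .rep 5 (v 1) (.ite 0 (neE (dgE (v 5)) 2) mkSingle .skip)

/-- The chains. -/
def passTwo : Stmt := .rep 5 (v 1) (.ite 0 (neE (dgE (v 5)) 2)
  (.rep 6 (dgE (v 5)) (.ite (rd 1 (nbrE (v 5) (v 6))) 1 followChain .skip)) .skip)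

/-- Single pieces for the remaining vertices. -/
def passThree : Stmt := .rep 5 (v 1) (.ite (rd 1 (v 5)) 1 mkSingle .skip)

section

variable {n : ℕ} {G : SimpleGraph (Fin n)} {I : ℕ → ℕ} {E X : ℕ} {σ : HS}

/-- The partial decomposition in a state. -/
def PState (G : SimpleGraph (Fin n)) (σ : HS) : Prop :=
  Part n (NAdj G) (σ.v 3) (σ.v 4) (σ.a 1) (σ.a 2) (σ.a 3) (σ.a 4) (σ.a 5)

theorem PState.bounds (h : PState G σ) : σ.v 3 ≤ n ∧ σ.v 4 ≤ n * (n + 1) :=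
  ⟨h.pieces_le, h.top_le.trans (Nat.mul_le_mul_right _ h.pieces_le)⟩

theorem mkSingle_spec (hX : (n + 2) * (n + 2) ≤ X) (h : PState G σ) (hv : σ.v 5 < n)
    (h0 : σ.a 1 (σ.v 5) = 0) :
    Tr I E X mkSingle σ fun σ' t => t = 7 ∧ PState G σ' ∧
      σ'.a 1 = Function.update (σ.a 1) (σ.v 5) (σ.v 3 + 1) ∧
      σ'.a 4 = Function.update (σ.a 4) (σ.v 3) 0 ∧ σ'.v 3 = σ.v 3 + 1 := by
  have hb := h.bounds
  have hs := h.single hv h0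
  have : (n + 2) * (n + 2) = n * (n + 1) + (3 * n + 4) := by ring
  simp only [mkSingle, Tr.seq, Tr.wr, Tr.asg]
  refine ⟨?_, ?_, ?_, ?_, ?_, ?_, ?_, ?_, ?_, ?_, ?_, ?_⟩ <;> simp
  all_goals try omega
  simpa [PState] using hs

theorem nadj_symm (G : SimpleGraph (Fin n)) : ∀ x y, NAdj G x y → NAdj G y x :=
  fun _ _ ⟨hx, hy, h⟩ => ⟨hy, hx, h.symm⟩
theorem nadj_lt (G : SimpleGraph (Fin n)) : ∀ x y, NAdj G x y → y < n := fun _ _ ⟨_, hy, _⟩ => hy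
theorem nadj_irrefl (G : SimpleGraph (Fin n)) : ∀ x, ¬ NAdj G x x :=
  fun _ ⟨_, _, h⟩ => G.irrefl h

/-- The situation between the first and the last pass: vertices of degree other than two are
pieces of their own, and marked vertices of degree two are inner vertices of chains. -/
structure Mid (G : SimpleGraph (Fin n)) (σ : HS) : Prop where
  part : PState G σ
  branch : ∀ y < n, dgA (σ.a 0) y ≠ 2 → σ.a 1 y ≠ 0 ∧ σ.a 4 (σ.a 1 y - 1) = 0
  inner : ∀ y < n, dgA (σ.a 0) y = 2 → σ.a 1 y ≠ 0 → σ.a 4 (σ.a 1 y - 1) ≠ 0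

theorem passOne_spec (hX : (n + 2) * (n + 2) ≤ X) (hn : σ.v 1 = n) (h3 : σ.v 3 = 0) (h4 : σ.v 4 = 0)
    (ha : ∀ t, t ≠ 0 → σ.a t = fun _ => 0) :
    Tr I E X passOne σ fun σ' t => t ≤ 9 * n + 1 ∧ Mid G σ' := by
  refine Tr.rep_le (fun j σ' => PState G σ' ∧ (∀ e, σ'.a 4 e = 0) ∧
    ∀ y < n, σ'.a 1 y ≠ 0 ↔ y < j ∧ dgA (σ.a 0) y ≠ 2) 8 ?_ ?_ ?_ ?_
  · simp only [Ex.eval_v, hn]; nlinarith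
  · refine ⟨?_, ?_, ?_⟩
    · rw [PState, h3, h4, ha 1 (by decide)]; exact Part.empty
    · rw [ha 4 (by decide)]; simp
    · rw [ha 1 (by decide)]; simp
  · rintro j hj σ' hF ⟨hp, hz, hm⟩
    simp only [Ex.eval_v, hn] at hj
    have e0 : σ'.a 0 = σ.a 0 := hF.2 0 (by decide)
    have hp' : PState G (σ'.sv 5 j) := hp
    rw [Tr.ite]
    simp only [Ex.eval_ofNat, eval_neE, eval_dgE, Ex.eval_v, HS.sv_v, HS.sv_a, if_true, e0]
    constructor
    · intro hd
      refine (mkSingle_spec hX hp' (by simpa using hj) ?_).conseq ?_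
      · by_contra h
        have := (hm j hj).1 (by simpa using h)
        omega
      · rintro σ'' t - ⟨ht, hp'', e1, e4, -⟩
        simp only [HS.sv_a, HS.sv_v, if_true, (by decide : ¬ (3 = 5)), if_false] at e1 e4
        refine ⟨⟨hp'', ?_, ?_⟩, by omega⟩
        · intro e
          rw [e4, Function.update_apply]; split_ifs
          exacts [rfl, hz e]
        · intro y hy
          rw [e1, Function.update_apply]
          split_ifs with hyj
          · subst hyj; simp; omega
          · rw [hm y hy]
            constructor <;> rintro ⟨h1, h2⟩ <;> exact ⟨by omega, h2⟩
    · intro hd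
      rw [Tr.skip]
      refine ⟨⟨hp', hz, ?_⟩, by omega⟩
      intro y hy
      rw [HS.sv_a, hm y hy]
      constructor
      · rintro ⟨h1, h2⟩; exact ⟨by omega, h2⟩
      · rintro ⟨h1, h2⟩
        refine ⟨?_, h2⟩
        by_contra hlt
        obtain rfl : y = j := by omega
        omega
  · rintro σ' t hF ⟨hp, hz, hm⟩ ht
    have e0 : σ'.a 0 = σ.a 0 := hF.2 0 (by decide)
    simp only [Ex.eval_v, hn] at ht hm
    refine ⟨by omega, hp, ?_, ?_⟩
    · intro y hy h2
      rw [e0] at h2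
      exact ⟨(hm y hy).2 ⟨hy, h2⟩, hz _⟩
    · intro y hy h2 h1
      rw [e0] at h2
      exact absurd h2 ((hm y hy).1 h1).2

/-- After the passes: everything is marked, and the special vertices of degree two lie on cycles
of such vertices. -/
structure Done (G : SimpleGraph (Fin n)) (σ : HS) : Prop where
  part : PState G σ
  marked : ∀ y < n, σ.a 1 y ≠ 0
  tight : ∀ y < n, dgA (σ.a 0) y = 2 → σ.a 4 (σ.a 1 y - 1) = 0 →
    ∀ z, NAdj G y z → dgA (σ.a 0) z = 2 ∧ σ.a 4 (σ.a 1 z - 1) = 0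

/-- All neighbours of vertices of degree other than two are marked by now, and a marked vertex of
degree two is inner to a chain and has only marked neighbours. -/
theorem Mid.unmarked_adj (h : Mid G σ) (hnb : ∀ y < n, dgA (σ.a 0) y ≠ 2 → ∀ z, NAdj G y z → σ.a 1 z ≠ 0)
    {y z : ℕ} (hy : y < n) (h0 : σ.a 1 y = 0) (hz : NAdj G y z) :
    dgA (σ.a 0) z = 2 ∧ σ.a 1 z = 0 := by
  have hzn := nadj_lt G _ _ hz
  have h2 : dgA (σ.a 0) z = 2 := by
    by_contra h2
    exact hnb z hzn h2 y (nadj_symm G _ _ hz) h0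
  refine ⟨h2, ?_⟩
  by_contra hm
  have hl := h.inner z hzn h2 hm
  have hle := h.part.hm_le z hzn
  rcases h.part.ps_cases z hzn hm with h' | ⟨p1, p2⟩
  · exact hl h'.2
  · have hlt : σ.a 1 z - 1 < σ.v 3 := by omega
    have hw := h.part.w_ps z hzn hm
    have hin := (h.part.inner _ hlt _ p1 p2).2.2 y hy
    rw [hw] at hin
    rcases hin.1 (nadj_symm G _ _ hz) with e | e
    · have := (h.part.w_lt _ hlt (σ.a 2 z - 1) (by omega)).2
      rw [← e] at this; exact this h0
    · have := (h.part.w_lt _ hlt (σ.a 2 z + 1) (by omega)).2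
      rw [← e] at this; exact this h0

/-- A special vertex of degree two becomes marked only in this pass. Its neighbours were then also
unmarked and of degree two, and this pass makes them special too, which is tightness. -/
theorem passThree_spec (hX : (n + 2) * (n + 2) ≤ X) (hn : σ.v 1 = n) (h : Mid G σ)
    (hnb : ∀ y < n, dgA (σ.a 0) y ≠ 2 → ∀ z, NAdj G y z → σ.a 1 z ≠ 0) :
    Tr I E X passThree σ fun σ' t => t ≤ 9 * n + 1 ∧ Done G σ' ∧ σ.v 3 ≤ σ'.v 3 := by
  have hP0 := h.part.hm_le
  refine Tr.rep_le (fun j σ' => PState G σ' ∧ σ.v 3 ≤ σ'.v 3 ∧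
    (∀ e < σ.v 3, σ'.a 4 e = σ.a 4 e) ∧ (∀ e, σ.v 3 ≤ e → e < σ'.v 3 → σ'.a 4 e = 0) ∧
    ∀ y < n, (σ.a 1 y ≠ 0 → σ'.a 1 y = σ.a 1 y) ∧
      (σ.a 1 y = 0 → (σ'.a 1 y ≠ 0 ↔ y < j) ∧ (σ'.a 1 y ≠ 0 → σ.v 3 < σ'.a 1 y))) 8 ?_ ?_ ?_ ?_
  · simp only [Ex.eval_v, hn]; nlinarith
  · exact ⟨h.part, le_rfl, fun _ _ => rfl, fun e h1 h2 => by omega,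
      fun y _ => ⟨fun _ => rfl, fun h0 => ⟨by simp [h0], fun h1 => absurd h0 h1⟩⟩⟩
  · rintro j hj σ' hF ⟨hp, hP, hold, hnew, hm⟩
    simp only [Ex.eval_v, hn] at hj
    have hp' : PState G (σ'.sv 5 j) := hp
    rw [Tr.ite]
    simp only [Ex.eval_ofNat, Ex.eval_rd, Ex.eval_v, HS.sv_v, HS.sv_a, if_true]
    constructor
    · intro hd
      have hj0 : σ'.a 1 j = 0 := by omega
      refine (mkSingle_spec hX hp' (by simpa using hj) (by simpa using hj0)).conseq ?_
      rintro σ'' t - ⟨ht, hp'', e1, e4, h3⟩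
      simp only [HS.sv_a, HS.sv_v, if_true, (by decide : ¬ (3 = 5)), if_false] at e1 e4 h3
      refine ⟨⟨hp'', by omega, ?_, ?_, ?_⟩, by omega⟩
      · intro e he
        rw [e4, Function.update_of_ne (by omega)]; exact hold e he
      · intro e h1 h2
        rw [e4, Function.update_apply]; split_ifs with h'
        exacts [rfl, hnew e h1 (by omega)]
      · intro y hy
        rw [e1, Function.update_apply]
        split_ifs with hyj
        · subst hyj
          refine ⟨fun h1 => absurd hj0 (by rw [(hm y hy).1 h1]; exact h1), fun _ => ⟨by simp, ?_⟩⟩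
          omega
        · refine ⟨(hm y hy).1, fun h0 => ?_⟩
          obtain ⟨h1, h2⟩ := (hm y hy).2 h0
          exact ⟨by rw [h1]; omega, h2⟩
    · intro hd
      rw [Tr.skip]
      refine ⟨⟨hp', hP, hold, hnew, ?_⟩, by omega⟩
      intro y hy
      refine ⟨(hm y hy).1, fun h0 => ?_⟩
      obtain ⟨h1, h2⟩ := (hm y hy).2 h0
      refine ⟨?_, h2⟩
      rw [HS.sv_a, h1]
      constructor
      · omega
      · intro h3
        by_contra h4
        obtain rfl : y = j := by omega
        have := h1.1 (by omega)
        omega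
  · rintro σ' t hF ⟨hp, hP, hold, hnew, hm⟩ ht
    have e0 : σ'.a 0 = σ.a 0 := hF.2 0 (by decide)
    simp only [Ex.eval_v, hn] at ht hm
    have hmk : ∀ y < n, σ'.a 1 y ≠ 0 := fun y hy => by
      by_cases h0 : σ.a 1 y = 0
      · exact ((hm y hy).2 h0).1.2 hy
      · rw [(hm y hy).1 h0]; exact h0
    have hun : ∀ y < n, σ.a 1 y = 0 → σ'.a 4 (σ'.a 1 y - 1) = 0 := fun y hy h0 => by
      have h1 := ((hm y hy).2 h0).2 (hmk y hy)
      have h2 := hp.hm_le y hy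
      exact hnew _ (by omega) (by omega)
    refine ⟨by omega, ⟨hp, hmk, ?_⟩, hP⟩
    intro y hy hy2 hl z hz
    rw [e0] at hy2 ⊢
    have h0 : σ.a 1 y = 0 := by
      by_contra h1
      have := hP0 y hy
      rw [(hm y hy).1 h1, hold _ (by omega)] at hl
      exact h.inner y hy hy2 h1 hl
    obtain ⟨h1, h2⟩ := h.unmarked_adj hnb hy h0 hz
    exact ⟨h1, hun z (nadj_lt G _ _ hz) h2⟩

variable [DecidableRel G.Adj]

theorem GrRep.adj_two {a : ℕ → ℕ} (h : GrRep G a) {x : ℕ} (hx : x < n) (h2 : dgA a x = 2) (y : ℕ) :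
    NAdj G x y ↔ y = nbrA a x 0 ∨ y = nbrA a x 1 := by
  rw [h.adj_iff x hx, h2]
  constructor
  · rintro ⟨i, hi, rfl⟩
    obtain rfl | rfl : i = 0 ∨ i = 1 := by omega
    exacts [.inl rfl, .inr rfl]
  · rintro (rfl | rfl)
    exacts [⟨0, by omega, rfl⟩, ⟨1, by omega, rfl⟩]

theorem stepChain_spec (hX : (n + 2) * (n + 2) ≤ X) (hG : GrRep G (σ.a 0)) {P top : ℕ}
    {hm₀ ps₀ st ln W₀ : ℕ → ℕ} (hpart : Part n (NAdj G) P top hm₀ ps₀ st ln W₀) {s : ℕ}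
    (hdeg : ∀ y < n, dgA (σ.a 0) y ≠ 2 → hm₀ y ≠ 0) (hs : s < n) (hs0 : hm₀ s ≠ 0)
    (hP : σ.v 3 = P) (htop : σ.v 4 = top)
    (h : Follow n (NAdj G) P top hm₀ ps₀ W₀ s (σ.v 8) (σ.a 1) (σ.a 2) (σ.a 5))
    (h0 : σ.a 1 (σ.a 5 (σ.v 4 + σ.v 8)) = 0) :
    Tr I E X stepChain σ fun σ' t => t = 5 ∧
      Follow n (NAdj G) P top hm₀ ps₀ W₀ s (σ'.v 8) (σ'.a 1) (σ'.a 2) (σ'.a 5) ∧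
      σ'.v 8 = σ.v 8 + 1 ∧ σ'.a 5 (σ.v 4 + 1) = σ.a 5 (σ.v 4 + 1) := by
  have hL1 := h.one_le
  subst hP htop
  have hXn : n + 2 ≤ X := le_trans (by nlinarith) hX
  have hPn := hpart.pieces_le
  have hLn := h.le hs hs0
  have hc := h.cur_lt
  have hc0 : hm₀ (σ.a 5 (σ.v 4 + σ.v 8)) = 0 := by
    by_contra h'
    rw [(h.old_hm _ h').1] at h0
    exact h' h0
  have h2 : dgA (σ.a 0) (σ.a 5 (σ.v 4 + σ.v 8)) = 2 := by
    by_contra h'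
    exact hdeg _ hc h' hc0
  obtain ⟨q1, q2⟩ := h.step (nadj_symm G) (nadj_lt G) h0 (hG.ne _ hc h2) (hG.adj_two hc h2)
  simp only [stepChain, Tr.seq, Tr.wr, Tr.asg]
  refine ⟨?_, ?_, ?_, ?_, ?_, ?_, ?_, ?_, ?_⟩ <;> simp
  all_goals try omega
  all_goals first | exact q2 | rw [Function.update_of_ne (by omega)]

theorem followChain_spec (hX : (n + 2) * (n + 2) ≤ X) (hG : GrRep G (σ.a 0)) (hn : σ.v 1 = n)
    (h : Mid G σ) (hv : σ.v 5 < n) (hd : dgA (σ.a 0) (σ.v 5) ≠ 2)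
    (hi : σ.v 6 < dgA (σ.a 0) (σ.v 5)) (h0 : σ.a 1 (nbrA (σ.a 0) (σ.v 5) (σ.v 6)) = 0) :
    Tr I E X followChain σ fun σ' t => t ≤ 7 * n + 8 ∧ Mid G σ' ∧ σ'.v 3 = σ.v 3 + 1 ∧
      (∀ y, σ.a 1 y ≠ 0 → σ'.a 1 y ≠ 0) ∧ σ'.a 1 (nbrA (σ.a 0) (σ.v 5) (σ.v 6)) ≠ 0 := by
  have hb := h.part.bounds
  obtain ⟨hs0, hsl⟩ := h.branch _ hv hd
  have hadj : NAdj G (σ.v 5) (nbrA (σ.a 0) (σ.v 5) (σ.v 6)) :=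
    (hG.adj_iff _ hv _).2 ⟨_, hi, rfl⟩
  have hun := nadj_lt G _ _ hadj
  have hXn : n + 2 ≤ X := le_trans (by nlinarith) hX
  have hXe : (n + 2) * (n + 2) = n * (n + 1) + (3 * n + 4) := by ring
  set u := nbrA (σ.a 0) (σ.v 5) (σ.v 6) with hu
  have hinit := Follow.init (ps := σ.a 2) (W := σ.a 5) (P := σ.v 3) (top := σ.v 4) hun h0
    (nadj_symm G _ _ hadj)
  rw [followChain]
  simp only [Tr.seq, Tr.wr, Tr.asg]
  refine ⟨by simp; omega, by simp [← hu]; omega, by simp; omega, ?_⟩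
  refine Tr.rep_le (fun j σ' =>
    Follow n (NAdj G) (σ.v 3) (σ.v 4) (σ.a 1) (σ.a 2) (σ.a 5) (σ.v 5) (σ'.v 8) (σ'.a 1) (σ'.a 2)
      (σ'.a 5) ∧ (σ'.a 1 (σ'.a 5 (σ.v 4 + σ'.v 8)) ≠ 0 ∨ σ'.v 8 = j + 1) ∧
      σ'.a 5 (σ.v 4 + 1) = u) 6 ?_ ?_ ?_ ?_
  · simp [hn]; omega
  · refine ⟨?_, .inr (by simp), by simp [hu]⟩
    simpa [← hu] using hinit
  · rintro j hj σ' hF ⟨hf, hc, hW⟩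
    have e0 : σ'.a 0 = σ.a 0 := by rw [hF.2 0 (by decide)]; simp
    have e3 : σ'.v 3 = σ.v 3 := by rw [hF.1 3 (by decide)]; simp
    have e4 : σ'.v 4 = σ.v 4 := by rw [hF.1 4 (by decide)]; simp
    rw [Tr.ite]
    simp only [Ex.eval_ofNat, Ex.eval_rd, Ex.eval_add, Ex.eval_v, HS.sv_v, HS.sv_a,
      (by decide : ¬ (4 = 7)), (by decide : ¬ (8 = 7)), if_false, e4]
    constructor
    · intro hlt
      refine (stepChain_spec (σ := σ'.sv 7 j) hX (by simpa [e0] using hG) h.part (s := σ.v 5)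
        (fun y hy hy2 => (h.branch y hy (by simpa [e0] using hy2)).1) hv hs0 (by simpa using e3)
        (by simpa using e4) (by simpa using hf) (by simp [e4]; omega)).conseq ?_
      rintro σ'' t - ⟨ht, hf', h8, hW'⟩
      refine ⟨⟨hf', .inr ?_, by simpa [e4, hW] using hW'⟩, by omega⟩
      simp at h8
      omega
    · intro hlt
      rw [Tr.skip]
      refine ⟨⟨by simpa using hf, .inl (by simp; omega), by simpa using hW⟩, by omega⟩
  · rintro σ' t hF ⟨hf, hc, hW⟩ ht
    have e0 : σ'.a 0 = σ.a 0 := by rw [hF.2 0 (by decide)]; simp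
    have e3' : σ'.a 3 = σ.a 3 := by rw [hF.2 3 (by decide)]; simp
    have e4' : σ'.a 4 = σ.a 4 := by rw [hF.2 4 (by decide)]; simp
    have e3 : σ'.v 3 = σ.v 3 := by rw [hF.1 3 (by decide)]; simp
    have e4 : σ'.v 4 = σ.v 4 := by rw [hF.1 4 (by decide)]; simp
    have hL := hf.le hv hs0
    -- If the walk never stopped, then `L = n + 1` after the loop, against `Follow.le`.
    have hcur : σ'.a 1 (σ'.a 5 (σ.v 4 + σ'.v 8)) ≠ 0 := by
      rcases hc with hc | hc
      · exact hc
      · simp [hn] at hc; omega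
    have hpart := hf.part h.part (nadj_irrefl G) hv hs0 hsl hcur
    obtain ⟨hL2, -, -⟩ := hf.special h.part (nadj_irrefl G) hs0 hcur
    refine ⟨by simp [e4]; omega, by simp; omega, by simp; omega, by simp; omega, ?_, ⟨?_, ?_, ?_⟩,
      ?_, ?_, ?_⟩
    · simp [hn] at ht; omega
    · simpa [PState, e3, e4, e3', e4'] using hpart
    · intro y hy hy2
      obtain ⟨h1, h2⟩ := h.branch y hy (by simpa [e0] using hy2)
      have := h.part.hm_le y hy
      simp [e3, e4', (hf.old_hm y h1).1, h1]
      rw [Function.update_of_ne (by omega)]; exact h2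
    · intro y hy hy2 hy1
      by_cases h1 : σ.a 1 y = 0
      · have := (hf.new y h1 (by simpa using hy1)).1
        simp [e3, this]; omega
      · have := h.part.hm_le y hy
        simp [e3, e4', (hf.old_hm y h1).1]
        rw [Function.update_of_ne (by omega)]
        exact h.inner y hy (by simpa [e0] using hy2) h1
    · simp [e3]
    · intro y hy
      simpa [(hf.old_hm y hy).1] using hy
    · have hi1 := hf.inner 1 (by omega) (by omega)
      rw [hW] at hi1
      simp [hi1.2.2.1]

theorem GrRep.dgA_lt {a : ℕ → ℕ} (h : GrRep G a) {x : ℕ} (hx : x < n) : dgA a x < n := by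
  have h1 := h.degree ⟨x, hx⟩
  have h2 := G.degree_lt_card_verts ⟨x, hx⟩
  rw [Fintype.card_fin] at h2
  simp only at h1
  omega

/-- Every chain that is followed creates a new piece, so its linear cost is charged to the growth of
`v 3`; the rest is proportional to the degree. -/
theorem scanNbrs_spec (hX : (n + 2) * (n + 2) ≤ X) (hG : GrRep G (σ.a 0)) (hn : σ.v 1 = n)
    (h : Mid G σ) (hv : σ.v 5 < n) (hd : dgA (σ.a 0) (σ.v 5) ≠ 2) :
    Tr I E X (.rep 6 (dgE (v 5)) (.ite (rd 1 (nbrE (v 5) (v 6))) 1 followChain .skip)) σ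
      fun σ' t => Mid G σ' ∧ (∀ y, σ.a 1 y ≠ 0 → σ'.a 1 y ≠ 0) ∧
      (∀ z, NAdj G (σ.v 5) z → σ'.a 1 z ≠ 0) ∧ σ.v 3 ≤ σ'.v 3 ∧
      t ≤ 3 * dgA (σ.a 0) (σ.v 5) + (7 * n + 10) * (σ'.v 3 - σ.v 3) + 1 := by
  have hdn := hG.dgA_lt hv
  refine Tr.rep (fun j σ' t => Mid G σ' ∧ (∀ y, σ.a 1 y ≠ 0 → σ'.a 1 y ≠ 0) ∧
    (∀ i < j, σ'.a 1 (nbrA (σ.a 0) (σ.v 5) i) ≠ 0) ∧ σ.v 3 ≤ σ'.v 3 ∧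
    t ≤ 3 * j + (7 * n + 10) * (σ'.v 3 - σ.v 3)) ?_ ?_ ?_ ?_
  · simp only [eval_dgE, Ex.eval_v]; nlinarith
  · exact ⟨h, fun _ h => h, fun i hi => by omega, le_rfl, by simp⟩
  · rintro j hj σ' t hF ⟨hM, hmono, hm, hP, ht⟩
    simp only [eval_dgE, Ex.eval_v] at hj
    have e0 : σ'.a 0 = σ.a 0 := hF.2 0 (by decide)
    have e1 : σ'.v 1 = n := by rw [hF.1 1 (by decide), hn]
    have e5 : σ'.v 5 = σ.v 5 := hF.1 5 (by decide)
    have hM' : Mid G (σ'.sv 6 j) := ⟨hM.part, hM.branch, hM.inner⟩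
    rw [Tr.ite]
    simp only [Ex.eval_ofNat, Ex.eval_rd, eval_nbrE, Ex.eval_v, HS.sv_v, HS.sv_a, if_true,
      (by decide : ¬ (5 = 6)), if_false, e0, e5]
    constructor
    · intro hlt
      refine (followChain_spec (σ := σ'.sv 6 j) hX (by simpa [e0] using hG) (by simpa using e1) hM'
        (by simpa [e5] using hv) (by simpa [e0, e5] using hd) (by simpa [e0, e5] using hj)
        (by simp [e0, e5]; omega)).conseq ?_
      rintro σ'' t' - ⟨ht', hM'', h3, hmono', hmark⟩
      simp only [HS.sv_v, HS.sv_a, if_true, (by decide : ¬ (5 = 6)), (by decide : ¬ (3 = 6)),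
        if_false, e0, e5] at h3 hmono' hmark
      refine ⟨hM'', fun y hy => hmono' y (hmono y hy), ?_, by omega, ?_⟩
      · intro i hi
        rcases Nat.lt_succ_iff_lt_or_eq.1 hi with h | rfl
        exacts [hmono' _ (hm i h), hmark]
      · rw [h3, show σ'.v 3 + 1 - σ.v 3 = (σ'.v 3 - σ.v 3) + 1 by omega, Nat.mul_add (7 * n + 10)]
        omega
    · intro hlt
      rw [Tr.skip]
      refine ⟨hM', hmono, ?_, hP, ?_⟩
      · intro i hi
        rcases Nat.lt_succ_iff_lt_or_eq.1 hi with h | rfl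
        exacts [hm i h, by simp; omega]
      · simp; omega
  · rintro σ' t hF ⟨hM, hmono, hm, hP, ht⟩
    simp only [eval_dgE, Ex.eval_v] at hm ht
    refine ⟨hM, hmono, ?_, hP, by omega⟩
    intro z hz
    obtain ⟨i, hi, rfl⟩ := (hG.adj_iff _ hv z).1 hz
    exact hm i hi

theorem passTwo_spec (hX : (n + 2) * (n + 2) ≤ X) (hG : GrRep G (σ.a 0)) (hn : σ.v 1 = n)
    (h : Mid G σ) :
    Tr I E X passTwo σ fun σ' t => Mid G σ' ∧
      (∀ y < n, dgA (σ.a 0) y ≠ 2 → ∀ z, NAdj G y z → σ'.a 1 z ≠ 0) ∧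
      t ≤ 3 * n + 6 * G.edgeFinset.card + (7 * n + 10) * σ'.v 3 + 1 := by
  refine Tr.rep (fun j σ' t => Mid G σ' ∧
    (∀ y < j, dgA (σ.a 0) y ≠ 2 → ∀ z, NAdj G y z → σ'.a 1 z ≠ 0) ∧
    t ≤ 3 * j + 3 * (∑ v ∈ Finset.range j, dgA (σ.a 0) v) + (7 * n + 10) * σ'.v 3) ?_ ?_ ?_ ?_
  · simp only [Ex.eval_v, hn]; nlinarith
  · exact ⟨h, fun i hi => by omega, by simp⟩
  · rintro j hj σ' t hF ⟨hM, hm, ht⟩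
    simp only [Ex.eval_v, hn] at hj
    have e0 : σ'.a 0 = σ.a 0 := hF.2 0 (by decide)
    have e1 : σ'.v 1 = n := by rw [hF.1 1 (by decide), hn]
    have hM' : Mid G (σ'.sv 5 j) := ⟨hM.part, hM.branch, hM.inner⟩
    rw [Tr.ite, Finset.sum_range_succ]
    simp only [Ex.eval_ofNat, eval_neE, eval_dgE, Ex.eval_v, HS.sv_v, HS.sv_a, if_true, e0]
    constructor
    · intro hd
      refine (scanNbrs_spec (σ := σ'.sv 5 j) hX (by simpa [e0] using hG) (by simpa using e1) hM'
        (by simpa using hj) (by simp [e0]; omega)).conseq ?_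
      rintro σ'' t' - ⟨hM'', hmono, hnb, hP, ht'⟩
      simp only [HS.sv_v, HS.sv_a, if_true, (by decide : ¬ (3 = 5)), if_false, e0] at hmono hnb hP ht'
      refine ⟨hM'', ?_, ?_⟩
      · intro y hy hy2 z hz
        rcases Nat.lt_succ_iff_lt_or_eq.1 hy with h | rfl
        exacts [hmono z (hm y h hy2 z hz), hnb z hz]
      · obtain ⟨d, hd⟩ := Nat.exists_eq_add_of_le hP
        rw [hd, Nat.add_sub_cancel_left] at ht'
        rw [hd, Nat.mul_add (7 * n + 10)]
        omega
    · intro hd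
      rw [Tr.skip]
      refine ⟨hM', ?_, ?_⟩
      · intro y hy hy2 z hz
        rcases Nat.lt_succ_iff_lt_or_eq.1 hy with h | rfl
        exacts [hm y h hy2 z hz, by omega]
      · simp; omega
  · rintro σ' t hF ⟨hM, hm, ht⟩
    simp only [Ex.eval_v, hn, hG.sum] at hm ht
    exact ⟨hM, hm, by omega⟩

end

end HypRAM
namespace HypRAM

/-! ### The input -/

section

variable {n : ℕ} {G : SimpleGraph (Fin n)} {adj : Fin n → List (Fin n)} {δ : ℕ}

/-- The adjacency lists as lists of numbers. -/
def lists (adj : Fin n → List (Fin n)) : List (List ℕ) := List.ofFn fun v => (adj v).map Fin.val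

theorem encode_eq (adj : Fin n → List (Fin n)) (δ : ℕ) : encode adj δ = [n, δ] ++
    (List.range (n + 1)).map (fun j => n + 3 + ((lists adj).take j).flatten.length) ++
    (lists adj).flatten := rfl

theorem length_encode (adj : Fin n → List (Fin n)) (δ : ℕ) :
    (encode adj δ).length = n + 3 + (lists adj).flatten.length := by
  simp only [encode_eq, List.length_append, List.length_map, List.length_range, List.length_cons,
    List.length_nil]
  omega

theorem encode_zero : (encode adj δ).getD 0 0 = n := by simp [encode_eq]
theorem encode_one : (encode adj δ).getD 1 0 = δ := by simp [encode_eq]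

theorem encode_start {j : ℕ} (hj : j ≤ n) :
    (encode adj δ).getD (j + 2) 0 = n + 3 + ((lists adj).take j).flatten.length := by
  rw [encode_eq, List.getD_append _ _ _ _ (by simp; omega), List.getD_append_right _ _ _ _ (by simp)]
  simp [List.getD_eq_getElem?_getD, List.getElem?_range (show j < n + 1 by omega)]

theorem encode_list (i : ℕ) :
    (encode adj δ).getD (n + 3 + i) 0 = (lists adj).flatten.getD i 0 := by
  rw [encode_eq, List.getD_append_right _ _ _ _ (by simp)]
  congr 1
  simp only [List.length_append, List.length_map, List.length_range, List.length_cons, List.length_nil]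
  omega

theorem take_succ_flatten (v : Fin n) : ((lists adj).take (v + 1)).flatten =
    ((lists adj).take v).flatten ++ (adj v).map Fin.val := by
  have hv : (v : ℕ) < (lists adj).length := by simp [lists]
  rw [List.take_succ_eq_append_getElem hv, List.flatten_append]
  simp [lists]

theorem encode_dgA (v : Fin n) : dgA (fun i => (encode adj δ).getD i 0) v = (adj v).length := by
  have h1 := encode_start (adj := adj) (δ := δ) (j := v + 1) (by omega)
  have h2 := encode_start (adj := adj) (δ := δ) (j := v) (by omega)
  rw [take_succ_flatten] at h1
  simp only [dgA, h2, show (v : ℕ) + 3 = v + 1 + 2 from rfl, h1, List.length_append, List.length_map]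
  omega

theorem encode_nbrA (v : Fin n) {i : ℕ} (hi : i < (adj v).length) :
    nbrA (fun i => (encode adj δ).getD i 0) v i = (adj v)[i] := by
  simp only [nbrA]
  rw [encode_start (by omega), add_assoc, encode_list]
  have h := List.take_append_drop (v + 1) (lists adj)
  rw [← h, List.flatten_append, take_succ_flatten, List.append_assoc, List.getD_append_right _ _ _ _
    (by simp), List.getD_append _ _ _ _ (by simpa using hi)]
  simp [List.getD_eq_getElem?_getD, hi]

variable [DecidableRel G.Adj]

theorem IsAdjLists.length_eq (h : IsAdjLists G adj) (v : Fin n) : (adj v).length = G.degree v := by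
  rw [← List.toFinset_card_of_nodup (h v).1]
  congr 1
  ext w
  simp [(h v).2]

theorem IsAdjLists.grRep (h : IsAdjLists G adj) : GrRep G fun i => (encode adj δ).getD i 0 where
  adj_iff v hv y := by
    have e1 := encode_dgA (adj := adj) (δ := δ) ⟨v, hv⟩
    simp only at e1
    rw [e1]
    constructor
    · rintro ⟨h1, h2, ha⟩
      obtain ⟨i, hi, hy⟩ := List.getElem_of_mem (((h _).2 _).2 ha)
      exact ⟨i, hi, by rw [encode_nbrA ⟨v, hv⟩ hi, hy]⟩
    · rintro ⟨i, hi, rfl⟩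
      rw [encode_nbrA ⟨v, hv⟩ hi]
      exact ⟨hv, Fin.is_lt _, ((h _).2 _).1 (List.getElem_mem hi)⟩
  ne v hv hd := by
    have e1 := encode_dgA (adj := adj) (δ := δ) ⟨v, hv⟩
    simp only at e1
    rw [hd] at e1
    rw [encode_nbrA ⟨v, hv⟩ (show 0 < _ by omega), encode_nbrA ⟨v, hv⟩ (show 1 < _ by omega)]
    intro h'
    have := (h ⟨v, hv⟩).1.getElem_inj_iff.1 (Fin.ext h')
    omega
  degree v := by rw [encode_dgA, h.length_eq]
  sum := by
    rw [Finset.sum_range, ← G.sum_degrees_eq_twice_card_edges]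
    exact Finset.sum_congr rfl fun v _ => by rw [encode_dgA, h.length_eq]

theorem IsAdjLists.length_encode (h : IsAdjLists G adj) :
    (encode adj δ).length = n + 3 + 2 * G.edgeFinset.card := by
  rw [HypRAM.length_encode, ← G.sum_degrees_eq_twice_card_edges]
  simp [lists, List.length_flatten, List.map_ofFn, List.sum_ofFn, h.length_eq]

theorem encode_end : (encode adj δ).getD ((encode adj δ).getD 0 0 + 2) 0 = (encode adj δ).length := by
  rw [encode_zero, encode_start le_rfl, length_encode, List.take_of_length_le (by simp [lists])]

theorem encode_le (i : ℕ) : (encode adj δ).getD i 0 ≤ (encode adj δ).length + δ := by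
  rw [length_encode]
  match i with
  | 0 => rw [encode_zero]; omega
  | 1 => rw [encode_one]; omega
  | i + 2 =>
    by_cases hi : i ≤ n
    · rw [encode_start hi]
      have := (((lists adj).take_sublist i).flatten).length_le
      omega
    · obtain ⟨j, rfl⟩ : ∃ j, i = n + 1 + j := ⟨i - (n + 1), by omega⟩
      rw [show n + 1 + j + 2 = n + 3 + j by omega, encode_list, List.getD_eq_getElem?_getD]
      by_cases hj : j < (lists adj).flatten.length
      · rw [List.getElem?_eq_getElem hj, Option.getD_some]
        have := List.getElem_mem hj
        generalize (lists adj).flatten[j] = x at this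
        simp only [List.mem_flatten, lists, List.mem_ofFn] at this
        obtain ⟨l, ⟨v, rfl⟩, hx⟩ := this
        simp only [List.mem_map] at hx
        obtain ⟨y, -, rfl⟩ := hx
        omega
      · rw [List.getElem?_eq_none (by omega)]; simp

end

open Ex (v rd)

/-- Read the number of vertices and copy the input. -/
def readInput : Stmt := .seq (.inp 1 0) (.seq (.inp 2 (v 1 + 2))
  (.rep 5 (v 2) (.seq (.inp 6 (v 5)) (.wr 0 (v 5) (v 6)))))

theorem readInput_spec {l : List ℕ} {X : ℕ} (hl : l.length ≤ X) (hI : ∀ i, l.getD i 0 ≤ X)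
    (hend : l.getD (l.getD 0 0 + 2) 0 = l.length) (h3 : l.getD 0 0 + 3 ≤ l.length) :
    Tr (fun i => l.getD i 0) l.length X readInput ⟨fun _ => 0, fun _ _ => 0⟩ fun σ t =>
      σ.v 1 = l.getD 0 0 ∧ σ.v 3 = 0 ∧ σ.v 4 = 0 ∧ σ.a 0 = (fun i => l.getD i 0) ∧
      (∀ t, t ≠ 0 → σ.a t = fun _ => 0) ∧ t ≤ 3 * l.length + 3 := by
  simp only [readInput, Tr.seq, Tr.inp]
  refine ⟨by simp only [Ex.eval_ofNat]; omega, by simp only [Ex.eval_ofNat, Ex.eval_add, Ex.eval_v, HS.sv_v, if_true]; omega, ?_⟩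
  have e2 : ∀ σ : HS, σ = ((⟨fun _ => 0, fun _ _ => 0⟩ : HS).sv 1 (l.getD 0 0)).sv 2 l.length →
    Tr (fun i => l.getD i 0) l.length X (.rep 5 (v 2) (.seq (.inp 6 (v 5)) (.wr 0 (v 5) (v 6)))) σ
      fun σ t => σ.v 1 = l.getD 0 0 ∧ σ.v 3 = 0 ∧ σ.v 4 = 0 ∧ σ.a 0 = (fun i => l.getD i 0) ∧
      (∀ t, t ≠ 0 → σ.a t = fun _ => 0) ∧ 1 + (1 + t) ≤ 3 * l.length + 3 := by
    rintro σ hσ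
    have v2 : σ.v 2 = l.length := by rw [hσ]; simp
    refine Tr.rep_le (fun j σ' => ∀ i, σ'.a 0 i = if i < j then l.getD i 0 else 0) 2 ?_ ?_ ?_ ?_
    · simpa [v2] using hl
    · simp [hσ]
    · intro j hj σ' hF h
      simp only [Tr.seq, Tr.inp, Tr.wr]
      simp only [Ex.eval_v, v2] at hj
      refine ⟨by simpa using hj, by simpa using hI j, ?_, by omega⟩
      intro i
      simp only [Ex.eval_v, HS.sv_v, HS.sa_a, HS.sv_a, if_true, Function.update_apply, h i,
        (by decide : ¬ (5 = 6)), if_false]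
      split_ifs <;> first | rfl | omega | (congr 1; omega)
    · intro σ' t hF h ht
      rw [hF.1 1 (by decide), hF.1 3 (by decide), hF.1 4 (by decide)]
      simp only [Ex.eval_v, v2] at h ht
      refine ⟨by simp [hσ], by simp [hσ], by simp [hσ], ?_, ?_, by omega⟩
      · funext i
        rw [h i]
        split_ifs with hi
        · rfl
        · rw [List.getD_eq_getElem?_getD, List.getElem?_eq_none (by omega)]; rfl
      · intro t ht
        rw [hF.2 t (by simp [Stmt.wa, ht]), hσ]
        rfl
  refine e2 _ ?_
  simp only [Ex.eval_ofNat, Ex.eval_add, Ex.eval_v, HS.sv_v, if_true, hend]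

end HypRAM
namespace HypRAM

/-! ### The distances between special vertices -/

section

variable {V : Type*} {G : SimpleGraph V} {P : ℕ} {len : ℕ → ℕ} {w : ℕ → ℕ → V} {home pos : V → ℕ}

/-- Special vertices that are adjacent or the ends of a piece of length `l`. -/
inductive Link (G : SimpleGraph V) (P : ℕ) (len : ℕ → ℕ) (w : ℕ → ℕ → V) (home : V → ℕ) :
    V → V → ℕ → Prop where
  | adj {x y : V} (hx : len (home x) = 0) (hy : len (home y) = 0) (h : G.Adj x y) :
      Link G P len w home x y 1
  | piece {e : ℕ} (he : e < P) : Link G P len w home (w e 0) (w e (len e)) (len e)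
  | piece' {e : ℕ} (he : e < P) : Link G P len w home (w e (len e)) (w e 0) (len e)

theorem Link.special (D : Dec G P len w home pos) {x y : V} {l : ℕ} (h : Link G P len w home x y l) :
    len (home x) = 0 ∧ len (home y) = 0 := by
  cases h with
  | adj hx hy => exact ⟨hx, hy⟩
  | piece he => exact ⟨D.first _ he, D.last _ he⟩
  | piece' he => exact ⟨D.last _ he, D.first _ he⟩

theorem Link.dist_le (D : Dec G P len w home pos) {x y : V} {l : ℕ} (h : Link G P len w home x y l) :
    G.Reachable x y ∧ G.dist x y ≤ l := by
  have key : ∀ e < P, G.Reachable (w e 0) (w e (len e)) ∧ G.dist (w e 0) (w e (len e)) ≤ len e := by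
    intro e he
    have h1 := D.dist_chain he (x := w e 0) (j := len e) (.refl _) (Dec.ne_special (D.first _ he)) le_rfl
    rw [SimpleGraph.dist_self] at h1
    exact ⟨D.reachable_w he (Nat.zero_le _) le_rfl, by omega⟩
  cases h with
  | adj hx hy h => exact ⟨h.reachable, (SimpleGraph.dist_eq_one_iff_adj.2 h).le⟩
  | piece he => exact key _ he
  | piece' he =>
    obtain ⟨h1, h2⟩ := key _ he
    exact ⟨h1.symm, by rwa [G.dist_comm]⟩

/-- Look at the last vertex before `y` on a shortest path from `x`. If it is special, its edge to
`y` is the link. Otherwise it is inner to a chain ending in `y`, and by `Dec.dist_chain` the path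
came through the whole chain from its other end. -/
theorem Dec.exists_link (D : Dec G P len w home pos) {x y : V} (hx : len (home x) = 0)
    (hy : len (home y) = 0) (h : G.Reachable x y) (hne : x ≠ y) :
    ∃ z l, Link G P len w home z y l ∧ G.Reachable x z ∧ G.dist x z + l = G.dist x y ∧ 0 < l := by
  obtain ⟨z, hyz, hd⟩ := exists_adj_dist h hne
  have hxz : G.Reachable x z := h.trans hyz.reachable
  by_cases hz : len (home z) = 0
  · exact ⟨z, 1, .adj hz hy hyz.symm, hxz, hd, one_pos⟩
  have hp := D.pos_mem hz
  have he := D.home_lt z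
  have h1 := D.dist_chain he (x := x) (j := pos z)
    (hxz.trans (by simpa [D.w_pos] using D.reachable_w he hp.2.le (Nat.zero_le _)))
    (Dec.ne_special hx) hp.2.le
  have hin := (D.inner _ he _ hp.1 hp.2).2.2 y
  rw [D.w_pos] at h1 hin
  have hw0 := D.reachable_w he hp.2.le (Nat.zero_le _)
  have hwl := D.reachable_w he hp.2.le le_rfl
  rw [D.w_pos] at hw0 hwl
  rcases hin.1 hyz.symm with rfl | rfl
  · have h0 : pos z - 1 = 0 := by
      by_contra h0
      rw [(D.inner _ he (pos z - 1) (by omega) (by omega)).1] at hy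
      exact hz hy
    rw [h0] at hd ⊢
    exact ⟨_, _, .piece' he, hxz.trans hwl, by omega, by omega⟩
  · have h0 : pos z + 1 = len (home z) := by
      by_contra h0
      rw [(D.inner _ he (pos z + 1) (by omega) (by omega)).1] at hy
      exact hz hy
    rw [h0] at hd ⊢
    exact ⟨_, _, .piece he, hxz.trans hw0, by omega, by omega⟩

theorem index_inj {P e f e' f' : ℕ} (hf : f < P) (hf' : f' < P) (h : e * P + f = e' * P + f') :
    e = e' ∧ f = f' := by
  have h1 : (e * P + f) / P = e := by
    rw [mul_comm, Nat.mul_add_div (by omega), Nat.div_eq_of_lt hf, add_zero]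
  have h2 : (e' * P + f') / P = e' := by
    rw [mul_comm, Nat.mul_add_div (by omega), Nat.div_eq_of_lt hf', add_zero]
  rw [h, h2] at h1
  subst h1
  exact ⟨rfl, by omega⟩

/-- The matrix `A`, stored by rows, has upper bounds of distances, with the value `n` for unknown
distances. -/
structure Mat (G : SimpleGraph V) (P n : ℕ) (len : ℕ → ℕ) (w : ℕ → ℕ → V) (A : ℕ → ℕ) : Prop where
  le : ∀ i, A i ≤ n
  sound : ∀ e < P, ∀ f < P, A (e * P + f) < n → len e = 0 ∧ len f = 0 ∧
    G.Reachable (w e 0) (w f 0) ∧ G.dist (w e 0) (w f 0) ≤ A (e * P + f)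

/-- Decrease an entry. -/
def relaxed (A : ℕ → ℕ) (i d : ℕ) : ℕ → ℕ := Function.update A i (min (A i) d)

theorem relaxed_le (A : ℕ → ℕ) (i d : ℕ) : relaxed A i d ≤ A := by
  intro j
  rw [relaxed, Function.update_apply]
  split_ifs with h
  · rw [h]; exact min_le_left _ _
  · exact le_rfl

theorem relaxed_self_le (A : ℕ → ℕ) (i d : ℕ) : relaxed A i d i ≤ d := by simp [relaxed]

variable {n : ℕ} {A : ℕ → ℕ}

theorem Mat.relaxed (h : Mat G P n len w A) {e f d : ℕ} (hf : f < P)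
    (hd : d < n → len e = 0 ∧ len f = 0 ∧ G.Reachable (w e 0) (w f 0) ∧ G.dist (w e 0) (w f 0) ≤ d) :
    Mat G P n len w (relaxed A (e * P + f) d) := by
  refine ⟨fun i => (relaxed_le A _ d i).trans (h.le i), fun e' he' f' hf' => ?_⟩
  rw [HypRAM.relaxed, Function.update_apply]
  split_ifs with hi
  · obtain ⟨rfl, rfl⟩ := index_inj hf' hf hi
    intro hlt
    rcases le_total (A (e' * P + f')) d with h' | h'
    · rw [min_eq_left h'] at hlt ⊢
      exact h.sound _ he' _ hf' hlt
    · rw [min_eq_right h'] at hlt ⊢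
      exact hd hlt
  · exact h.sound _ he' _ hf'

theorem Mat.relaxed_link (D : Dec G P len w home pos) (h : Mat G P n len w A) {x y : V} {l : ℕ}
    (hl : Link G P len w home x y l) : Mat G P n len w (HypRAM.relaxed A (home x * P + home y) l) := by
  obtain ⟨hx, hy⟩ := hl.special D
  refine h.relaxed (D.home_lt y) fun _ => ⟨hx, hy, ?_⟩
  rw [D.w_zero hx, D.w_zero hy]
  exact hl.dist_le D

/-- A sum below `n` forces both entries below `n`, so both stand for genuine walks that can be
concatenated. -/
theorem Mat.relaxed_trans (h : Mat G P n len w A) {e f g : ℕ}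
    (he : e < P) (hf : f < P) (hg : g < P) :
    Mat G P n len w (HypRAM.relaxed A (e * P + f) (A (e * P + g) + A (g * P + f))) := by
  refine h.relaxed hf fun hlt => ?_
  obtain ⟨h1, h2, h3, h4⟩ := h.sound e he g hg (by omega)
  obtain ⟨h5, h6, h7, h8⟩ := h.sound g hg f hf (by omega)
  refine ⟨h1, h6, h3.trans h7, ?_⟩
  obtain ⟨p, hp⟩ := h3.exists_walk_length_eq_dist
  obtain ⟨q, hq⟩ := h7.exists_walk_length_eq_dist
  have := G.dist_le (p.append q)
  rw [SimpleGraph.Walk.length_append] at this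
  omega

/-- Distances up to `r` are known. -/
def Known (G : SimpleGraph V) (P : ℕ) (len : ℕ → ℕ) (home : V → ℕ) (r : ℕ) (A : ℕ → ℕ) : Prop :=
  ∀ x y, len (home x) = 0 → len (home y) = 0 → G.Reachable x y → G.dist x y ≤ r →
    A (home x * P + home y) ≤ G.dist x y

/-- All links have been used. -/
def Linked (G : SimpleGraph V) (P : ℕ) (len : ℕ → ℕ) (w : ℕ → ℕ → V) (home : V → ℕ) (A : ℕ → ℕ) :
    Prop :=
  ∀ x y l, Link G P len w home x y l → A (home x * P + home y) ≤ l

/-- Pieces of length zero are links as well, and they provide the zeros on the diagonal. -/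
theorem Linked.known (D : Dec G P len w home pos) (h : Linked G P len w home A) :
    Known G P len home 0 A := by
  intro x y hx _ hr hd
  obtain rfl : x = y := by
    by_contra hne
    exact (hr.pos_dist_of_ne hne).ne' (by omega)
  have := h _ _ _ (Link.piece (D.home_lt x))
  rw [hx, D.w_zero hx] at this
  omega

/-- Split off the last link from `z` to `y`: it has positive length, so the distance from `x` to `z`
is already known, and the relaxation through `z` adds the link. -/
theorem Known.succ (D : Dec G P len w home pos) (hl : Linked G P len w home A) {r : ℕ} (h : Known G P len home r A)
    {A' : ℕ → ℕ} (hA : A' ≤ A)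
    (ht : ∀ e < P, ∀ f < P, ∀ g < P, A' (e * P + f) ≤ A (e * P + g) + A (g * P + f)) :
    Known G P len home (r + 1) A' := by
  intro x y hx hy hr hd
  by_cases hxy : x = y
  · subst hxy
    exact (hA _).trans (h x x hx hx (.refl _) (by simp))
  · obtain ⟨z, l, hzl, hxz, hdz, hl0⟩ := D.exists_link hx hy hr hxy
    have h1 := h x z hx (hzl.special D).1 hxz (by omega)
    have h2 := hl _ _ _ hzl
    have h3 := ht _ (D.home_lt x) _ (D.home_lt y) _ (D.home_lt z)
    omega

theorem Mat.isMat (D : Dec G P len w home pos) (h : Mat G P n len w A) (hk : Known G P len home n A)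
    (hn : ∀ x y, G.dist x y < n) : IsMat G n len home fun e f => A (e * P + f) := by
  have hs : ∀ x y, len (home x) = 0 → len (home y) = 0 → A (home x * P + home y) < n →
      G.Reachable x y ∧ G.dist x y ≤ A (home x * P + home y) := by
    intro x y hx hy hlt
    have := h.sound _ (D.home_lt x) _ (D.home_lt y) hlt
    rw [D.w_zero hx, D.w_zero hy] at this
    exact this.2.2
  constructor
  · intro x y hx hy hr
    have h1 := hk x y hx hy hr (hn x y).le
    have h2 := hn x y
    exact le_antisymm h1 (hs x y hx hy (by omega)).2
  · intro x y hx hy hr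
    by_contra! hlt
    exact hr (hs x y hx hy hlt).1

end

end HypRAM
namespace HypRAM

/-! ### Computing the distances between special vertices -/

def homeE (e : Ex) : Ex := .rd 1 e - 1
def wE (e f : Ex) : Ex := .rd 5 (.rd 3 e + f)
def minE (e f : Ex) : Ex := e - (e - f)
def modE (e f : Ex) : Ex := e - e / f * f

@[simp] theorem eval_minE (e f : Ex) (σ : HS) : (minE e f).eval σ = min (e.eval σ) (f.eval σ) := by
  simp only [minE, Ex.eval_sub]; omega
@[simp] theorem eval_modE (e f : Ex) (σ : HS) : (modE e f).eval σ = e.eval σ % f.eval σ := by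
  simp only [modE, Ex.eval_sub, Ex.eval_mul, Ex.eval_div]
  rw [Nat.mod_eq_sub, mul_comm]
@[simp] theorem eval_homeE (e : Ex) (σ : HS) : (homeE e).eval σ = σ.a 1 (e.eval σ) - 1 := rfl
@[simp] theorem eval_wE (e f : Ex) (σ : HS) :
    (wE e f).eval σ = σ.a 5 (σ.a 3 (e.eval σ) + f.eval σ) := rfl

open Ex (v rd)

/-- Decrease entry `e` of the matrix to `d`. -/
def relaxStmt (e d : Ex) : Stmt := .wr 6 e (minE (rd 6 e) d)

theorem update_min (A : ℕ → ℕ) (i d : ℕ) : Function.update A i (min (A i) d) = relaxed A i d := rfl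

def clearMat : Stmt := .rep 5 (v 3 * v 3) (.wr 6 (v 5) (v 1))

def linkPieces : Stmt := .rep 5 (v 3) (.seq (.asg 6 (homeE (wE (v 5) 0)))
  (.seq (.asg 7 (homeE (wE (v 5) (rd 4 (v 5)))))
  (.seq (relaxStmt (v 6 * v 3 + v 7) (rd 4 (v 5))) (relaxStmt (v 7 * v 3 + v 6) (rd 4 (v 5))))))

def linkEdges : Stmt := .rep 5 (v 1) (.rep 6 (dgE (v 5))
  (.ite (rd 4 (homeE (v 5)) + rd 4 (homeE (nbrE (v 5) (v 6)))) 1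
    (relaxStmt (homeE (v 5) * v 3 + homeE (nbrE (v 5) (v 6))) 1) .skip))

/-- One round of relaxations; the loop variable encodes two pieces and an intermediate one. -/
def closeRound : Stmt := .rep 6 (v 3 * v 3 * v 3) (relaxStmt (v 6 / v 3 / v 3 * v 3 + modE (v 6 / v 3) (v 3))
  (rd 6 (v 6 / v 3 / v 3 * v 3 + modE (v 6) (v 3)) +
    rd 6 (modE (v 6) (v 3) * v 3 + modE (v 6 / v 3) (v 3))))

def closeMat : Stmt := .rep 5 (v 1) closeRound

section

variable {n : ℕ} {G : SimpleGraph (Fin n)} [DecidableRel G.Adj] {I : ℕ → ℕ} {E X : ℕ} {σ : HS}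

/-- The piece of a vertex. -/
def homeS (σ : HS) (x : Fin n) : ℕ := σ.a 1 x - 1
/-- The position of a vertex. -/
def posS (σ : HS) (x : Fin n) : ℕ := σ.a 2 x
/-- The vertices of the pieces. -/
def vertS [NeZero n] (σ : HS) (e j : ℕ) : Fin n := Fin.ofNat n (σ.a 5 (σ.a 3 e + j))

/-- The decomposition has been computed. -/
structure Ready (G : SimpleGraph (Fin n)) [DecidableRel G.Adj] (σ : HS) : Prop where
  grRep : GrRep G (σ.a 0)
  size : σ.v 1 = n
  done : Done G σ

theorem Ready.congr (h : Ready G σ) {σ' : HS} (h1 : σ'.v 1 = σ.v 1) (h3 : σ'.v 3 = σ.v 3)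
    (h4 : σ'.v 4 = σ.v 4) (ha : ∀ t : Fin 16, (t : ℕ) < 6 → σ'.a t = σ.a t) : Ready G σ' := by
  obtain ⟨hg, hs, ⟨hp, hm, ht⟩⟩ := h
  refine ⟨by rwa [ha 0 (by decide)], by rw [h1, hs], ⟨?_, ?_, ?_⟩⟩
  · rw [PState, h3, h4, ha 1 (by decide), ha 2 (by decide), ha 3 (by decide), ha 4 (by decide),
      ha 5 (by decide)]
    exact hp
  · rwa [ha 1 (by decide)]
  · rwa [ha 0 (by decide), ha 1 (by decide), ha 4 (by decide)]

theorem Ready.tight (h : Ready G σ) : TightSpecials G (σ.a 4) (homeS σ) := by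
  intro x hl hd y hy
  rw [← h.grRep.degree] at hd ⊢
  exact h.done.tight x x.2 hd hl y ⟨x.2, y.2, hy⟩

theorem Ready.pieces_le (h : Ready G σ) : σ.v 3 ≤ n := h.done.part.pieces_le

variable [NeZero n]

theorem Ready.dec (h : Ready G σ) : Dec G (σ.v 3) (σ.a 4) (vertS σ) (homeS σ) (posS σ) :=
  h.done.part.dec h.done.marked

theorem Ready.vert_val (h : Ready G σ) {e j : ℕ} (he : e < σ.v 3) (hj : j ≤ σ.a 4 e) :
    ((vertS σ e j : Fin n) : ℕ) = σ.a 5 (σ.a 3 e + j) :=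
  Nat.mod_eq_of_lt (h.done.part.w_lt e he j hj).1

omit [DecidableRel G.Adj] in
theorem clearMat_spec (hX : n * n ≤ X) (hn : σ.v 1 = n) (hP : σ.v 3 ≤ n) (h6 : σ.a 6 = fun _ => 0) :
    Tr I E X clearMat σ fun σ' t =>
      Mat G (σ.v 3) n (σ.a 4) (vertS σ) (σ'.a 6) ∧ t ≤ 2 * (σ.v 3 * σ.v 3) + 1 := by
  have hPP : σ.v 3 * σ.v 3 ≤ n * n := Nat.mul_le_mul hP hP
  have hnX : n ≤ X := (Nat.le_mul_self n).trans hX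
  refine Tr.rep_le (fun j σ' => (∀ i, σ'.a 6 i ≤ n) ∧ ∀ i < j, σ'.a 6 i = n) 1 ?_ ?_ ?_ ?_
  · simp; omega
  · simp [h6]
  · rintro j hj σ' hF ⟨h1, h2⟩
    have e1 : σ'.v 1 = n := by rw [hF.1 1 (by decide), hn]
    rw [Tr.wr]
    simp only [Ex.eval_v, HS.sv_v, HS.sa_a, HS.sv_a, if_true, (by decide : ¬ (1 = 5)), if_false, e1,
      Function.update_apply]
    refine ⟨hnX, ⟨?_, ?_⟩, le_rfl⟩
    · intro i; split_ifs
      exacts [le_rfl, h1 i]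
    · intro i hi; split_ifs
      exacts [rfl, h2 i (by omega)]
  · rintro σ' t hF ⟨h1, h2⟩ ht
    simp only [Ex.eval_mul, Ex.eval_v] at h2 ht
    refine ⟨⟨h1, ?_⟩, by omega⟩
    intro e he f hf hlt
    have : e * σ.v 3 + f < σ.v 3 * σ.v 3 :=
      calc e * σ.v 3 + f < (e + 1) * σ.v 3 := by rw [Nat.add_mul]; omega
        _ ≤ _ := Nat.mul_le_mul_right _ he
    rw [h2 _ this] at hlt
    omega

theorem linkPieces_spec (hX : n ≤ X) (h : Ready G σ)
    (hm : Mat G (σ.v 3) n (σ.a 4) (vertS σ) (σ.a 6)) :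
    Tr I E X linkPieces σ fun σ' t => Mat G (σ.v 3) n (σ.a 4) (vertS σ) (σ'.a 6) ∧
      (∀ e < σ.v 3, ∀ x y : Fin n, x = vertS σ e 0 → y = vertS σ e (σ.a 4 e) →
        σ'.a 6 (homeS σ x * σ.v 3 + homeS σ y) ≤ σ.a 4 e ∧
        σ'.a 6 (homeS σ y * σ.v 3 + homeS σ x) ≤ σ.a 4 e) ∧ t ≤ 5 * n + 1 := by
  have hP := h.pieces_le
  have D := h.dec
  refine Tr.rep_le (fun j σ' => Mat G (σ.v 3) n (σ.a 4) (vertS σ) (σ'.a 6) ∧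
    (∀ e < j, ∀ x y : Fin n, x = vertS σ e 0 → y = vertS σ e (σ.a 4 e) →
        σ'.a 6 (homeS σ x * σ.v 3 + homeS σ y) ≤ σ.a 4 e ∧
        σ'.a 6 (homeS σ y * σ.v 3 + homeS σ x) ≤ σ.a 4 e)) 4 ?_ ⟨hm, by omega⟩ ?_ ?_
  · simp only [Ex.eval_v]; omega
  · rintro j hj σ' hF ⟨hM, hl⟩
    simp only [Ex.eval_v] at hj
    have e1 : σ'.a 1 = σ.a 1 := hF.2 1 (by decide)
    have e3 : σ'.a 3 = σ.a 3 := hF.2 3 (by decide)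
    have e4 : σ'.a 4 = σ.a 4 := hF.2 4 (by decide)
    have e5 : σ'.a 5 = σ.a 5 := hF.2 5 (by decide)
    have v3 : σ'.v 3 = σ.v 3 := hF.1 3 (by decide)
    set p : Fin n := vertS σ j 0 with hp
    set q : Fin n := vertS σ j (σ.a 4 j) with hq
    have ep : σ.a 1 (σ.a 5 (σ.a 3 j + 0)) - 1 = homeS σ p := by
      rw [homeS, hp, h.vert_val hj (Nat.zero_le _)]
    have eq : σ.a 1 (σ.a 5 (σ.a 3 j + σ.a 4 j)) - 1 = homeS σ q := by
      rw [homeS, hq, h.vert_val hj le_rfl]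
    have hhp : homeS σ p < σ.v 3 := D.home_lt p
    have hhq : homeS σ q < σ.v 3 := D.home_lt q
    have hM1 := hM.relaxed_link D (.piece hj)
    have hM2 := hM1.relaxed_link D (.piece' hj)
    rw [← hp, ← hq] at hM1 hM2
    have l1 := hM1.le (homeS σ q * σ.v 3 + homeS σ p)
    have l0 := hM.le (homeS σ p * σ.v 3 + homeS σ q)
    have r1 := relaxed_le (σ'.a 6) (homeS σ p * σ.v 3 + homeS σ q) (σ.a 4 j)
    have r2 := relaxed_le (relaxed (σ'.a 6) (homeS σ p * σ.v 3 + homeS σ q) (σ.a 4 j))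
      (homeS σ q * σ.v 3 + homeS σ p) (σ.a 4 j)
    have s1 := relaxed_self_le (σ'.a 6) (homeS σ p * σ.v 3 + homeS σ q) (σ.a 4 j)
    have s2 := relaxed_self_le (relaxed (σ'.a 6) (homeS σ p * σ.v 3 + homeS σ q) (σ.a 4 j))
      (homeS σ q * σ.v 3 + homeS σ p) (σ.a 4 j)
    simp only [Tr.seq, Tr.asg, relaxStmt, Tr.wr, eval_homeE, eval_wE, eval_minE, Ex.eval_rd,
      Ex.eval_add, Ex.eval_mul, Ex.eval_v, Ex.eval_ofNat, HS.sv_v, HS.sv_a, HS.sa_v, HS.sa_a, e1, e3,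
      e4, e5, v3, ep, eq, update_min, if_true, if_false, (by decide : ¬ (5 = 6)), (by decide : ¬ (5 = 7)),
      (by decide : ¬ (6 = 7)), (by decide : ¬ (3 = 6)), (by decide : ¬ (3 = 5)), (by decide : ¬ (3 = 7)),
      (by decide : ¬ ((4 : Fin 16) = 6))]
    refine ⟨by omega, by omega, by omega, by omega, ⟨hM2, ?_⟩, by omega⟩
    rintro e he x y rfl rfl
    rcases Nat.lt_succ_iff_lt_or_eq.1 he with he | rfl
    · obtain ⟨h1, h2⟩ := hl e he _ _ rfl rfl
      exact ⟨((r2 _).trans (r1 _)).trans h1, ((r2 _).trans (r1 _)).trans h2⟩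
    · exact ⟨(r2 _).trans s1, s2⟩
  · rintro σ' t hF ⟨h1, h2⟩ ht
    simp only [Ex.eval_v] at h2 ht
    exact ⟨h1, h2, by omega⟩

theorem linkNbrs_spec (hX : n ≤ X) (h : Ready G σ) (x : Fin n) (hx : σ.v 5 = x)
    (hm : Mat G (σ.v 3) n (σ.a 4) (vertS σ) (σ.a 6)) :
    Tr I E X (.rep 6 (dgE (v 5))
      (.ite (rd 4 (homeE (v 5)) + rd 4 (homeE (nbrE (v 5) (v 6)))) 1
      (relaxStmt (homeE (v 5) * v 3 + homeE (nbrE (v 5) (v 6))) 1) .skip)) σ fun σ' t =>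
      Mat G (σ.v 3) n (σ.a 4) (vertS σ) (σ'.a 6) ∧ σ'.a 6 ≤ σ.a 6 ∧
      (∀ y : Fin n, G.Adj x y → σ.a 4 (homeS σ x) = 0 → σ.a 4 (homeS σ y) = 0 →
        σ'.a 6 (homeS σ x * σ.v 3 + homeS σ y) ≤ 1) ∧ t ≤ 3 * dgA (σ.a 0) x + 1 := by
  have D := h.dec
  have hg := h.grRep
  refine Tr.rep_le (fun j σ' => Mat G (σ.v 3) n (σ.a 4) (vertS σ) (σ'.a 6) ∧ σ'.a 6 ≤ σ.a 6 ∧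
      (∀ i < j, ∀ y : Fin n, nbrA (σ.a 0) x i = y → σ.a 4 (homeS σ x) = 0 → σ.a 4 (homeS σ y) = 0 →
        σ'.a 6 (homeS σ x * σ.v 3 + homeS σ y) ≤ 1)) 2 ?_ ⟨hm, le_rfl, by omega⟩ ?_ ?_
  · have := hg.dgA_lt x.2
    simp only [eval_dgE, Ex.eval_v, hx]; omega
  · rintro j hj σ' hF ⟨hM, hle, hl⟩
    simp only [eval_dgE, Ex.eval_v, hx] at hj
    have e0 : σ'.a 0 = σ.a 0 := hF.2 0 (by decide)
    have e1 : σ'.a 1 = σ.a 1 := hF.2 1 (by decide)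
    have e4 : σ'.a 4 = σ.a 4 := hF.2 4 (by decide)
    have v3 : σ'.v 3 = σ.v 3 := hF.1 3 (by decide)
    have v5 : σ'.v 5 = x := by rw [hF.1 5 (by decide), hx]
    obtain ⟨_, hyn, hadj⟩ := (hg.adj_iff x x.2 _).2 ⟨j, hj, rfl⟩
    obtain ⟨y, hy⟩ : ∃ y : Fin n, nbrA (σ.a 0) x j = y := ⟨⟨_, hyn⟩, rfl⟩
    replace hadj : G.Adj x y := by
      convert hadj using 1; exact Fin.ext hy.symm
    have ex : σ.a 1 x - 1 = homeS σ x := rfl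
    have ey : σ.a 1 y - 1 = homeS σ y := rfl
    simp only [Tr.ite, Tr.skip, relaxStmt, Tr.wr, eval_homeE, eval_nbrE, eval_minE, Ex.eval_rd,
      Ex.eval_add, Ex.eval_mul, Ex.eval_v, Ex.eval_ofNat, HS.sv_v, HS.sv_a, HS.sa_a, e0, e1,
      e4, v3, v5, hy, ex, ey, update_min, if_true, if_false, (by decide : ¬ (5 = 6)),
      (by decide : ¬ (3 = 6))]
    constructor
    · intro hlt
      have l0 := hM.le (homeS σ x * σ.v 3 + homeS σ y)
      have r1 := relaxed_le (σ'.a 6) (homeS σ x * σ.v 3 + homeS σ y) 1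
      refine ⟨by omega, ⟨hM.relaxed_link D (.adj (by omega) (by omega) hadj), r1.trans hle, ?_⟩,
        by omega⟩
      intro i hi z hz h1 h2
      rcases Nat.lt_succ_iff_lt_or_eq.1 hi with hi | rfl
      · exact (r1 _).trans (hl i hi z hz h1 h2)
      · obtain rfl : z = y := Fin.ext (hz.symm.trans hy)
        exact relaxed_self_le _ _ _
    · intro hlt
      refine ⟨⟨hM, hle, ?_⟩, by omega⟩
      intro i hi z hz h1 h2
      rcases Nat.lt_succ_iff_lt_or_eq.1 hi with hi | rfl
      · exact hl i hi z hz h1 h2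
      · obtain rfl : z = y := Fin.ext (hz.symm.trans hy)
        omega
  · rintro σ' t hF ⟨h1, h2, h3⟩ ht
    simp only [eval_dgE, Ex.eval_v, hx] at h3 ht
    refine ⟨h1, h2, fun y hy => ?_, by omega⟩
    obtain ⟨i, hi, hi'⟩ := (hg.adj_iff x x.2 y).1 ⟨x.2, y.2, hy⟩
    exact h3 i hi y hi'

theorem linkEdges_spec (hX : n ≤ X) (h : Ready G σ)
    (hm : Mat G (σ.v 3) n (σ.a 4) (vertS σ) (σ.a 6)) :
    Tr I E X linkEdges σ fun σ' t =>
      Mat G (σ.v 3) n (σ.a 4) (vertS σ) (σ'.a 6) ∧ σ'.a 6 ≤ σ.a 6 ∧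
      (∀ x y : Fin n, G.Adj x y → σ.a 4 (homeS σ x) = 0 → σ.a 4 (homeS σ y) = 0 →
        σ'.a 6 (homeS σ x * σ.v 3 + homeS σ y) ≤ 1) ∧ t ≤ 2 * n + 6 * G.edgeFinset.card + 1 := by
  refine Tr.rep (fun j σ' t => Mat G (σ.v 3) n (σ.a 4) (vertS σ) (σ'.a 6) ∧ σ'.a 6 ≤ σ.a 6 ∧
      (∀ x y : Fin n, (x : ℕ) < j → G.Adj x y → σ.a 4 (homeS σ x) = 0 → σ.a 4 (homeS σ y) = 0 →
        σ'.a 6 (homeS σ x * σ.v 3 + homeS σ y) ≤ 1) ∧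
      t ≤ 2 * j + 3 * (∑ v ∈ Finset.range j, dgA (σ.a 0) v)) ?_ ⟨hm, le_rfl, by omega, by simp⟩ ?_ ?_
  · simpa [h.size] using hX
  · rintro j hj σ' t hF ⟨hM, hle, hl, ht⟩
    simp only [Ex.eval_v, h.size] at hj
    have e0 : σ'.a 0 = σ.a 0 := hF.2 0 (by decide)
    have e1 : σ'.a 1 = σ.a 1 := hF.2 1 (by decide)
    have e3 : σ'.a 3 = σ.a 3 := hF.2 3 (by decide)
    have e4 : σ'.a 4 = σ.a 4 := hF.2 4 (by decide)
    have e5 : σ'.a 5 = σ.a 5 := hF.2 5 (by decide)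
    have v3 : σ'.v 3 = σ.v 3 := hF.1 3 (by decide)
    have hr : Ready G (σ'.sv 5 j) := h.congr (by simp [hF.1 1 (by decide)]) (by simp [v3])
      (by simp [hF.1 4 (by decide)]) fun t ht => hF.2 t (by
        have : t ≠ 6 := by rintro rfl; simp at ht
        simpa [Stmt.wa, relaxStmt] using this)
    have ev : (vertS (σ'.sv 5 j) : ℕ → ℕ → Fin n) = vertS σ := by
      funext e i; simp [vertS, e3, e5]
    have eh : (homeS (σ'.sv 5 j) : Fin n → ℕ) = homeS σ := by
      funext x; simp [homeS, e1]
    refine (linkNbrs_spec hX hr ⟨j, hj⟩ (by simp) (by simpa [ev, e4, v3] using hM)).conseq ?_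
    rintro σ'' t' - ⟨hM', hle', hl', ht'⟩
    simp only [HS.sv_v, HS.sv_a, v3, e4, e0, ev, eh, (by decide : ¬ (3 = 5)), if_false] at hM' hle' hl' ht'
    refine ⟨hM', hle'.trans hle, ?_, ?_⟩
    · intro x y hx
      rcases Nat.lt_succ_iff_lt_or_eq.1 hx with hx | rfl
      · exact fun h1 h2 h3 => (hle' _).trans (hl x y hx h1 h2 h3)
      · exact hl' y
    · rw [Finset.sum_range_succ]; omega
  · rintro σ' t hF ⟨h1, h2, h3, ht⟩
    simp only [Ex.eval_v, h.size, h.grRep.sum] at h3 ht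
    exact ⟨h1, h2, fun x y => h3 x y x.2, by omega⟩

/-- The matrix is updated in place, but entries only decrease, so each relaxation is at least as
good as one with the entries before the round. -/
theorem closeRound_spec (hX : n * n * n ≤ X) (h : Ready G σ)
    (hm : Mat G (σ.v 3) n (σ.a 4) (vertS σ) (σ.a 6)) :
    Tr I E X closeRound σ fun σ' t =>
      Mat G (σ.v 3) n (σ.a 4) (vertS σ) (σ'.a 6) ∧ σ'.a 6 ≤ σ.a 6 ∧
      (∀ e < σ.v 3, ∀ f < σ.v 3, ∀ g < σ.v 3, σ'.a 6 (e * σ.v 3 + f) ≤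
        σ.a 6 (e * σ.v 3 + g) + σ.a 6 (g * σ.v 3 + f)) ∧
      t ≤ 2 * (σ.v 3 * σ.v 3 * σ.v 3) + 1 := by
  have hP := h.pieces_le
  have hnX : n ≤ X := by
    refine le_trans ?_ hX
    rw [mul_assoc]; exact Nat.le_mul_of_pos_right _ (Nat.mul_pos (NeZero.pos n) (NeZero.pos n))
  set P := σ.v 3 with hPdef
  refine Tr.rep_le (fun j σ' => Mat G P n (σ.a 4) (vertS σ) (σ'.a 6) ∧ σ'.a 6 ≤ σ.a 6 ∧
      (∀ e < P, ∀ f < P, ∀ g < P, (e * P + f) * P + g < j → σ'.a 6 (e * P + f) ≤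
        σ.a 6 (e * P + g) + σ.a 6 (g * P + f))) 1 ?_ ⟨hm, le_rfl, by omega⟩ ?_ ?_
  · simp only [Ex.eval_mul, Ex.eval_v]
    exact (Nat.mul_le_mul (Nat.mul_le_mul hP hP) hP).trans hX
  · rintro j hj σ' hF ⟨hM, hle, hl⟩
    simp only [Ex.eval_mul, Ex.eval_v, ← hPdef] at hj
    have v3 : σ'.v 3 = P := hF.1 3 (by decide)
    have hP0 : 0 < P := by
      by_contra h0
      obtain h0 : P = 0 := by omega
      simp [h0] at hj
    obtain ⟨e, f, g, he, hf, hg, rfl⟩ : ∃ e f g, e < P ∧ f < P ∧ g < P ∧ j = (e * P + f) * P + g := by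
      refine ⟨j / P / P, j / P % P, j % P, ?_, Nat.mod_lt _ hP0, Nat.mod_lt _ hP0, ?_⟩
      · rw [Nat.div_lt_iff_lt_mul hP0, Nat.div_lt_iff_lt_mul hP0]; exact hj
      · rw [Nat.div_add_mod', Nat.div_add_mod']
    have d1 : ((e * P + f) * P + g) / P = e * P + f := by
      rw [mul_comm, Nat.mul_add_div hP0, Nat.div_eq_of_lt hg, add_zero]
    have d2 : (e * P + f) / P = e := by
      rw [mul_comm, Nat.mul_add_div hP0, Nat.div_eq_of_lt hf, add_zero]
    have m1 : ((e * P + f) * P + g) % P = g := by rw [Nat.mul_add_mod', Nat.mod_eq_of_lt hg]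
    have m2 : (e * P + f) % P = f := by rw [Nat.mul_add_mod', Nat.mod_eq_of_lt hf]
    simp only [relaxStmt, Tr.wr, eval_minE, eval_modE, Ex.eval_rd, Ex.eval_div,
      Ex.eval_add, Ex.eval_mul, Ex.eval_v, HS.sv_v, HS.sv_a, HS.sa_a, v3, update_min, if_true, if_false,
      (by decide : ¬ (3 = 6)), d1, d2, m1, m2]
    have l0 := hM.le (e * P + f)
    have r1 := relaxed_le (σ'.a 6) (e * P + f) (σ'.a 6 (e * P + g) + σ'.a 6 (g * P + f))
    refine ⟨by omega, ⟨hM.relaxed_trans he hf hg, r1.trans hle, ?_⟩, by omega⟩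
    intro e' he' f' hf' g' hg' hlt
    rcases Nat.lt_succ_iff_lt_or_eq.1 hlt with hlt | heq
    · exact (r1 _).trans (hl _ he' _ hf' _ hg' hlt)
    · obtain ⟨h1, rfl⟩ := index_inj hg' hg heq
      obtain ⟨rfl, rfl⟩ := index_inj hf' hf h1
      exact (relaxed_self_le _ _ _).trans (Nat.add_le_add (hle _) (hle _))
  · rintro σ' t hF ⟨h1, h2, h3⟩ ht
    simp only [Ex.eval_mul, Ex.eval_v, ← hPdef] at h3 ht
    refine ⟨h1, h2, fun e he f hf g hg => h3 e he f hf g hg ?_, by omega⟩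
    have a1 : e * P + f + 1 ≤ P * P := by
      have := Nat.mul_le_mul_right P (Nat.succ_le_of_lt he)
      rw [Nat.succ_mul] at this; omega
    have := Nat.mul_le_mul_right P a1
    rw [Nat.add_mul, one_mul] at this
    omega

/-- Fill the matrix. -/
def fillMat : Stmt := .seq clearMat (.seq linkPieces (.seq linkEdges closeMat))

/-- Each round extends the radius of known distances by one, and all finite distances are below `n`.
-/
theorem closeMat_spec (hX : n * n * n ≤ X) (h : Ready G σ)
    (hm : Mat G (σ.v 3) n (σ.a 4) (vertS σ) (σ.a 6))
    (hl : Linked G (σ.v 3) (σ.a 4) (vertS σ) (homeS σ) (σ.a 6)) :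
    Tr I E X closeMat σ fun σ' t =>
      Mat G (σ.v 3) n (σ.a 4) (vertS σ) (σ'.a 6) ∧ Known G (σ.v 3) (σ.a 4) (homeS σ) n (σ'.a 6) ∧
      t ≤ n * (2 * (σ.v 3 * σ.v 3 * σ.v 3) + 2) + 1 := by
  have hnX : n ≤ X := by
    refine le_trans ?_ hX
    rw [mul_assoc]; exact Nat.le_mul_of_pos_right _ (Nat.mul_pos (NeZero.pos n) (NeZero.pos n))
  refine Tr.rep_le (fun j σ' => Mat G (σ.v 3) n (σ.a 4) (vertS σ) (σ'.a 6) ∧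
      Linked G (σ.v 3) (σ.a 4) (vertS σ) (homeS σ) (σ'.a 6) ∧
      Known G (σ.v 3) (σ.a 4) (homeS σ) j (σ'.a 6)) (2 * (σ.v 3 * σ.v 3 * σ.v 3) + 1) ?_
      ⟨hm, hl, hl.known h.dec⟩ ?_ ?_
  · simpa [h.size] using hnX
  · rintro j hj σ' hF ⟨hM, hL, hK⟩
    have e1 : σ'.a 1 = σ.a 1 := hF.2 1 (by decide)
    have e3 : σ'.a 3 = σ.a 3 := hF.2 3 (by decide)
    have e4 : σ'.a 4 = σ.a 4 := hF.2 4 (by decide)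
    have e5 : σ'.a 5 = σ.a 5 := hF.2 5 (by decide)
    have v3 : σ'.v 3 = σ.v 3 := hF.1 3 (by decide)
    have hr : Ready G (σ'.sv 5 j) := h.congr (by simp [hF.1 1 (by decide)]) (by simp [v3])
      (by simp [hF.1 4 (by decide)]) fun t ht => hF.2 t (by
        have : t ≠ 6 := by rintro rfl; simp at ht
        simpa [Stmt.wa, relaxStmt, closeRound] using this)
    have ev : (vertS (σ'.sv 5 j) : ℕ → ℕ → Fin n) = vertS σ := by
      funext e i; simp [vertS, e3, e5]
    refine (closeRound_spec hX hr (by simpa [ev, e4, v3] using hM)).conseq ?_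
    rintro σ'' t' - ⟨hM', hle', ht', hc⟩
    simp only [HS.sv_v, HS.sv_a, v3, e4, ev, (by decide : ¬ (3 = 5)), if_false] at hM' hle' ht' hc
    exact ⟨⟨hM', fun x y l h => (hle' _).trans (hL x y l h), hK.succ h.dec hL hle' ht'⟩, hc⟩
  · rintro σ' t hF ⟨h1, h2, h3⟩ ht
    simp only [Ex.eval_v, h.size] at h3 ht
    exact ⟨h1, h3, ht⟩

theorem dist_lt (G : SimpleGraph (Fin n)) (x y : Fin n) : G.dist x y < n := by
  by_cases h : G.Reachable x y
  · obtain ⟨p, hp, hl⟩ := h.exists_path_of_dist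
    have := hp.length_lt
    rw [Fintype.card_fin] at this
    omega
  · rw [SimpleGraph.dist_eq_zero_of_not_reachable h]
    exact NeZero.pos n

theorem Fr.ready {s : Stmt} {σ' : HS} (hF : Fr s σ σ') (h : Ready G σ) (h1 : 1 ∉ s.wv) (h3 : 3 ∉ s.wv)
    (h4 : 4 ∉ s.wv) (ha : ∀ t ∈ s.wa, 6 ≤ (t : ℕ)) :
    Ready G σ' ∧ σ'.v 3 = σ.v 3 ∧ σ'.a 4 = σ.a 4 ∧ (vertS σ' : ℕ → ℕ → Fin n) = vertS σ ∧
      (homeS σ' : Fin n → ℕ) = homeS σ ∧ (posS σ' : Fin n → ℕ) = posS σ := by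
  have hA : ∀ t : Fin 16, (t : ℕ) < 6 → σ'.a t = σ.a t := fun t ht => hF.2 t fun h => by
    have := ha t h; omega
  refine ⟨h.congr (hF.1 1 h1) (hF.1 3 h3) (hF.1 4 h4) hA, hF.1 3 h3, hA 4 (by decide), ?_, ?_, ?_⟩
  · funext e i; simp [vertS, hA 3 (by decide), hA 5 (by decide)]
  · funext x; simp [homeS, hA 1 (by decide)]
  · funext x; simp [posS, hA 2 (by decide)]

theorem fillMat_spec (hX : n * n * n ≤ X) (h : Ready G σ) (h6 : σ.a 6 = fun _ => 0) :
    Tr I E X fillMat σ fun σ' t =>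
      IsMat G n (σ.a 4) (homeS σ) (fun e f => σ'.a 6 (e * σ.v 3 + f)) ∧
      t ≤ 2 * (σ.v 3 * σ.v 3) + 9 * n + 6 * G.edgeFinset.card +
        n * (2 * (σ.v 3 * σ.v 3 * σ.v 3)) + 4 := by
  have hn0 := NeZero.pos n
  have hnn : n * n ≤ X := (Nat.le_mul_of_pos_right _ hn0).trans hX
  have hnX : n ≤ X := (Nat.le_mul_self n).trans hnn
  rw [fillMat, Tr.seq]
  refine (clearMat_spec (G := G) hnn h.size h.pieces_le h6).conseq ?_
  rintro σ₁ t₁ hF ⟨hM, ht₁⟩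
  obtain ⟨hr, v3, e4, ev, eh, ep⟩ := hF.ready h (by decide) (by decide) (by decide) (by decide)
  clear hF
  rw [Tr.seq]
  rw [← v3, ← e4, ← ev] at hM
  refine (linkPieces_spec hnX hr hM).conseq ?_
  rintro σ₂ t₂ hF ⟨hM, hl, ht₂⟩
  obtain ⟨hr', v3', e4', ev', eh', ep'⟩ := hF.ready hr (by decide) (by decide) (by decide) (by decide)
  clear hF
  rw [Tr.seq]
  rw [← v3', ← e4', ← ev'] at hM
  refine (linkEdges_spec hnX hr' hM).conseq ?_
  rintro σ₃ t₃ hF ⟨hM, hle, hl', ht₃⟩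
  obtain ⟨hr'', v3'', e4'', ev'', eh'', ep''⟩ :=
    hF.ready hr' (by decide) (by decide) (by decide) (by decide)
  clear hF
  rw [← v3'', ← e4'', ← ev''] at hM
  refine (closeMat_spec hX hr'' hM ?_).conseq ?_
  · rw [v3'', e4'', ev'', eh'']
    intro x y l hL
    cases hL with
    | adj hx hy h => exact hl' _ _ h hx hy
    | piece he =>
      rw [v3'] at he
      rw [v3', ev', e4', eh']
      exact (hle _).trans (hl _ he _ _ rfl rfl).1
    | piece' he =>
      rw [v3'] at he
      rw [v3', ev', e4', eh']
      exact (hle _).trans (hl _ he _ _ rfl rfl).2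
  · rintro σ₄ t₄ - ⟨hM, hK, ht₄⟩
    have v : σ₃.v 3 = σ.v 3 := by rw [v3'', v3', v3]
    have e : σ₃.a 4 = σ.a 4 := by rw [e4'', e4', e4]
    have w : (vertS σ₃ : ℕ → ℕ → Fin n) = vertS σ := by rw [ev'', ev', ev]
    have i : (homeS σ₃ : Fin n → ℕ) = homeS σ := by rw [eh'', eh', eh]
    rw [v, e, w] at hM
    rw [v, e, i] at hK
    rw [v] at ht₄
    refine ⟨hM.isMat h.dec hK (dist_lt G), ?_⟩
    rw [Nat.mul_add] at ht₄
    omega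

end

end HypRAM
namespace HypRAM

/-! ### The table of critical vertices and the search -/

def distE (x y : Ex) : Ex :=
  let e := homeE x
  let f := homeE y
  let p := homeE (wE e 0)
  let q := homeE (wE e (.rd 4 e))
  let r := homeE (wE f 0)
  let s := homeE (wE f (.rd 4 f))
  let M : Ex → Ex → Ex := fun e f => .rd 6 (e * .v 3 + f)
  minE (minE (minE (.rd 2 x + (M p r + .rd 2 y)) (.rd 2 x + (M p s + (.rd 4 f - .rd 2 y))))
    (minE ((.rd 4 e - .rd 2 x) + (M q r + .rd 2 y)) ((.rd 4 e - .rd 2 x) + (M q s + (.rd 4 f - .rd 2 y)))))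
    (neE (.rd 2 x) (.rd 2 y) + .v 1 * neE e f)

def candE (α β L i : Ex) : ℕ → Ex
  | 0 => 0
  | 1 => i
  | 2 => i + 1
  | 3 => i - 1
  | 4 => (β + L - α) / 2
  | 5 => (β + L - α) / 2 + 1
  | 6 => (β + L + i) / 2
  | 7 => (β + L + i) / 2 + 1
  | 8 => (i - α) / 2
  | _ => (i - α) / 2 + 1

@[simp] theorem eval_candE (α β L i : Ex) (r : ℕ) (σ : HS) : (candE α β L i r).eval σ =
    candPos (α.eval σ) (β.eval σ) (L.eval σ) (i.eval σ) r := by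
  rcases r with _ | _ | _ | _ | _ | _ | _ | _ | _ | _ <;> rfl

open Ex (v rd)

/-- The first `k` candidates for vertex `x` on piece `g`. -/
def writeCands (x g : Ex) : ℕ → Stmt
  | 0 => .skip
  | k + 1 => .seq (writeCands x g k) (.wr 7 (v 5 * 10 + .c k) (wE g (minE (rd 4 g)
      (candE (distE x (wE g 0)) (distE x (wE g (rd 4 g))) (rd 4 g) (rd 2 x) k))))

def fillTable : Stmt := .rep 5 (v 1 * v 3) (writeCands (v 5 / v 3) (modE (v 5) (v 3)) 10)

def maxE (e f : Ex) : Ex := e + (f - e)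

@[simp] theorem eval_maxE (e f : Ex) (σ : HS) : (maxE e f).eval σ = max (e.eval σ) (f.eval σ) := by
  simp only [maxE, Ex.eval_sub, Ex.eval_add]; omega

/-- Test the quadruple in the variables 10, 11, 6, 7. -/
def testQuad : Stmt :=
  .ite (distE (v 10) (v 11)) (v 1) (.ite (distE (v 10) (v 6)) (v 1) (.ite (distE (v 10) (v 7)) (v 1)
    (.ite (maxE (distE (v 10) (v 6) + distE (v 11) (v 7)) (distE (v 10) (v 7) + distE (v 11) (v 6)) + rd 0 1)
      (distE (v 10) (v 11) + distE (v 6) (v 7)) (.asg 0 0) .skip) .skip) .skip) .skip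

/-- Decode the loop variable of the search into a vertex and four table entries, and test. -/
def searchBody (K : Ex) : Stmt :=
  .seq (.asg 6 (v 5 / K / K / K / K)) (.seq (.asg 7 (rd 7 (v 6 * K + modE (v 5 / K / K / K) K)))
  (.seq (.asg 8 (rd 7 (v 6 * K + modE (v 5 / K / K) K)))
  (.seq (.asg 10 (rd 7 (v 8 * K + modE (v 5 / K) K)))
  (.seq (.asg 11 (rd 7 (v 10 * K + modE (v 5) K))) testQuad))))

def search : Stmt :=
  let K : Ex := v 3 * 10
  .seq (.asg 0 1) (.rep 5 (v 1 * K * K * K * K) (searchBody K))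

section

variable {n : ℕ} {G : SimpleGraph (Fin n)} [DecidableRel G.Adj] {I : ℕ → ℕ} {E X : ℕ} {σ : HS}
  [NeZero n]

/-- The distance that is computed in a state. -/
def distS (σ : HS) (x y : Fin n) : ℕ :=
  dhat n (σ.a 4) (vertS σ) (homeS σ) (posS σ) (fun e f => σ.a 6 (e * σ.v 3 + f)) x y

theorem Ready.eval_distE (h : Ready G σ) {e f : Ex} {x y : Fin n} (hx : e.eval σ = x)
    (hy : f.eval σ = y) : (distE e f).eval σ = distS σ x y := by
  have D := h.dec
  have h1 : ∀ x : Fin n, σ.a 1 x - 1 = homeS σ x := fun _ => rfl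
  have h2 : ∀ x : Fin n, σ.a 2 x = posS σ x := fun _ => rfl
  have e1 := h.vert_val (D.home_lt x) (Nat.zero_le _)
  have e2 := h.vert_val (D.home_lt x) le_rfl
  have e3 := h.vert_val (D.home_lt y) (Nat.zero_le _)
  have e4 := h.vert_val (D.home_lt y) le_rfl
  simp only [distE, eval_minE, eval_homeE, eval_wE, eval_neE, Ex.eval_add, Ex.eval_sub, Ex.eval_mul,
    Ex.eval_rd, Ex.eval_v, Ex.eval_ofNat, hx, hy, h1, h2, ← e1, ← e2, ← e3, ← e4, h.size]
  rfl

/-- The candidate with the number `r` for vertex `x` on piece `g`. -/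
def candS (σ : HS) (x : Fin n) (g r : ℕ) : Fin n :=
  vertS σ g (min (σ.a 4 g) (candPos (distS σ x (vertS σ g 0)) (distS σ x (vertS σ g (σ.a 4 g)))
    (σ.a 4 g) (posS σ x) r))

theorem distS_congr {σ' : HS} (h3 : σ'.v 3 = σ.v 3) (h4 : σ'.a 4 = σ.a 4)
    (hv : (vertS σ' : ℕ → ℕ → Fin n) = vertS σ) (hh : (homeS σ' : Fin n → ℕ) = homeS σ)
    (hp : (posS σ' : Fin n → ℕ) = posS σ) (h6 : σ'.a 6 = σ.a 6) :
    (distS σ' : Fin n → Fin n → ℕ) = distS σ := by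
  funext x y; simp only [distS, h3, h4, hv, hh, hp, h6]

theorem wv_writeCands (e g : Ex) (k : ℕ) : (writeCands e g k).wv = [] ∧ ∀ t ∈ (writeCands e g k).wa, t = 7 := by
  induction k with
  | zero => simp [writeCands, Stmt.wv, Stmt.wa]
  | succ k ih => simpa [writeCands, Stmt.wv, Stmt.wa, or_imp, forall_and] using ih

theorem writeCands_spec (hX : n ≤ X) (h : Ready G σ) {e g : Ex} (x : Fin n) {p : ℕ} (hp : p < σ.v 3)
    (he : ∀ σ' : HS, σ'.v = σ.v → e.eval σ' = x) (hg : ∀ σ' : HS, σ'.v = σ.v → g.eval σ' = p) (k : ℕ) :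
    Tr I E X (writeCands e g k) σ fun σ' t =>
      (∀ r < k, σ'.a 7 (σ.v 5 * 10 + r) = candS σ x p r) ∧
      (∀ i < σ.v 5 * 10, σ'.a 7 i = σ.a 7 i) ∧ t ≤ 2 * k + 1 := by
  induction k with
  | zero => simp [writeCands, Tr.skip]
  | succ k ih =>
    rw [writeCands, Tr.seq]
    refine ih.conseq ?_
    rintro σ' t hF ⟨h1, h2, ht⟩
    obtain ⟨w1, w2⟩ := wv_writeCands e g k
    have hv : σ'.v = σ.v := funext fun y => hF.1 y (by simp [w1])
    have ha : ∀ t, t ≠ 7 → σ'.a t = σ.a t := fun t ht => hF.2 t fun h => ht (w2 t h)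
    obtain ⟨hr, v3, e4, ev, eh, ep⟩ := hF.ready h (by simp [w1]) (by simp [w1]) (by simp [w1])
      (fun t ht => by rw [w2 t ht]; decide)
    have ed : (distS σ' : Fin n → Fin n → ℕ) = distS σ :=
      distS_congr v3 e4 ev eh ep (ha 6 (by decide))
    rw [Tr.wr]
    have hp' : p < σ'.v 3 := by rwa [v3]
    have q0 : (wE g 0).eval σ' = ((vertS σ' p 0 : Fin n) : ℕ) := by
      simp only [eval_wE, Ex.eval_ofNat, hg σ' hv, hr.vert_val hp' (Nat.zero_le _)]
    have q1 : (wE g (rd 4 g)).eval σ' = ((vertS σ' p (σ'.a 4 p) : Fin n) : ℕ) := by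
      simp only [eval_wE, Ex.eval_rd, hg σ' hv, hr.vert_val hp' le_rfl]
    have key : (wE g (minE (rd 4 g) (candE (distE e (wE g 0)) (distE e (wE g (rd 4 g))) (rd 4 g)
        (rd 2 e) k))).eval σ' = candS σ x p k := by
      rw [eval_wE, eval_minE, eval_candE, hr.eval_distE (he σ' hv) q0, hr.eval_distE (he σ' hv) q1]
      simp only [Ex.eval_rd, hg σ' hv, he σ' hv]
      rw [← hr.vert_val hp' (min_le_left _ _), candS]
      simp only [ed, ev, e4, ha 2 (by decide)]
      rfl
    rw [key]
    refine ⟨(Fin.is_lt _).le.trans hX, ?_, ?_, by omega⟩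
    · intro r hr
      simp only [HS.sa_a, if_true, Ex.eval_add, Ex.eval_mul, Ex.eval_v, Ex.eval_ofNat, hv, Function.update_apply]
      rcases Nat.lt_succ_iff_lt_or_eq.1 hr with hr | rfl
      · rw [if_neg, h1 r hr]
        simp only [Ex.eval]; omega
      · exact if_pos rfl
    · intro i hi
      simp only [HS.sa_a, if_true, Ex.eval_add, Ex.eval_mul, Ex.eval_v, Ex.eval_ofNat, hv, Function.update_apply]
      rw [if_neg, h2 i hi]
      simp only [Ex.eval]; omega

theorem fillTable_spec (hX : n * n ≤ X) (h : Ready G σ) :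
    Tr I E X fillTable σ fun σ' t =>
      (∀ (x : Fin n), ∀ g < σ.v 3, ∀ r < 10, σ'.a 7 (x * (σ.v 3 * 10) + (g * 10 + r)) = candS σ x g r) ∧
      t ≤ n * σ.v 3 * 22 + 1 := by
  set P := σ.v 3 with hP
  have hnX : n ≤ X := (Nat.le_mul_self n).trans hX
  have hwv := wv_writeCands (v 5 / v 3) (modE (v 5) (v 3)) 10
  have hwa : ∀ t ∈ fillTable.wa, t = 7 := hwv.2
  have hvv : fillTable.wv = [5] := by simp [fillTable, Stmt.wv, hwv.1]
  refine Tr.rep_le (fun j σ' => ∀ (x : Fin n), ∀ g < P, ∀ r < 10, x * P + g < j →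
    σ'.a 7 ((x * P + g) * 10 + r) = candS σ x g r) 21 ?_ ?_ ?_ ?_
  · simp only [Ex.eval_mul, Ex.eval_v, h.size]
    exact (Nat.mul_le_mul_left _ h.pieces_le).trans hX
  · intros; omega
  · rintro j hj σ' hF hT
    simp only [Ex.eval_mul, Ex.eval_v, h.size, ← hP] at hj
    have hP0 : 0 < P := by
      by_contra h0
      obtain h0 : P = 0 := by omega
      simp [h0] at hj
    have ha : ∀ t, t ≠ 7 → σ'.a t = σ.a t := fun t ht => hF.2 t fun h => ht (hwa t h)
    obtain ⟨hr, v3, e4, ev, eh, ep⟩ := Fr.ready (s := fillTable) (σ' := σ'.sv 5 j)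
      ⟨fun y hy => by
        rw [HS.sv_v, if_neg (by simpa [hvv] using hy), hF.1 y hy],
        fun t ht => hF.2 t ht⟩ h (by simp [hvv]) (by simp [hvv])
      (by simp [hvv]) (fun t ht => by rw [hwa t ht]; decide)
    have ed : (distS (σ'.sv 5 j) : Fin n → Fin n → ℕ) = distS σ :=
      distS_congr v3 e4 ev eh ep (ha 6 (by decide))
    have hx : j / P < n := by rwa [Nat.div_lt_iff_lt_mul hP0]
    have hg : j % P < P := Nat.mod_lt _ hP0
    have v3' : σ'.v 3 = P := by simpa using v3
    refine (writeCands_spec hnX hr ⟨j / P, hx⟩ (p := j % P) (by rw [v3]; exact hg) ?_ ?_ 10).conseq ?_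
    · intro τ hτ
      simp only [Ex.eval_div, Ex.eval_v, hτ]
      simp [v3']
    · intro τ hτ
      simp only [eval_modE, Ex.eval_v, hτ]
      simp [v3']
    · rintro σ'' t - ⟨h1, h2, ht⟩
      simp only [HS.sv_v, if_true] at h1 h2
      refine ⟨?_, by omega⟩
      intro x g hg' r hr' hlt
      rcases Nat.lt_succ_iff_lt_or_eq.1 hlt with hlt | rfl
      · rw [h2 _ (by omega), HS.sv_a]
        exact hT x g hg' r hr' hlt
      · rw [h1 r hr']
        have d1 : (x * P + g) / P = x := by
          rw [mul_comm, Nat.mul_add_div hP0, Nat.div_eq_of_lt hg', add_zero]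
        have m1 : (x * P + g) % P = g := by rw [Nat.mul_add_mod', Nat.mod_eq_of_lt hg']
        simp only [candS, ed, ev, e4, ep, d1, m1]
  · rintro σ' t hF hT ht
    simp only [Ex.eval_mul, Ex.eval_v, h.size, ← hP] at hT ht
    refine ⟨fun x g hg r hr => ?_, by omega⟩
    rw [← hT x g hg r hr]
    · congr 1; ring
    · have := Nat.mul_le_mul_right P (Nat.succ_le_of_lt x.2)
      rw [Nat.succ_mul] at this; omega

/-- The computed distances are correct. -/
structure DistOk (G : SimpleGraph (Fin n)) (σ : HS) : Prop where
  eq : ∀ x y : Fin n, G.Reachable x y → distS σ x y = G.dist x y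
  le : ∀ x y : Fin n, ¬ G.Reachable x y → n ≤ distS σ x y

/-- A computed distance is below `n` exactly for connected pairs, so three comparisons with `n`
decide whether the quadruple lies in one component. -/
theorem testQuad_spec (h : Ready G σ) (hd : DistOk G σ) {a b c d : Fin n} (ha : σ.v 10 = a)
    (hb : σ.v 11 = b) (hc : σ.v 6 = c) (hd' : σ.v 7 = d) (h0 : σ.v 0 ≤ 1) :
    Tr I E X testQuad σ fun σ' t => (σ'.v 0 ≤ 1 ∧
      (σ'.v 0 = 0 ↔ σ.v 0 = 0 ∨ Violates G (σ.a 0 1) a b c d)) ∧ t ≤ 5 := by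
  have hR : ∀ x y : Fin n, distS σ x y < n ↔ G.Reachable x y := by
    intro x y
    constructor
    · intro hlt
      by_contra hr
      have := hd.le x y hr
      omega
    · intro hr
      rw [hd.eq x y hr]
      exact dist_lt G x y
  have eab := h.eval_distE (e := v 10) (f := v 11) ha hb
  have eac := h.eval_distE (e := v 10) (f := v 6) ha hc
  have ead := h.eval_distE (e := v 10) (f := v 7) ha hd'
  have ebc := h.eval_distE (e := v 11) (f := v 6) hb hc
  have ebd := h.eval_distE (e := v 11) (f := v 7) hb hd'
  have ecd := h.eval_distE (e := v 6) (f := v 7) hc hd'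
  simp only [testQuad, Tr.ite, Tr.skip, Tr.asg, eval_maxE, Ex.eval_add, eab, eac, ead, ebc, ebd, ecd,
    Ex.eval_v, Ex.eval_rd, Ex.eval_ofNat, h.size, hR, HS.sv_v, if_true]
  refine ⟨fun h1 => ⟨fun h2 => ⟨fun h3 => ?_, fun h3 => ?_⟩, fun h2 => ?_⟩, fun h1 => ?_⟩
  · rw [hd.eq _ _ h1, hd.eq _ _ h2, hd.eq _ _ h3, hd.eq _ _ (h1.symm.trans h2),
      hd.eq _ _ (h1.symm.trans h3), hd.eq _ _ (h2.symm.trans h3)]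
    refine ⟨fun hlt => ⟨by omega, ⟨by omega, ?_⟩, by omega⟩, fun hlt => ⟨⟨h0, ?_⟩, by omega⟩⟩
    · exact ⟨fun _ => .inr ⟨⟨h1, h2, h3⟩, hlt⟩, fun _ => trivial⟩
    · exact ⟨.inl, fun h => h.resolve_right fun hv => hlt hv.2⟩
  · exact ⟨⟨h0, .inl, fun h => h.resolve_right fun hv => h3 hv.1.2.2⟩, by omega⟩
  · exact ⟨⟨h0, .inl, fun h => h.resolve_right fun hv => h2 hv.1.2.1⟩, by omega⟩
  · exact ⟨⟨h0, .inl, fun h => h.resolve_right fun hv => h1 hv.1.1⟩, by omega⟩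

/-- The quadruple encoded by `j` violates the four-point condition. -/
def Hit (G : SimpleGraph (Fin n)) (δ K : ℕ) (T : ℕ → ℕ) (j : ℕ) : Prop :=
  ∃ c d u a b : Fin n, j / K / K / K / K = c ∧ T (c * K + j / K / K / K % K) = d ∧
    T (c * K + j / K / K % K) = u ∧ T (u * K + j / K % K) = a ∧ T (a * K + j % K) = b ∧
    Violates G δ a b c d

/-- The loop index is read in base `K`: the leading part is the vertex `c`, the four digits select
table entries for `d`, `u`, `a` and `b`. -/
theorem searchBody_spec (h : Ready G σ) (hd : DistOk G σ) {K : ℕ} (hK : K = σ.v 3 * 10)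
    (hnX : n ≤ X) (hT : ∀ x : Fin n, ∀ o < K, σ.a 7 (x * K + o) < n) (hj : σ.v 5 < n * K * K * K * K)
    (h0 : σ.v 0 ≤ 1) :
    Tr I E X (searchBody (v 3 * 10)) σ fun σ' t => (σ'.v 0 ≤ 1 ∧
      (σ'.v 0 = 0 ↔ σ.v 0 = 0 ∨ Hit G (σ.a 0 1) K (σ.a 7) (σ.v 5))) ∧ t ≤ 10 := by
  have hK0 : 0 < K := by
    by_contra h0
    obtain h0 : K = 0 := by omega
    simp [h0] at hj
  have hmod : ∀ i, i % K < K := fun i => Nat.mod_lt _ hK0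
  set j := σ.v 5 with hjdef
  obtain ⟨c, hc⟩ : ∃ c : Fin n, j / K / K / K / K = c := ⟨⟨_, by
    rwa [Nat.div_lt_iff_lt_mul hK0, Nat.div_lt_iff_lt_mul hK0, Nat.div_lt_iff_lt_mul hK0,
      Nat.div_lt_iff_lt_mul hK0]⟩, rfl⟩
  obtain ⟨d, hd'⟩ : ∃ d : Fin n, σ.a 7 (c * K + j / K / K / K % K) = d := ⟨⟨_, hT c _ (hmod _)⟩, rfl⟩
  obtain ⟨u, hu⟩ : ∃ u : Fin n, σ.a 7 (c * K + j / K / K % K) = u := ⟨⟨_, hT c _ (hmod _)⟩, rfl⟩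
  obtain ⟨a, ha⟩ : ∃ a : Fin n, σ.a 7 (u * K + j / K % K) = a := ⟨⟨_, hT u _ (hmod _)⟩, rfl⟩
  obtain ⟨b, hb⟩ : ∃ b : Fin n, σ.a 7 (a * K + j % K) = b := ⟨⟨_, hT a _ (hmod _)⟩, rfl⟩
  have hhit : Hit G (σ.a 0 1) K (σ.a 7) j ↔ Violates G (σ.a 0 1) a b c d := by
    constructor
    · rintro ⟨c', d', u', a', b', q1, q2, q3, q4, q5, hv⟩
      obtain rfl : c = c' := Fin.ext (hc.symm.trans q1)
      obtain rfl : d = d' := Fin.ext (hd'.symm.trans q2)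
      obtain rfl : u = u' := Fin.ext (hu.symm.trans q3)
      obtain rfl : a = a' := Fin.ext (ha.symm.trans q4)
      obtain rfl : b = b' := Fin.ext (hb.symm.trans q5)
      exact hv
    · exact fun hv => ⟨c, d, u, a, b, hc, hd', hu, ha, hb, hv⟩
  rw [hhit]
  simp only [searchBody, Tr.seq, Tr.asg, eval_modE, Ex.eval_rd, Ex.eval_add, Ex.eval_mul, Ex.eval_div,
    Ex.eval_v, Ex.eval_ofNat, HS.sv_v, HS.sv_a, if_true, if_false, (by decide : ¬ (3 = 6)),
    (by decide : ¬ (3 = 7)), (by decide : ¬ (3 = 8)), (by decide : ¬ (3 = 10)), (by decide : ¬ (5 = 6)),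
    (by decide : ¬ (5 = 7)), (by decide : ¬ (5 = 8)), (by decide : ¬ (5 = 10)), (by decide : ¬ (6 = 7)),
    ← hK, ← hjdef, hc, hd', hu, ha, hb]
  refine ⟨c.2.le.trans hnX, d.2.le.trans hnX, u.2.le.trans hnX, a.2.le.trans hnX, b.2.le.trans hnX, ?_⟩
  have hr : Ready G (((((σ.sv 6 c).sv 7 d).sv 8 u).sv 10 a).sv 11 b) :=
    h.congr (by simp) (by simp) (by simp) fun _ _ => rfl
  have ed : (distS (((((σ.sv 6 c).sv 7 d).sv 8 u).sv 10 a).sv 11 b) : Fin n → Fin n → ℕ) = distS σ :=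
    distS_congr (by simp) rfl rfl rfl rfl rfl
  refine (testQuad_spec (a := a) (b := b) (c := c) (d := d) hr ⟨by rw [ed]; exact hd.eq, by rw [ed]; exact hd.le⟩
    (by simp) (by simp) (by simp) (by simp) (by simpa using h0)).conseq ?_
  rintro σ' t - ⟨⟨h1, h2⟩, ht⟩
  refine ⟨⟨h1, ?_⟩, by omega⟩
  simpa using h2

theorem search_spec (h : Ready G σ) (hd : DistOk G σ) {K : ℕ} (hK : K = σ.v 3 * 10)
    (hX : n * K * K * K * K ≤ X) (hnX : n ≤ X) (hT : ∀ x : Fin n, ∀ o < K, σ.a 7 (x * K + o) < n) :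
    Tr I E X search σ fun σ' t => (σ'.v 0 ≤ 1 ∧
      (σ'.v 0 = 0 ↔ ∃ j < n * K * K * K * K, Hit G (σ.a 0 1) K (σ.a 7) j)) ∧
      t ≤ n * K * K * K * K * 11 + 2 := by
  simp only [search, Tr.seq]
  rw [Tr.asg]
  have hn0 := NeZero.pos n
  refine ⟨by simp; omega, ?_⟩
  have hN : (v 1 * (v 3 * 10) * (v 3 * 10) * (v 3 * 10) * (v 3 * 10) : Ex).eval
      (σ.sv 0 (Ex.eval 1 σ)) = n * K * K * K * K := by
    simp [h.size, hK]
  have := Tr.rep_search (I := I) (E := E) (X := X) (x := 5) (r := 0)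
    (e := v 1 * (v 3 * 10) * (v 3 * 10) * (v 3 * 10) * (v 3 * 10)) (s := searchBody (v 3 * 10))
    (σ := σ.sv 0 (Ex.eval 1 σ)) (Hit G (σ.a 0 1) K (σ.a 7)) 10 (by rw [hN]; exact hX) (by simp) ?_
  · rw [hN] at this
    refine this.conseq ?_
    rintro σ' t - ⟨⟨h1, h2⟩, ht⟩
    refine ⟨⟨h1, ?_⟩, by omega⟩
    simpa using h2
  · rw [hN]
    intro j hj σ' hF h0
    obtain ⟨hr, v3, e4, ev, eh, ep⟩ := hF.ready (h.congr (σ' := σ.sv 0 (Ex.eval 1 σ)) (by simp) (by simp)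
      (by simp) fun _ _ => rfl) (by decide) (by decide) (by decide) (by decide)
    have v3' : σ'.v 3 = σ.v 3 := by simpa using v3
    have e7 : σ'.a 7 = σ.a 7 := hF.2 7 (by decide)
    have e0 : σ'.a 0 = σ.a 0 := hF.2 0 (by decide)
    have ed : (distS (σ'.sv 5 j) : Fin n → Fin n → ℕ) = distS σ :=
      distS_congr (by simpa using v3') e4 ev eh ep (hF.2 6 (by decide))
    refine (searchBody_spec (σ := σ'.sv 5 j) (K := K) (hr.congr (by simp) (by simp) (by simp) fun _ _ => rfl)
      ⟨by rw [ed]; exact hd.eq, by rw [ed]; exact hd.le⟩ (by simp [hK, v3']) hnX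
      (by simpa [e7] using hT) (by simpa using hj) (by simpa using h0)).conseq ?_
    rintro σ'' t - h'
    simpa [e0, e7] using h'

end

end HypRAM
namespace HypRAM

/-! ### The algorithm -/

theorem exists_decode {n K : ℕ} {c o₁ o₂ o₃ o₄ : ℕ} (hc : c < n) (h₁ : o₁ < K) (h₂ : o₂ < K)
    (h₃ : o₃ < K) (h₄ : o₄ < K) : ∃ j < n * K * K * K * K, j / K / K / K / K = c ∧
      j / K / K / K % K = o₁ ∧ j / K / K % K = o₂ ∧ j / K % K = o₃ ∧ j % K = o₄ := by
  have hK : 0 < K := by omega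
  have lt : ∀ {a b o : ℕ}, a < b → o < K → a * K + o < b * K := fun {a b o} ha ho => by
    have := Nat.mul_le_mul_right K (Nat.succ_le_of_lt ha)
    rw [Nat.succ_mul] at this; omega
  have dv : ∀ {a o : ℕ}, o < K → (a * K + o) / K = a := fun {a o} ho => by
    rw [mul_comm, Nat.mul_add_div hK, Nat.div_eq_of_lt ho, add_zero]
  have md : ∀ {a o : ℕ}, o < K → (a * K + o) % K = o := fun {a o} ho => by
    rw [Nat.mul_add_mod', Nat.mod_eq_of_lt ho]
  refine ⟨(((c * K + o₁) * K + o₂) * K + o₃) * K + o₄, lt (lt (lt (lt hc h₁) h₂) h₃) h₄, ?_⟩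
  simp only [dv h₄, dv h₃, dv h₂, dv h₁, md h₄, md h₃, md h₂, md h₁, and_self]

section

variable {n : ℕ} {G : SimpleGraph (Fin n)} [DecidableRel G.Adj] [NeZero n] {σ : HS}

/-- The relation computed by `candS`. -/
def CandS (σ : HS) : Fin n → Fin n → Prop :=
  Cand (σ.v 3) (σ.a 4) (vertS σ) (posS σ) (distS σ)

omit [DecidableRel G.Adj] in
-- The row of `x` in the table enumerates `CandS σ x`, with `10 * g + r` as the number of candidate
-- `r` on piece `g`.
theorem exists_hit_iff {P δ : ℕ} {T : ℕ → ℕ} (hP : P = σ.v 3)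
    (hT : ∀ x : Fin n, ∀ g < P, ∀ r < 10, T (x * (P * 10) + (g * 10 + r)) = candS σ x g r) :
    (∃ j < n * (P * 10) * (P * 10) * (P * 10) * (P * 10), Hit G δ (P * 10) T j) ↔
      Found G (CandS σ) δ := by
  have hF : ∀ x y : Fin n, CandS σ x y ↔ ∃ o < P * 10, T (x * (P * 10) + o) = y := by
    intro x y
    constructor
    · rintro ⟨g, hg, r, hr, rfl⟩
      rw [← hP] at hg
      exact ⟨g * 10 + r, by omega, hT x g hg r hr⟩
    · rintro ⟨o, ho, h⟩
      have := hT x (o / 10) (by omega) (o % 10) (by omega)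
      rw [Nat.div_add_mod', h] at this
      exact ⟨o / 10, by omega, o % 10, by omega, Fin.ext this⟩
  constructor
  · rintro ⟨j, hj, c, d, u, a, b, -, h1, h2, h3, h4, hv⟩
    have hK : 0 < P * 10 := by
      by_contra h0
      obtain h0 : P * 10 = 0 := by omega
      simp [h0] at hj
    exact ⟨c, d, u, a, b, (hF _ _).2 ⟨_, Nat.mod_lt _ hK, h1⟩, (hF _ _).2 ⟨_, Nat.mod_lt _ hK, h2⟩,
      (hF _ _).2 ⟨_, Nat.mod_lt _ hK, h3⟩, (hF _ _).2 ⟨_, Nat.mod_lt _ hK, h4⟩, hv⟩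
  · rintro ⟨c, d, u, a, b, h1, h2, h3, h4, hv⟩
    obtain ⟨o₁, l₁, h1⟩ := (hF _ _).1 h1
    obtain ⟨o₂, l₂, h2⟩ := (hF _ _).1 h2
    obtain ⟨o₃, l₃, h3⟩ := (hF _ _).1 h3
    obtain ⟨o₄, l₄, h4⟩ := (hF _ _).1 h4
    obtain ⟨j, hj, e0, e1, e2, e3, e4⟩ := exists_decode c.2 l₁ l₂ l₃ l₄
    exact ⟨j, hj, c, d, u, a, b, e0, by rw [e1, h1], by rw [e2, h2], by rw [e3, h3], by rw [e4, h4], hv⟩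

/-- `Found` contains a violation, so one direction is immediate; the other is `Crit.found`. -/
theorem found_iff (h : Ready G σ) (hd : DistOk G σ) {δ : ℕ} :
    Found G (CandS σ) δ ↔ ¬ IsHyperbolic G δ := by
  rw [isHyperbolic_iff_not_violates]
  push Not
  constructor
  · rintro ⟨c, d, u, a, b, -, -, -, -, hv⟩
    exact ⟨a, b, c, d, hv⟩
  · exact fun hv => (h.dec.crit_cand hd.eq).found h.dec hv

end

/-- The algorithm. -/
def algorithm : Stmt := .seq readInput (.seq passOne (.seq passTwo (.seq passThree
  (.seq fillMat (.seq fillTable search)))))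

section

variable {n : ℕ} {G : SimpleGraph (Fin n)} [DecidableRel G.Adj] [NeZero n]
  {adj : Fin n → List (Fin n)} {δ X : ℕ}

theorem algorithm_spec (hadj : IsAdjLists G adj) (hl : (encode adj δ).length + δ ≤ X)
    (hX2 : (n + 2) * (n + 2) ≤ X) (hX3 : n * n * n ≤ X)
    (hX5 : n * (n * 10) * (n * 10) * (n * 10) * (n * 10) ≤ X) :
    Tr (fun i => (encode adj δ).getD i 0) (encode adj δ).length X algorithm
      ⟨fun _ => 0, fun _ _ => 0⟩ fun σ t => (IsHyperbolic G δ → σ.v 0 = 1) ∧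
      (¬ IsHyperbolic G δ → σ.v 0 = 0) ∧ ∀ k : ℕ, coverNumber G = k →
        1 ≤ k ∧ t ≤ 20000000 * (k ^ 4 * (n + G.edgeFinset.card)) := by
  have hn0 := NeZero.pos n
  have hlen := hadj.length_encode (δ := δ)
  have hnn : n * n ≤ X := (Nat.le_mul_of_pos_right _ hn0).trans hX3
  have hnX : n ≤ X := (Nat.le_mul_self n).trans hnn
  rw [algorithm, Tr.seq]
  refine (readInput_spec (by omega) (fun i => (encode_le i).trans hl) encode_end
    (by rw [encode_zero]; omega)).conseq ?_
  rintro σ₁ t₁ - ⟨hn, h3, h4, h0, hz, ht₁⟩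
  rw [encode_zero] at hn
  have hg : GrRep G (σ₁.a 0) := by rw [h0]; exact hadj.grRep
  have hδ : σ₁.a 0 1 = δ := by rw [h0]; exact encode_one
  rw [Tr.seq]
  refine (passOne_spec (G := G) hX2 hn h3 h4 hz).conseq ?_
  rintro σ₂ t₂ hF ⟨ht₂, hM⟩
  have hn₂ : σ₂.v 1 = n := by rw [hF.1 1 (by decide), hn]
  have h0₂ : σ₂.a 0 = σ₁.a 0 := hF.2 0 (by decide)
  have h6₂ : σ₂.a 6 = fun _ => 0 := by rw [hF.2 6 (by decide), hz 6 (by decide)]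
  rw [Tr.seq]
  refine (passTwo_spec hX2 (by rwa [h0₂]) hn₂ hM).conseq ?_
  rintro σ₃ t₃ hF ⟨hM, hnb, ht₃⟩
  have hn₃ : σ₃.v 1 = n := by rw [hF.1 1 (by decide), hn₂]
  have h0₃ : σ₃.a 0 = σ₂.a 0 := hF.2 0 (by decide)
  have h6₃ : σ₃.a 6 = fun _ => 0 := by rw [hF.2 6 (by decide), h6₂]
  rw [Tr.seq]
  refine (passThree_spec hX2 hn₃ hM (by rwa [h0₃])).conseq ?_
  rintro σ₄ t₄ hF ⟨ht₄, hD, hP⟩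
  have h0₄ : σ₄.a 0 = σ₁.a 0 := by rw [hF.2 0 (by decide), h0₃, h0₂]
  have h6₄ : σ₄.a 6 = fun _ => 0 := by rw [hF.2 6 (by decide), h6₃]
  have hr₄ : Ready G σ₄ := ⟨by rwa [h0₄], by rw [hF.1 1 (by decide), hn₃], hD⟩
  clear hF
  rw [Tr.seq]
  refine (fillMat_spec hX3 hr₄ h6₄).conseq ?_
  rintro σ₅ t₅ hF ⟨hm, ht₅⟩
  obtain ⟨hr₅, v3, e4, ev, eh, ep⟩ := hF.ready hr₄ (by decide) (by decide) (by decide) (by decide)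
  have h0₅ : σ₅.a 0 = σ₁.a 0 := by rw [hF.2 0 (by decide), h0₄]
  rw [← e4, ← eh, ← v3] at hm
  have hd₅ : DistOk G σ₅ :=
    ⟨fun x y h => hr₅.dec.dhat_eq (dist_lt G) hm h, fun x y h => hr₅.dec.le_dhat hm h⟩
  rw [← v3] at ht₅ hP
  clear hF v3 e4 ev eh ep
  rw [Tr.seq]
  refine (fillTable_spec hnn hr₅).conseq ?_
  rintro σ₆ t₆ hF ⟨hT, ht₆⟩
  obtain ⟨hr₆, v3, e4, ev, eh, ep⟩ := hF.ready hr₅ (by decide) (by decide) (by decide) (by decide)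
  have h0₆ : σ₆.a 0 = σ₁.a 0 := by rw [hF.2 0 (by decide), h0₅]
  have ed : (distS σ₆ : Fin n → Fin n → ℕ) = distS σ₅ :=
    distS_congr v3 e4 ev eh ep (hF.2 6 (by decide))
  have hd₆ : DistOk G σ₆ := ⟨by rw [ed]; exact hd₅.eq, by rw [ed]; exact hd₅.le⟩
  clear hF
  have hPn := hr₅.pieces_le
  have hP0 : 0 < σ₅.v 3 := (Nat.zero_le _).trans_lt (hr₅.dec.home_lt 0)
  set P := σ₅.v 3
  refine (search_spec (K := P * 10) hr₆ hd₆ (by rw [v3]) (le_trans ?_ hX5) hnX ?_).conseq ?_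
  · gcongr
  · intro x o ho
    have := hT x (o / 10) (by omega) (o % 10) (by omega)
    rw [Nat.div_add_mod'] at this
    rw [this]; exact Fin.is_lt _
  rintro σ₇ t₇ - ⟨⟨h1, h2⟩, ht₇⟩
  rw [exists_hit_iff (σ := σ₅) rfl hT, found_iff hr₅ hd₅, h0₆, hδ] at h2
  refine ⟨fun hy => ?_, h2.2, fun k hk => ?_⟩
  · have : σ₇.v 0 ≠ 0 := fun h => h2.1 h hy
    omega
  · have hPk := hr₅.dec.pieces_le hr₅.tight hk
    refine ⟨by omega, ?_⟩
    -- As `P` and `n` are positive, every summand of the running time is dominated by `P ^ 4 * (n +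
    -- m)`. The largest coefficient, 110000, comes from the search with `K = 10 * P` and eleven
    -- steps per quadruple; passing from `P` to `k` costs the factor 81.
    have p1 : P ≤ P ^ 4 := Nat.le_self_pow (by omega) P
    have p2 : P * P ≤ P ^ 4 := by rw [← sq]; exact Nat.pow_le_pow_right hP0 (by omega)
    have p3 : P * P * P ≤ P ^ 4 := by rw [← sq, ← pow_succ]; exact Nat.pow_le_pow_right hP0 (by omega)
    have p4 : 1 ≤ P ^ 4 := Nat.one_le_pow _ _ hP0
    have p5 : P ^ 4 ≤ 81 * k ^ 4 :=
      (Nat.pow_le_pow_left hPk 4).trans (by rw [Nat.mul_pow])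
    have q1 := Nat.mul_le_mul_left n p1
    have q3 := Nat.mul_le_mul_left n p3
    have q4 := Nat.mul_le_mul_left n p4
    have q5 := Nat.mul_le_mul_left G.edgeFinset.card p4
    have q6 := Nat.mul_le_mul_right (P ^ 4) (Nat.succ_le_of_lt hn0)
    have r3 := Nat.mul_le_mul_left (7 * n + 10) hP
    have r4 : (7 * n + 10) * P = 7 * (n * P) + 10 * P := by ring
    have s1 : n * (2 * (P * P * P)) = 2 * (n * (P * P * P)) := by ring
    have s2 : n * P * 22 = 22 * (n * P) := by ring
    have s3 : n * (P * 10) * (P * 10) * (P * 10) * (P * 10) * 11 = 110000 * (n * P ^ 4) := by ring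
    rw [s1] at ht₅
    rw [s2] at ht₆
    rw [s3] at ht₇
    have u1 := Nat.mul_le_mul_left (n + G.edgeFinset.card) p5
    have u2 : (n + G.edgeFinset.card) * (81 * k ^ 4) = 81 * (k ^ 4 * (n + G.edgeFinset.card)) := by ring
    have u3 : (n + G.edgeFinset.card) * P ^ 4 = n * P ^ 4 + G.edgeFinset.card * P ^ 4 := by ring
    rw [u2, u3] at u1
    generalize k ^ 4 * (n + G.edgeFinset.card) = Z at *
    generalize n * P ^ 4 = A at *
    generalize G.edgeFinset.card * P ^ 4 = B at *
    generalize n * P = a1 at *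
    generalize n * (P * P * P) = a2 at *
    generalize P * P = a3 at *
    omega

end

end HypRAM

/-! ### The main theorem -/

/-- There is one word RAM program that solves the problem "given a graph `G` (by adjacency
lists) and a positive integer `δ`, is `G` `δ`-hyperbolic?" with words of `O(log (n + m + δ))`
bits, and takes at most `C * k ^ 4 * (n + m)` steps whenever the minimum maximal paths cover
number `k` of `G` exists. -/
theorem mainTheorem1 :
    ∃ (p : HypRAM.Prog) (c C : ℕ),
      ∀ (n : ℕ) (G : SimpleGraph (Fin n)) [DecidableRel G.Adj]
        (adj : Fin n → List (Fin n)) (δ : ℕ),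
        0 < n → 0 < δ → HypRAM.IsAdjLists G adj →
        ∃ (t : ℕ) (s : HypRAM.State),
          HypRAM.Exec ((n + G.edgeFinset.card + δ) ^ c) p
            (HypRAM.initState (HypRAM.encode adj δ)) t s ∧
          (HypRAM.IsHyperbolic G δ → s.reg 0 = 1) ∧
          (¬ HypRAM.IsHyperbolic G δ → s.reg 0 = 0) ∧
          ∀ k : ℕ, HypRAM.coverNumber G = (k : ℕ∞) →
            t ≤ C * k ^ 4 * (n + G.edgeFinset.card) := by
  -- Naming the algorithm opaquely keeps its size and time factor from being unfolded.
  obtain ⟨S, hS⟩ : ∃ S, S = HypRAM.algorithm := ⟨_, rfl⟩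
  -- With `N = n + m + δ`, all variables and array cells stay below `X = N ^ 20`, and the compiled
  -- code stays below `X ^ S.sz`.
  refine ⟨S.prog, 20 * S.sz + 20, S.factor * 20000000 + 5, ?_⟩
  intro n G _ adj δ hn hδ hadj
  have : NeZero n := ⟨hn.ne'⟩
  have hlen := hadj.length_encode (δ := δ)
  set m := G.edgeFinset.card
  set N := n + m + δ with hN
  -- Both `n` and `δ` are positive, so constant factors can be absorbed into powers of `N`.
  have hN2 : 2 ≤ N := by omega
  have hnN : n ≤ N := by omega
  have hpow : ∀ a b, a ≤ b → N ^ a ≤ N ^ b := fun a b h => Nat.pow_le_pow_right (by omega) h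
  have h4 : 4 ≤ N ^ 2 := Nat.pow_le_pow_left hN2 2
  have hX1 : 4 * N ≤ N ^ 20 :=
    calc 4 * N ≤ N ^ 2 * N := Nat.mul_le_mul_right _ h4
      _ = N ^ 3 := by ring
      _ ≤ _ := hpow _ _ (by omega)
  have hX2 : (n + 2) * (n + 2) ≤ N ^ 20 :=
    calc (n + 2) * (n + 2) ≤ (N + N) * (N + N) := Nat.mul_le_mul (by omega) (by omega)
      _ = 4 * N ^ 2 := by ring
      _ ≤ N ^ 2 * N ^ 2 := Nat.mul_le_mul_right _ h4
      _ = N ^ 4 := by ring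
      _ ≤ _ := hpow _ _ (by omega)
  have hX3 : n * n * n ≤ N ^ 20 :=
    calc n * n * n = n ^ 3 := by ring
      _ ≤ N ^ 3 := Nat.pow_le_pow_left hnN 3
      _ ≤ _ := hpow _ _ (by omega)
  have hX5 : n * (n * 10) * (n * 10) * (n * 10) * (n * 10) ≤ N ^ 20 :=
    calc n * (n * 10) * (n * 10) * (n * 10) * (n * 10) = 10000 * n ^ 5 := by ring
      _ ≤ 2 ^ 14 * n ^ 5 := Nat.mul_le_mul_right _ (by norm_num)
      _ ≤ N ^ 14 * N ^ 5 := Nat.mul_le_mul (Nat.pow_le_pow_left hN2 14) (Nat.pow_le_pow_left hnN 5)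
      _ = N ^ 19 := by ring
      _ ≤ _ := hpow _ _ (by omega)
  have hl : (HypRAM.encode adj δ).length + δ ≤ N ^ 20 := by
    refine le_trans ?_ hX1
    omega
  generalize hX : N ^ 20 = X at hX1 hX2 hX3 hX5 hl
  replace hX := hX.symm
  obtain ⟨t, s, σ, t', hE, ⟨h1, h0, ht'⟩, ht, hs⟩ := HypRAM.Stmt.prog_exec (X := X)
    (B := N ^ (20 * S.sz + 20)) (by omega) (by omega) (fun i _ => (HypRAM.encode_le i).trans hl)
    HypRAM.encode_end (by rw [HypRAM.encode_zero]; omega) (by rw [hX, ← pow_mul]; exact hpow _ _ (Nat.le_add_right _ _))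
    (by rw [hX]; exact hpow _ _ (Nat.le_add_left _ _)) (hS ▸ HypRAM.algorithm_spec hadj hl hX2 hX3 hX5)
  refine ⟨t, s, hE, fun h => by rw [hs, h1 h], fun h => by rw [hs, h0 h], fun k hk => ?_⟩
  obtain ⟨hk1, hk2⟩ := ht' k hk
  -- Since `k` is positive, the five initial steps are absorbed into the bound.
  have hZ : 1 ≤ k ^ 4 * (n + m) := Nat.mul_pos (Nat.pow_pos hk1) (by omega)
  calc t ≤ S.factor * t' + 5 := ht
    _ ≤ S.factor * (20000000 * (k ^ 4 * (n + m))) + 5 * (k ^ 4 * (n + m)) :=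
      Nat.add_le_add (Nat.mul_le_mul_left _ hk2) (by omega)
    _ = _ := by ring
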